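/- Let $N$ and $M$ be two disjoint sets of agents with $|N|=|M|=n$, and let $a\in[0,1)$. At each time step $t=1,2,3,\dots$ every agent $i$ has a value $v_i^t(k)\in\{a,1\}$ for each agent $k$ on the other side, and $v_i^t(k)=v_k^t(i)$ (binary, symmetric, dynamic valuations; they may change arbitrarily over time). At each step a perfect matching $x^t$ between $N$ and $M$ is chosen without knowledge of future valuations; $x^t_i$ is the partner of $i$ in $x^t$, $X^t_j$ is the multiset of the matches of $j$ up to and including step $t$ (each with its time step), and values are additive: $v_i(X^t_j)=\sum_{s\le t}v_i^s(x^s_j)$. The weight of a perfect matching $x$ at step $t$ is $W^t(x)=\frac12\sum_{\{i,k\}\in x}(v_i^t(k)+v_k^t(i))$. The sequence $x^1,x^2,\dots$ is *EF1-over-rounds* if every $x^t$ is a perfect matching and, for every $t\ge 0$ and all agents $i,j$ on the same side with $v_i(X^t_i)<v_i(X^t_j)$, there is a match $k\in X^t_j$ (one occurrence is removed) with $v_i(X^t_i)\ge v_i(X^t_j\setminus\{k\})$. Algorithm: at each step $t$, let $x^t$ be an arbitrary maximum weight perfect matching for the valuations of step $t$; while there are agents $i,j$ on the same side with $v_i(X^t_j)-v_i(X^t_i)>1-a$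 (where $X^t$ includes the tentative $x^t$), choose such a pair and let $i$ and $j$ exchange their partners in $x^t$; then confirm $x^t$. Theorem. Whatever choices are made, the while loop of each time step stops after at most $2n^2$ iterations, so that the algorithm produces an infinite sequence $x^1,x^2,\dots$; every sequence it can produce is EF1-over-rounds, and each $x^t$ is a maximum weight perfect matching for the valuations of step $t$. Moreover, the algorithm can be implemented in time $O(n^{2.5})$ per time step: there are one program for a word RAM (unit-cost operations on words of $O(\log(n+t))$ bits) and a constant $C$ such that, for all $n\ge1$, all $a\in[0,1)$ and all such valuations, the program, which keeps its memory between time steps and receives at step $t$ the $n\times n$ table that tells which of the values of that step are equal to $1$, outputs at each step $t$ a perfect matching $x^t$ after at most $C\,n^{2.5}$ machine steps, and the sequence $x^1,x^2,\dots$ is produced by an execution of the algorithm. -/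

import Mathlib

namespace RepeatedMatching

/-! ## The two-sided market

The agents are the elements of `N ⊕ M`, where `N` and `M` are the two sides. -/

/-- A valuation profile: `v i k` is the value of agent `i` for a match with agent `k`.
Only the values for agents `k` on the other side than `i` are ever used. -/
abbrev Profile (N M : Type*) := N ⊕ M → N ⊕ M → ℝ

/-- A dynamic valuation profile: a profile `v t` for each time step `t = 0, 1, 2, …`. -/
abbrev DynProfile (N M : Type*) := ℕ → Profile N M

/-- A perfect matching between the two sides: every agent has exactly one partner. -/
abbrev PerfectMatching (N M : Type*) := N ≃ M

/-- All values (between the two sides, at all times) lie in `{a, 1}`. -/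
def IsBinary {N M : Type*} (a : ℝ) (v : DynProfile N M) : Prop :=
  ∀ t (i : N) (j : M),
    (v t (.inl i) (.inr j) = a ∨ v t (.inl i) (.inr j) = 1) ∧
    (v t (.inr j) (.inl i) = a ∨ v t (.inr j) (.inl i) = 1)

/-- At all times, any two agents on different sides have the same value for each other. -/
def IsSymmetric {N M : Type*} (v : DynProfile N M) : Prop :=
  ∀ t (i : N) (j : M), v t (.inl i) (.inr j) = v t (.inr j) (.inl i)

/-- Two agents are on the same side of the market. -/
def SameSide {N M : Type*} : N ⊕ M → N ⊕ M → Prop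
  | .inl _, .inl _ => True
  | .inr _, .inr _ => True
  | _, _ => False

/-- The agent with whom agent `i` is matched in `x`. -/
def partner {N M : Type*} (x : PerfectMatching N M) : N ⊕ M → N ⊕ M
  | .inl i => .inr (x i)
  | .inr j => .inl (x.symm j)

/-- The cumulative bundle of agent `i` after the first `t` time steps `0, …, t - 1`:
the multiset of her matches, each of them with the time at which it happened. -/
def bundle {N M : Type*} (x : ℕ → PerfectMatching N M) (t : ℕ) (i : N ⊕ M) :
    Multiset (ℕ × (N ⊕ M)) :=
  (Multiset.range t).map fun s => (s, partner (x s) i)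

/-- The (additive) value of agent `i` for a bundle of dated matches: each match counts with the
value that `i` had for it at its time. -/
def bundleValue {N M : Type*} (v : DynProfile N M) (i : N ⊕ M) (B : Multiset (ℕ × (N ⊕ M))) : ℝ :=
  (B.map fun p => v p.1 i p.2).sum

/-- `v_i(X_j) - v_i(X_i)` for the cumulative matching `X` after the first `t` time steps. -/
def envyGap {N M : Type*} (v : DynProfile N M) (x : ℕ → PerfectMatching N M) (t : ℕ)
    (i j : N ⊕ M) : ℝ :=
  bundleValue v i (bundle x t j) - bundleValue v i (bundle x t i)

/-- The cumulative matching after the first `t` time steps is envy-free up to one match. -/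
def IsEF1 {N M : Type*} [DecidableEq N] [DecidableEq M]
    (v : DynProfile N M) (x : ℕ → PerfectMatching N M) (t : ℕ) : Prop :=
  ∀ i j : N ⊕ M, SameSide i j →
    bundleValue v i (bundle x t i) < bundleValue v i (bundle x t j) →
    ∃ k ∈ bundle x t j,
      bundleValue v i ((bundle x t j).erase k) ≤ bundleValue v i (bundle x t i)

/-- EF1-over-rounds: in each time step every agent is matched exactly once (this is part of the
type of `x`), and the cumulative matching is EF1 after any number of time steps. -/
def EF1OverRounds {N M : Type*} [DecidableEq N] [DecidableEq M]
    (v : DynProfile N M) (x : ℕ → PerfectMatching N M) : Prop :=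
  ∀ t, IsEF1 v x t

/-- The weight of a perfect matching. -/
noncomputable def weight {N M : Type*} [Fintype N] (v : Profile N M)
    (x : PerfectMatching N M) : ℝ :=
  (1 / 2) * ∑ i : N, (v (.inl i) (.inr (x i)) + v (.inr (x i)) (.inl i))

/-- `x` is a maximum weight (perfect) matching. -/
def IsMaxWeight {N M : Type*} [Fintype N] (v : Profile N M) (x : PerfectMatching N M) : Prop :=
  ∀ y : PerfectMatching N M, weight v y ≤ weight v x

/-! ## The algorithm -/

/-- The matching obtained from `y` when two agents on the same side exchange their partners. -/
def swapMatches {N M : Type*} [DecidableEq N] [DecidableEq M] (y : PerfectMatching N M) :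
    N ⊕ M → N ⊕ M → PerfectMatching N M
  | .inl i, .inl j => (Equiv.swap i j).trans y
  | .inr k, .inr l => y.trans (Equiv.swap k l)
  | _, _ => y

/-- One iteration of the while loop of time step `t`, when the matchings `x 0, …, x (t - 1)` have
been confirmed: the tentative matching `y` is changed to `y'` by swapping the matches of two
agents `i`, `j` for which `(i, j)` is not `(1 - a)`-envy-bounded in the cumulative matching that
includes `y`. The value of `x` at `t` and later does not matter. -/
def LoopStep {N M : Type*} [DecidableEq N] [DecidableEq M] (a : ℝ) (v : DynProfile N M)
    (x : ℕ → PerfectMatching N M) (t : ℕ) (y y' : PerfectMatching N M) : Prop :=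
  ∃ i j : N ⊕ M, SameSide i j ∧ 1 - a < envyGap v (Function.update x t y) (t + 1) i j ∧
    y' = swapMatches y i j

/-- `x t` is a possible result of time step `t` of the algorithm after `x 0, …, x (t - 1)`: it is
reached from some maximum weight matching by iterations of the while loop, and the loop stops. -/
def IsAlgStep {N M : Type*} [Fintype N] [DecidableEq N] [DecidableEq M] (a : ℝ)
    (v : DynProfile N M) (x : ℕ → PerfectMatching N M) (t : ℕ) : Prop :=
  ∃ y, IsMaxWeight (v t) y ∧ Relation.ReflTransGen (LoopStep a v x t) y (x t) ∧
    ∀ y', ¬ LoopStep a v x t (x t) y'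

/-- The sequence `x` is produced by an execution of the algorithm. -/
def IsRun {N M : Type*} [Fintype N] [DecidableEq N] [DecidableEq M] (a : ℝ)
    (v : DynProfile N M) (x : ℕ → PerfectMatching N M) : Prop :=
  ∀ t, IsAlgStep a v x t

/-! ## A random access machine with a step count

Programs are while-programs over natural-number registers and arrays. The primitive operations
have unit cost, and only numbers up to a bound `W` can be stored. -/

/-- A memory state: the contents of the registers and of the arrays. -/
structure State where
  reg : ℕ → ℕ
  arr : ℕ → ℕ → ℕ

inductive Expr where
  | const (c : ℕ)
  | reg (r : ℕ)
  | read (A : ℕ) (e : Expr)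
  | add (e₁ e₂ : Expr)
  | sub (e₁ e₂ : Expr)
  | mul (e₁ e₂ : Expr)
  | lt (e₁ e₂ : Expr)

/-- The value of an expression (subtraction is truncated; comparison returns `0` or `1`). -/
def Expr.eval (σ : State) : Expr → ℕ
  | .const c => c
  | .reg r => σ.reg r
  | .read A e => σ.arr A (e.eval σ)
  | .add e₁ e₂ => e₁.eval σ + e₂.eval σ
  | .sub e₁ e₂ => e₁.eval σ - e₂.eval σ
  | .mul e₁ e₂ => e₁.eval σ * e₂.eval σ
  | .lt e₁ e₂ => if e₁.eval σ < e₂.eval σ then 1 else 0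

/-- The number of operations needed to evaluate an expression. -/
def Expr.cost : Expr → ℕ
  | .const _ => 1
  | .reg _ => 1
  | .read _ e => e.cost + 1
  | .add e₁ e₂ => e₁.cost + e₂.cost + 1
  | .sub e₁ e₂ => e₁.cost + e₂.cost + 1
  | .mul e₁ e₂ => e₁.cost + e₂.cost + 1
  | .lt e₁ e₂ => e₁.cost + e₂.cost + 1

inductive Cmd where
  | skip
  | set (r : ℕ) (e : Expr)
  | write (A : ℕ) (idx e : Expr)
  | seq (P Q : Cmd)
  | ite (e : Expr) (P Q : Cmd)
  | while (e : Expr) (P : Cmd)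

/-- Store the number `b` in the register `r`. -/
def State.setReg (σ : State) (r b : ℕ) : State :=
  { σ with reg := Function.update σ.reg r b }

/-- Store the number `b` in the cell `p` of the array `A`. -/
def State.setArr (σ : State) (A p b : ℕ) : State :=
  { σ with arr := Function.update σ.arr A (Function.update (σ.arr A) p b) }

/-- `Exec W P σ k τ`: the program `P`, started in the state `σ`, halts in the state `τ` after
exactly `k` steps, and never stores a number, nor writes to an address, above `W`. -/
inductive Exec (W : ℕ) : Cmd → State → ℕ → State → Prop where
  | skip (σ : State) : Exec W .skip σ 1 σ
  | set (r : ℕ) (e : Expr) (σ : State) (h : e.eval σ ≤ W) :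
      Exec W (.set r e) σ (e.cost + 1) (σ.setReg r (e.eval σ))
  | write (A : ℕ) (idx e : Expr) (σ : State) (hidx : idx.eval σ ≤ W) (h : e.eval σ ≤ W) :
      Exec W (.write A idx e) σ (idx.cost + e.cost + 1) (σ.setArr A (idx.eval σ) (e.eval σ))
  | seq {P Q : Cmd} {σ τ ρ : State} {k l : ℕ} (hP : Exec W P σ k τ) (hQ : Exec W Q τ l ρ) :
      Exec W (.seq P Q) σ (k + l) ρ
  | ite_true {e : Expr} {P Q : Cmd} {σ τ : State} {k : ℕ} (he : e.eval σ ≠ 0)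
      (hP : Exec W P σ k τ) : Exec W (.ite e P Q) σ (e.cost + 1 + k) τ
  | ite_false {e : Expr} {P Q : Cmd} {σ τ : State} {k : ℕ} (he : e.eval σ = 0)
      (hQ : Exec W Q σ k τ) : Exec W (.ite e P Q) σ (e.cost + 1 + k) τ
  | while_true {e : Expr} {P : Cmd} {σ τ ρ : State} {k l : ℕ} (he : e.eval σ ≠ 0)
      (hP : Exec W P σ k τ) (hW : Exec W (.while e P) τ l ρ) :
      Exec W (.while e P) σ (e.cost + 1 + k + l) ρ
  | while_false {e : Expr} {P : Cmd} {σ : State} (he : e.eval σ = 0) :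
      Exec W (.while e P) σ (e.cost + 1) σ

/-- The initial memory: register `0` holds `n`, everything else is `0`. -/
def initState (n : ℕ) : State where
  reg := fun r => if r = 0 then n else 0
  arr := fun _ _ => 0

open Classical in
/-- The table of a symmetric binary profile as an array of bits, row by row: the cell `i * n + j`
holds `1` if agents `i` and `j` have value `1` for each other, and `0` otherwise. -/
noncomputable def valueTable {n : ℕ} (v : Profile (Fin n) (Fin n)) : ℕ → ℕ := fun p =>
  if ∃ i j : Fin n, p = (i : ℕ) * n + (j : ℕ) ∧ v (.inl i) (.inr j) = 1 then 1 else 0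

/-- Put an input table into array `0`; the rest of the memory is kept. -/
def State.load (σ : State) (table : ℕ → ℕ) : State :=
  { σ with arr := Function.update σ.arr 0 table }

/-- The program `P` computes the sequence `x` online, for the dynamic profile `v`, using `T t`
machine steps at time step `t`: it is run once per time step, its memory persists between time
steps, at time step `t` it receives (only) the valuations of that time step in array `0`, and
leaves the matching `x t` in array `1`. Stored numbers are at most `(n + t + 2) ^ c`, that is,
they have `O(log (n + t))` bits. -/
def Computes {n : ℕ} (P : Cmd) (c : ℕ) (v : DynProfile (Fin n) (Fin n))
    (x : ℕ → PerfectMatching (Fin n) (Fin n)) (T : ℕ → ℕ) : Prop :=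
  ∃ σ : ℕ → State, σ 0 = initState n ∧
    ∀ t, Exec ((n + t + 2) ^ c) P ((σ t).load (valueTable (v t))) (T t) (σ (t + 1)) ∧
      ∀ i : Fin n, (σ (t + 1)).arr 1 i = (x t i : ℕ)

end RepeatedMatching

open RepeatedMatching

/-!
Call a match good if it has value `1`. A perfect matching has maximum weight iff it has the maximum
number of good matches, and by König's theorem (`exists_isDual`) this holds iff there is a `0/1`
dual solution `d`: `d i + d k ≥ 1` for all pairs `i, k` of value `1`, and `d i + d k` is `1` or `0`
on the pairs of the matching, according to their value. If `d s` belongs to the matching of time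
`s`, and `potential d x t j` is the sum of the dual values of the partners of `j` before time `t`,
then the envy of `i` towards `j` is at most `1 - a` times the difference of their potentials
(`envyGap_le_potential`). So envy goes from smaller to larger potentials.

While envy before time `t` is at most `1 - a`, an iteration of the loop can only give the good match
of `j` to an agent `i` without a good match who has envied `j` before (`LoopStep.spec`). Then `j`
loses her good match, because the dual solution remains one for the new matching, which therefore
still has maximum weight. As `i` has the smaller potential, the sum over the agents with a good
match of their ranks by potential decreases. It is at most `2 * n ^ 2`, which bounds the number of
iterations (`loop_length_le`). When the loop stops, envy is at most `1 - a` again, and this implies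
EF1 (`EnvyBounded.isEF1`).

For the implementation, the same inequality shows that there is no need for exchanges if the maximum
weight matching is stable: no agent without a good match has a match of value `1` with the partner
of an agent on her side of larger potential (`isRun_of_potential`). The program keeps one counter
for each agent, which is the number of time steps minus the potential, and computes a stable
matching in four phases.

* The agents of one side propose, starting at level `0`. An agent displaces those of lower levels,
  and raises her level after all her candidates have refused her, up to a level of about `√n`. This
  takes time `O(n ^ 2)` per level, and the matching is smaller than a maximum one by at most
  about `√n` (`ProposeInv.exists_cover`).
* The matching is augmented about `√n` times, each time by a search in time `O(n ^ 2)`. The last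
  search yields the dual solution (`augment_runs`).
* The agents of the first side who are unmatched propose, and displace others of smaller counters
  (`propose_runs` for the number `0` of levels). Then the second side does the same. Displacements
  keep the dual solution valid (`IsTight.take`), and the result is stable (`stepSpec_of_phases`).
* The remaining agents are matched arbitrarily, and the counters are updated.
-/

namespace RepeatedMatching

/-! ### Binary valuations and dual certificates -/

section Duality

variable {N M : Type*}

open Classical in
/-- The `0/1` indicator of "agent `i` has value `1` for agent `k`". -/
noncomputable def likes (v : Profile N M) (i k : N ⊕ M) : ℕ := if v i k = 1 then 1 else 0

theorem likes_le_one (v : Profile N M) (i k : N ⊕ M) : likes v i k ≤ 1 := by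
  unfold likes; split_ifs <;> simp

theorem SameSide.symm {i j : N ⊕ M} (h : SameSide i j) : SameSide j i := by
  rcases i with i | i <;> rcases j with j | j <;> simp_all [SameSide]

theorem not_sameSide_partner (y : PerfectMatching N M) (i : N ⊕ M) :
    ¬ SameSide i (partner y i) := by
  rcases i with i | i <;> simp [SameSide, partner]

theorem SameSide.not_partner {i j : N ⊕ M} (h : SameSide i j) (y : PerfectMatching N M) :
    ¬ SameSide i (partner y j) := by
  rcases i with i | i <;> rcases j with j | j <;> simp_all [SameSide, partner]

theorem partner_partner (y : PerfectMatching N M) (i : N ⊕ M) :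
    partner y (partner y i) = i := by
  rcases i with i | i <;> simp [partner]

theorem IsBinary.eq_likes {a : ℝ} (ha : a < 1) {v : DynProfile N M} (hb : IsBinary a v) (t : ℕ)
    {i k : N ⊕ M} (h : ¬ SameSide i k) : v t i k = a + (1 - a) * likes (v t) i k := by
  have key : v t i k = a ∨ v t i k = 1 := by
    rcases i with i | i <;> rcases k with k | k
    · simp [SameSide] at h
    · exact (hb t i k).1
    · exact (hb t k i).2
    · simp [SameSide] at h
  unfold likes
  rcases key with key | key
  · have : v t i k ≠ 1 := by rw [key]; exact ha.ne
    rw [if_neg this, key]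
    simp
  · simp [key]

theorem IsSymmetric.likes_comm {v : DynProfile N M} (hs : IsSymmetric v) (t : ℕ)
    {i k : N ⊕ M} (h : ¬ SameSide i k) : likes (v t) i k = likes (v t) k i := by
  rcases i with i | i <;> rcases k with k | k
  · simp [SameSide] at h
  · simp [likes, hs t i k]
  · simp [likes, hs t k i]
  · simp [SameSide] at h

/-- `d` is a dual certificate for the perfect matching `y`: a (fractional) vertex cover of the
pairs of mutual value `1`, with equality on the pairs of `y`. -/
structure IsDual (v : Profile N M) (d : N ⊕ M → ℕ) (y : PerfectMatching N M) : Prop where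
  cover : ∀ i k, ¬ SameSide i k → likes v i k ≤ d i + d k
  tight : ∀ i, likes v i (partner y i) = d i + d (partner y i)

theorem weight_eq [Fintype N] {a : ℝ} (ha : a < 1) {v : DynProfile N M}
    (hb : IsBinary a v) (hs : IsSymmetric v) (t : ℕ) (y : PerfectMatching N M) :
    weight (v t) y = Fintype.card N * a +
      (1 - a) * (∑ i : N, likes (v t) (.inl i) (.inr (y i)) : ℕ) := by
  unfold weight
  have : ∀ i : N, v t (.inl i) (.inr (y i)) + v t (.inr (y i)) (.inl i) =
      2 * (a + (1 - a) * likes (v t) (.inl i) (.inr (y i))) := by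
    intro i
    rw [← hs t i (y i), hb.eq_likes ha t (by simp [SameSide])]
    ring
  simp only [this]
  rw [← Finset.mul_sum, Finset.sum_add_distrib, ← Finset.mul_sum]
  push_cast
  simp

theorem isMaxWeight_iff [Fintype N] {a : ℝ} (ha : a < 1) {v : DynProfile N M}
    (hb : IsBinary a v) (hs : IsSymmetric v) (t : ℕ) (y : PerfectMatching N M) :
    IsMaxWeight (v t) y ↔ ∀ z : PerfectMatching N M,
      ∑ i : N, likes (v t) (.inl i) (.inr (z i)) ≤ ∑ i : N, likes (v t) (.inl i) (.inr (y i)) := by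
  unfold IsMaxWeight
  refine forall_congr' fun z => ?_
  rw [weight_eq ha hb hs, weight_eq ha hb hs, add_le_add_iff_left,
    mul_le_mul_iff_right₀ (by linarith), Nat.cast_le]

/-- Weak duality: the weight of `z` is bounded by the total dual value, with equality for `y`. -/
theorem IsDual.isMaxWeight [Fintype N] [Fintype M] {a : ℝ} (ha : a < 1) {v : DynProfile N M}
    (hb : IsBinary a v) (hs : IsSymmetric v) {t : ℕ} {d : N ⊕ M → ℕ} {y : PerfectMatching N M}
    (h : IsDual (v t) d y) : IsMaxWeight (v t) y := by
  rw [isMaxWeight_iff ha hb hs]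
  intro z
  have key : ∀ z : PerfectMatching N M,
      ∑ i : N, (d (.inl i) + d (.inr (z i))) = ∑ i, d (.inl i) + ∑ k, d (.inr k) := fun z => by
    rw [Finset.sum_add_distrib, Equiv.sum_comp z fun k => d (.inr k)]
  calc _ ≤ ∑ i : N, (d (.inl i) + d (.inr (z i))) :=
        Finset.sum_le_sum fun i _ => h.cover _ _ (by simp [SameSide])
    _ = ∑ i : N, (d (.inl i) + d (.inr (y i))) := by rw [key, key]
    _ = _ := Finset.sum_congr rfl fun i _ => (h.tight (.inl i)).symm

section Koenig

variable [Fintype N] [DecidableEq N]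

theorem sum_swap_trans (e : N → M → ℕ) (y : N ≃ M) {i j : N} (h : i ≠ j) :
    ∑ b, e b (((Equiv.swap i j).trans y) b) + (e i (y i) + e j (y j)) =
      ∑ b, e b (y b) + (e i (y j) + e j (y i)) := by
  have split : ∀ f : N → ℕ, ∑ b, f b = f i + (f j + ∑ b ∈ (Finset.univ.erase i).erase j, f b) := by
    intro f
    rw [Finset.add_sum_erase _ _ (by simp [h.symm]), Finset.add_sum_erase _ _ (by simp)]
  rw [split, split (fun b => e b (y b))]
  have : ∑ b ∈ (Finset.univ.erase i).erase j, e b (((Equiv.swap i j).trans y) b) =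
      ∑ b ∈ (Finset.univ.erase i).erase j, e b (y b) := by
    refine Finset.sum_congr rfl fun b hb => ?_
    simp only [Finset.mem_erase] at hb
    simp [Equiv.swap_apply_of_ne_of_ne hb.2.1 hb.1]
  rw [this]
  simp
  ring

/-- A maximum matching has no augmenting path. The path is `c 0, y (c 1), c 1, …, c m, y l`; it
is shortened from its end: giving `y l` to `c m` and `y (c m)` to `l` yields another maximum
matching, for which `c 0, …, c (m - 1), y (c m)` is augmenting. -/
theorem no_augmenting_path (e : N → M → ℕ) (he : ∀ i k, e i k ≤ 1) :
    ∀ (m : ℕ) (y : N ≃ M), (∀ z : N ≃ M, ∑ b, e b (z b) ≤ ∑ b, e b (y b)) →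
      ∀ (c : ℕ → N) (l : N), e (c 0) (y (c 0)) = 0 →
        (∀ b < m, e (c b) (y (c (b + 1))) = 1) → e (c m) (y l) = 1 → e l (y l) = 0 → False := by
  intro m
  induction m using Nat.strong_induction_on with
  | _ m ih =>
    intro y hy c l h0 hc hm hl
    have hne : c m ≠ l := by rintro rfl; omega
    have hw := sum_swap_trans e y hne
    have hmax := hy ((Equiv.swap (c m) l).trans y)
    rcases Nat.eq_zero_or_pos m with rfl | hpos
    · omega
    by_cases hrep : ∃ b < m, c b = c m
    · obtain ⟨b, hb, hbm⟩ := hrep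
      exact ih b hb y hy c l h0 (fun b' hb' => hc b' (by omega)) (by rw [hbm]; exact hm) hl
    by_cases hrep' : ∃ b < m, c (b + 1) = l
    · obtain ⟨b, hb, hbl⟩ := hrep'
      exact ih b hb y hy c l h0 (fun b' hb' => hc b' (by omega)) (by rw [← hbl]; exact hc b hb) hl
    push Not at hrep hrep'
    have h1 := he (c m) (y (c m))
    have hl0 : e l (y (c m)) = 0 := by omega
    have hz : ∀ b, b ≠ c m → b ≠ l → ((Equiv.swap (c m) l).trans y) b = y b := fun b h h' => by
      simp [Equiv.swap_apply_of_ne_of_ne h h']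
    have hzl : ((Equiv.swap (c m) l).trans y) l = y (c m) := by simp
    refine ih (m - 1) (by omega) ((Equiv.swap (c m) l).trans y) ?_ c l ?_ ?_ ?_ ?_
    · intro z
      have := hy z
      omega
    · by_cases h : c 0 = l
      · rw [h, hzl, hl0]
      · rw [hz _ (hrep 0 hpos) h, h0]
    · intro b hb
      rw [hz _ (hrep _ (by omega)) (hrep' _ (by omega))]
      exact hc b (by omega)
    · rw [hzl]
      have := hc (m - 1) (by omega)
      rwa [show m - 1 + 1 = m by omega] at this
    · rw [hzl, hl0]

/-- König's theorem: a maximum weight matching has a dual certificate. It is given by the agents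
that can be reached by alternating paths from the agents of `N` who get nothing. -/
theorem exists_isDual {a : ℝ} (ha : a < 1) {v : DynProfile N M}
    (hb : IsBinary a v) (hs : IsSymmetric v) {t : ℕ} {y : PerfectMatching N M}
    (h : IsMaxWeight (v t) y) : ∃ d, IsDual (v t) d y := by
  classical
  rw [isMaxWeight_iff ha hb hs] at h
  set e : N → M → ℕ := fun i k => likes (v t) (.inl i) (.inr k) with he
  have e01 : ∀ i k, e i k ≤ 1 := fun i k => likes_le_one _ _ _
  let R : Set N := {j | ∃ (m : ℕ) (c : ℕ → N), c m = j ∧ e (c 0) (y (c 0)) = 0 ∧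
    ∀ b < m, e (c b) (y (c (b + 1))) = 1}
  have hR0 : ∀ i, e i (y i) = 0 → i ∈ R := fun i hi => ⟨0, fun _ => i, rfl, hi, by simp⟩
  have hR1 : ∀ i ∈ R, ∀ j, e i (y j) = 1 → j ∈ R ∧ e j (y j) = 1 := by
    rintro i ⟨m, c, rfl, hc0, hc⟩ j hj
    refine ⟨⟨m + 1, fun b => if b ≤ m then c b else j, by simp, by simpa using hc0, ?_⟩, ?_⟩
    · intro b hbm
      rcases Nat.lt_or_ge b m with h' | h'
      · simpa [h', h'.le, Nat.succ_le_iff.2 h'] using hc b h'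
      · obtain rfl : b = m := by omega
        simpa using hj
    · by_contra hj'
      have := e01 j (y j)
      exact no_augmenting_path e e01 m y h c j hc0 hc hj (by omega)
  let d : N ⊕ M → ℕ := Sum.elim (fun i => if i ∈ R then 0 else 1)
    (fun k => if y.symm k ∈ R then e (y.symm k) k else 0)
  have hcov : ∀ i k, e i k ≤ d (.inl i) + d (.inr k) := by
    intro i k
    have h1 := e01 i k
    by_cases hi : i ∈ R
    · by_cases hk : e i k = 1
      · have := hR1 i hi (y.symm k) (by simpa using hk)
        simp only [Equiv.apply_symm_apply] at this
        simp [d, hi, this, hk]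
      · omega
    · simp only [d, Sum.elim_inl, if_neg hi]
      omega
  have htight : ∀ i, e i (y i) = d (.inl i) + d (.inr (y i)) := by
    intro i
    by_cases hi : i ∈ R
    · simp [d, hi]
    · have h1 := e01 i (y i)
      have h2 : e i (y i) ≠ 0 := fun h => hi (hR0 i h)
      simp only [d, Sum.elim_inl, if_neg hi, Sum.elim_inr, Equiv.symm_apply_apply]
      omega
  refine ⟨d, ?_, ?_⟩
  · rintro (i | i) (k | k) hik
    · simp [SameSide] at hik
    · exact hcov i k
    · rw [hs.likes_comm t hik, add_comm]
      exact hcov k i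
    · simp [SameSide] at hik
  · rintro (i | k)
    · exact htight i
    · rw [hs.likes_comm t (not_sameSide_partner y _), add_comm]
      simpa [partner] using htight (y.symm k)

end Koenig

end Duality

/-! ### Envy and potentials -/

section Envy

variable {N M : Type*}

theorem bundleValue_bundle (v : DynProfile N M) (x : ℕ → PerfectMatching N M) (t : ℕ)
    (i j : N ⊕ M) :
    bundleValue v i (bundle x t j) = ∑ s ∈ Finset.range t, v s i (partner (x s) j) := by
  simp [bundleValue, bundle, Finset.sum, Finset.range]

theorem envyGap_zero (v : DynProfile N M) (x : ℕ → PerfectMatching N M) (i j : N ⊕ M) :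
    envyGap v x 0 i j = 0 := by
  simp [envyGap, bundleValue_bundle]

theorem envyGap_succ (v : DynProfile N M) (x : ℕ → PerfectMatching N M) (t : ℕ) (i j : N ⊕ M) :
    envyGap v x (t + 1) i j =
      envyGap v x t i j + (v t i (partner (x t) j) - v t i (partner (x t) i)) := by
  simp only [envyGap, bundleValue_bundle, Finset.sum_range_succ]
  ring

theorem envyGap_congr (v : DynProfile N M) {x x' : ℕ → PerfectMatching N M} {t : ℕ}
    (h : ∀ s < t, x s = x' s) (i j : N ⊕ M) : envyGap v x t i j = envyGap v x' t i j := by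
  simp only [envyGap, bundleValue_bundle]
  congr 1 <;> exact Finset.sum_congr rfl fun s hs => by rw [h s (Finset.mem_range.1 hs)]

theorem envyGap_update_succ (v : DynProfile N M) (x : ℕ → PerfectMatching N M) (t : ℕ)
    (y : PerfectMatching N M) (i j : N ⊕ M) :
    envyGap v (Function.update x t y) (t + 1) i j =
      envyGap v x t i j + (v t i (partner y j) - v t i (partner y i)) := by
  rw [envyGap_succ, envyGap_congr v (x' := x)]
  · simp
  · intro s hs
    simp [hs.ne]

/-- No agent envies an agent on the same side by more than `1 - a`. -/
def EnvyBounded (a : ℝ) (v : DynProfile N M) (x : ℕ → PerfectMatching N M) (t : ℕ) : Prop :=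
  ∀ i j, SameSide i j → envyGap v x t i j ≤ 1 - a

theorem envyBounded_zero {a : ℝ} (ha : a < 1) (v : DynProfile N M)
    (x : ℕ → PerfectMatching N M) : EnvyBounded a v x 0 := fun i j _ => by
  rw [envyGap_zero]; linarith

/-- Removing a match that was worth `1` to the envious agent repairs an envy of at most `1 - a`. -/
theorem EnvyBounded.isEF1 [DecidableEq N] [DecidableEq M] {a : ℝ} (ha0 : 0 ≤ a) (ha : a < 1)
    {v : DynProfile N M} (hb : IsBinary a v) {x : ℕ → PerfectMatching N M} {t : ℕ}
    (h : EnvyBounded a v x t) : IsEF1 v x t := by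
  intro i j hij hlt
  obtain ⟨s, hs, hlt'⟩ : ∃ s ∈ Finset.range t,
      v s i (partner (x s) i) < v s i (partner (x s) j) := by
    rw [bundleValue_bundle, bundleValue_bundle] at hlt
    exact Finset.exists_lt_of_sum_lt hlt
  have hone : v s i (partner (x s) j) = 1 := by
    rw [hb.eq_likes ha s (not_sameSide_partner _ i),
      hb.eq_likes ha s (hij.not_partner _)] at hlt'
    rw [hb.eq_likes ha s (hij.not_partner _)]
    have h1 := likes_le_one (v s) i (partner (x s) j)
    have : likes (v s) i (partner (x s) j) ≠ 0 := by
      intro h0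
      rw [h0] at hlt'
      have : (0 : ℝ) ≤ (1 - a) * likes (v s) i (partner (x s) i) :=
        mul_nonneg (by linarith) (Nat.cast_nonneg _)
      push_cast at hlt'
      linarith
    rw [show likes (v s) i (partner (x s) j) = 1 by omega]
    push_cast
    ring
  have hmem : (s, partner (x s) j) ∈ bundle x t j :=
    Multiset.mem_map.2 ⟨s, by simpa using hs, rfl⟩
  refine ⟨_, hmem, ?_⟩
  have hsum : bundleValue v i (bundle x t j) =
      v s i (partner (x s) j) + bundleValue v i ((bundle x t j).erase (s, partner (x s) j)) := by
    conv_lhs => rw [← Multiset.cons_erase hmem]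
    simp [bundleValue]
  have := h i j hij
  unfold envyGap at this
  linarith

/-- The potential of agent `j`: the total dual value of her partners before time `t`. -/
def potential (d : ℕ → N ⊕ M → ℕ) (x : ℕ → PerfectMatching N M) (t : ℕ) (j : N ⊕ M) : ℕ :=
  ∑ s ∈ Finset.range t, d s (partner (x s) j)

/-- Envy is bounded by differences of potentials; so it is acyclic. -/
theorem envyGap_le_potential {a : ℝ} (ha : a < 1) {v : DynProfile N M} (hb : IsBinary a v)
    {d : ℕ → N ⊕ M → ℕ} {x : ℕ → PerfectMatching N M} {t : ℕ}
    (h : ∀ s < t, IsDual (v s) (d s) (x s)) {i j : N ⊕ M} (hij : SameSide i j) :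
    envyGap v x t i j ≤ (1 - a) * ((potential d x t j : ℝ) - potential d x t i) := by
  induction t with
  | zero => simp [envyGap_zero, potential]
  | succ t ih =>
    have ih := ih fun s hs => h s (by omega)
    rw [envyGap_succ, hb.eq_likes ha t (not_sameSide_partner _ i),
      hb.eq_likes ha t (hij.not_partner _)]
    have hd := h t (by omega)
    have h1 := hd.tight i
    have h2 := hd.cover i (partner (x t) j) (hij.not_partner _)
    have h3 : (likes (v t) i (partner (x t) j) : ℝ) - likes (v t) i (partner (x t) i) ≤
        (d t (partner (x t) j) : ℝ) - d t (partner (x t) i) := by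
      rw [h1]
      have : (likes (v t) i (partner (x t) j) : ℝ) ≤ d t i + d t (partner (x t) j) := by
        exact_mod_cast h2
      push_cast
      linarith
    have h4 := mul_le_mul_of_nonneg_left h3 (by linarith : (0 : ℝ) ≤ 1 - a)
    have h5 : ∀ b, potential d x (t + 1) b = potential d x t b + d t (partner (x t) b) :=
      fun b => Finset.sum_range_succ _ _
    rw [h5, h5]
    push_cast
    linarith

end Envy

/-! ### The while loop -/

section Loop

variable {N M : Type*} [DecidableEq N] [DecidableEq M]

theorem partner_swapMatches (y : PerfectMatching N M) {i j : N ⊕ M} (hij : SameSide i j)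
    (b : N ⊕ M) : partner (swapMatches y i j) b =
      if b = i then partner y j else if b = j then partner y i else
      if b = partner y i then j else if b = partner y j then i else partner y b := by
  rcases i with i | i <;> rcases j with j | j <;> simp only [SameSide] at hij <;>
    rcases b with b | b <;> simp [partner, swapMatches, Equiv.swap_apply_def,
      Equiv.eq_symm_apply, Equiv.symm_apply_eq] <;> split_ifs <;> simp_all

/-- What an exchange of the while loop does: the poor agent `i` gets a good match, and the agent
`j` loses hers. This is forced by the dual certificate, which remains one. -/
theorem LoopStep.spec {a : ℝ} (ha : a < 1) {v : DynProfile N M} (hb : IsBinary a v)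
    (hs : IsSymmetric v) {x : ℕ → PerfectMatching N M} {t : ℕ} (hx : EnvyBounded a v x t)
    {d : N ⊕ M → ℕ} {y y' : PerfectMatching N M} (hd : IsDual (v t) d y)
    (h : LoopStep a v x t y y') :
    IsDual (v t) d y' ∧ ∃ i j, SameSide i j ∧ 0 < envyGap v x t i j ∧
      likes (v t) i (partner y i) = 0 ∧ likes (v t) j (partner y j) = 1 ∧
      ∀ b, likes (v t) b (partner y' b) =
        if b = i then 1 else if b = j then 0 else likes (v t) b (partner y b) := by
  obtain ⟨i, j, hij, hgap, rfl⟩ := h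
  have hpos : 0 < 1 - a := by linarith
  rw [envyGap_update_succ, hb.eq_likes ha t (not_sameSide_partner _ i),
    hb.eq_likes ha t (hij.not_partner _)] at hgap
  have hxij := hx i j hij
  have hlt : likes (v t) i (partner y i) < likes (v t) i (partner y j) := by
    have : (likes (v t) i (partner y i) : ℝ) < likes (v t) i (partner y j) := by
      by_contra hcon
      push Not at hcon
      have := mul_le_mul_of_nonneg_left hcon hpos.le
      linarith
    exact_mod_cast this
  have hle := likes_le_one (v t) i (partner y j)
  have hi0 : likes (v t) i (partner y i) = 0 := by omega
  have hi1 : likes (v t) i (partner y j) = 1 := by omega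
  have hgap' : 0 < envyGap v x t i j := by
    rw [hi0, hi1] at hgap
    push_cast at hgap
    linarith
  have h1 := hd.tight i
  have h2 := hd.cover i (partner y j) (hij.not_partner _)
  have h3 := hd.tight j
  have h4 := likes_le_one (v t) j (partner y j)
  have h5 := hd.cover j (partner y i) (hij.symm.not_partner _)
  have hc : ∀ b, likes (v t) (partner y b) b = likes (v t) b (partner y b) := fun b =>
    (hs.likes_comm t (not_sameSide_partner y b)).symm
  have hcij := hs.likes_comm t (hij.not_partner y)
  have hcji := hs.likes_comm t (hij.symm.not_partner y)
  have hne : i ≠ j := by rintro rfl; omega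
  have hci := hc i
  have hcj := hc j
  refine ⟨⟨hd.cover, fun b => ?_⟩, i, j, hij, hgap', hi0, by omega, fun b => ?_⟩
  · have hb := hd.tight b
    rw [partner_swapMatches y hij]
    split_ifs <;> subst_vars <;> omega
  · rw [partner_swapMatches y hij]
    have hni := not_sameSide_partner y i
    have hnj := not_sameSide_partner y j
    split_ifs <;> subst_vars <;> try simp only [partner_partner]
    all_goals omega

open Classical in
/-- The number of agents on the side of `b` of smaller potential. It serves as a bounded substitute
for the potential, which grows with time. -/
noncomputable def rank [Fintype N] [Fintype M] (p : N ⊕ M → ℕ) (b : N ⊕ M) : ℕ :=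
  (Finset.univ.filter fun c => SameSide c b ∧ p c < p b).card

omit [DecidableEq N] [DecidableEq M] in
theorem rank_lt_rank [Fintype N] [Fintype M] (p : N ⊕ M → ℕ) {i j : N ⊕ M} (hij : SameSide i j)
    (h : p i < p j) : rank p i < rank p j := by
  refine Finset.card_lt_card ⟨fun c => ?_, fun hc => ?_⟩
  · simp only [Finset.mem_filter, Finset.mem_univ, true_and]
    rintro ⟨h1, h2⟩
    refine ⟨?_, by omega⟩
    rcases i with i | i <;> rcases j with j | j <;> rcases c with c | c <;> simp_all [SameSide]
  · have := @hc i (by simp [hij, h])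
    simp at this

omit [DecidableEq N] [DecidableEq M] in
theorem rank_le [Fintype N] [Fintype M] {n : ℕ} (hN : Fintype.card N = n)
    (hM : Fintype.card M = n) (p : N ⊕ M → ℕ) (b : N ⊕ M) : rank p b ≤ n := by
  classical
  unfold rank
  rcases b with b | b
  · calc _ ≤ ((Finset.univ : Finset N).map (.inl : N ↪ N ⊕ M)).card :=
          Finset.card_le_card fun c hc => by
            have := (Finset.mem_filter.1 hc).2.1
            rcases c with c | c <;> simp_all [SameSide]
      _ ≤ n := by simp [hN]
  · calc _ ≤ ((Finset.univ : Finset M).map (.inr : M ↪ N ⊕ M)).card :=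
          Finset.card_le_card fun c hc => by
            have := (Finset.mem_filter.1 hc).2.1
            rcases c with c | c <;> simp_all [SameSide]
      _ ≤ n := by simp [hM]

/-- The termination measure of the while loop: the total rank of the agents with a good match. -/
noncomputable def loopMeasure [Fintype N] [Fintype M] (v : Profile N M) (p : N ⊕ M → ℕ)
    (y : PerfectMatching N M) : ℕ :=
  ∑ b, likes v b (partner y b) * rank p b

omit [DecidableEq N] [DecidableEq M] in
theorem loopMeasure_le [Fintype N] [Fintype M] {n : ℕ} (hN : Fintype.card N = n)
    (hM : Fintype.card M = n) (v : Profile N M) (p : N ⊕ M → ℕ) (y : PerfectMatching N M) :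
    loopMeasure v p y ≤ 2 * n ^ 2 := by
  calc loopMeasure v p y ≤ ∑ _b : N ⊕ M, n := Finset.sum_le_sum fun b _ =>
        (Nat.mul_le_mul (likes_le_one _ _ _) (rank_le hN hM p b)).trans_eq (one_mul n)
    _ = 2 * n ^ 2 := by simp [hN, hM]; ring

theorem sum_update_two {ι : Type*} [Fintype ι] [DecidableEq ι] (f r : ι → ℕ) {i j : ι}
    (hne : i ≠ j) (hi : f i = 0) (hj : f j = 1) :
    ∑ b, (if b = i then 1 else if b = j then 0 else f b) * r b + r j = ∑ b, f b * r b + r i := by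
  have split : ∀ g : ι → ℕ, ∑ b, g b = g i + (g j + ∑ b ∈ (Finset.univ.erase i).erase j, g b) := by
    intro g
    rw [Finset.add_sum_erase _ _ (by simp [hne.symm]), Finset.add_sum_erase _ _ (by simp)]
  rw [split, split fun b => f b * r b]
  have : ∑ b ∈ (Finset.univ.erase i).erase j,
      (if b = i then 1 else if b = j then 0 else f b) * r b =
      ∑ b ∈ (Finset.univ.erase i).erase j, f b * r b := by
    refine Finset.sum_congr rfl fun b hb => ?_
    simp only [Finset.mem_erase] at hb
    simp [hb.1, hb.2.1]
  rw [this]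
  simp [hne.symm, hi, hj]
  ring

/-- The agent `i` who receives the good match of `j` envied her before, so that `i` has the smaller
potential. -/
theorem LoopStep.measure_lt [Fintype N] [Fintype M] {a : ℝ} (ha : a < 1) {v : DynProfile N M}
    (hb : IsBinary a v) (hs : IsSymmetric v) {x : ℕ → PerfectMatching N M} {t : ℕ}
    (hx : EnvyBounded a v x t) {D : ℕ → N ⊕ M → ℕ} (hD : ∀ s < t, IsDual (v s) (D s) (x s))
    {d : N ⊕ M → ℕ} {y y' : PerfectMatching N M} (hd : IsDual (v t) d y)
    (h : LoopStep a v x t y y') :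
    loopMeasure (v t) (potential D x t) y' < loopMeasure (v t) (potential D x t) y := by
  obtain ⟨-, i, j, hij, hgap, hi0, hj1, hlik⟩ := h.spec ha hb hs hx hd
  have hp : potential D x t i < potential D x t j := by
    have := envyGap_le_potential ha hb hD hij
    have h2 : (0 : ℝ) < (potential D x t j : ℝ) - potential D x t i := by
      by_contra hcon
      push Not at hcon
      have := mul_nonpos_of_nonneg_of_nonpos (by linarith : (0 : ℝ) ≤ 1 - a) hcon
      linarith
    exact_mod_cast sub_pos.1 h2
  have hr := rank_lt_rank _ hij hp
  have hne : i ≠ j := by rintro rfl; omega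
  have := sum_update_two (fun b => likes (v t) b (partner y b)) (rank (potential D x t)) hne
    hi0 hj1
  unfold loopMeasure
  simp only [hlik]
  omega

theorem LoopStep.congr {a : ℝ} {v : DynProfile N M} {x x' : ℕ → PerfectMatching N M} {t : ℕ}
    (h : ∀ s < t, x s = x' s) (y y' : PerfectMatching N M) :
    LoopStep a v x t y y' ↔ LoopStep a v x' t y y' := by
  simp only [LoopStep, envyGap_update_succ, envyGap_congr v h]

theorem IsAlgStep.congr [Fintype N] {a : ℝ} {v : DynProfile N M} {x x' : ℕ → PerfectMatching N M}
    {t : ℕ} (h : ∀ s ≤ t, x s = x' s) : IsAlgStep a v x t ↔ IsAlgStep a v x' t := by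
  have : LoopStep a v x t = LoopStep a v x' t := by
    funext y y'
    exact propext (LoopStep.congr (fun s hs => h s hs.le) y y')
  simp only [IsAlgStep, this, h t le_rfl]

theorem forall_not_loopStep_iff {a : ℝ} {v : DynProfile N M} {x : ℕ → PerfectMatching N M}
    {t : ℕ} : (∀ y', ¬ LoopStep a v x t (x t) y') ↔ EnvyBounded a v x (t + 1) := by
  constructor
  · intro h i j hij
    by_contra hcon
    push Not at hcon
    exact h _ ⟨i, j, hij, by rwa [Function.update_eq_self], rfl⟩
  · rintro h y' ⟨i, j, hij, hgap, -⟩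
    rw [Function.update_eq_self] at hgap
    exact absurd (h i j hij) (not_le.2 hgap)

theorem isDual_of_reflTransGen {a : ℝ} (ha : a < 1) {v : DynProfile N M}
    (hb : IsBinary a v) (hs : IsSymmetric v) {x : ℕ → PerfectMatching N M} {t : ℕ}
    (hx : EnvyBounded a v x t) {d : N ⊕ M → ℕ} {y y' : PerfectMatching N M}
    (hd : IsDual (v t) d y) (h : Relation.ReflTransGen (LoopStep a v x t) y y') :
    IsDual (v t) d y' := by
  induction h with
  | refl => exact hd
  | tail _ h ih => exact (h.spec ha hb hs hx ih).1

/-- The invariant of the algorithm: envy is bounded, and the matchings have dual certificates. -/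
theorem invariant_of_isAlgStep [Fintype N] {a : ℝ} (ha : a < 1) {v : DynProfile N M}
    (hb : IsBinary a v) (hs : IsSymmetric v) {x : ℕ → PerfectMatching N M} (t : ℕ)
    (h : ∀ s < t, IsAlgStep a v x s) :
    EnvyBounded a v x t ∧ ∀ s < t, ∃ d, IsDual (v s) d (x s) := by
  induction t with
  | zero => exact ⟨envyBounded_zero ha v x, by simp⟩
  | succ t ih =>
    obtain ⟨ih1, ih2⟩ := ih fun s hs => h s (by omega)
    obtain ⟨y, hy, hyx, hfinal⟩ := h t (by omega)
    obtain ⟨d, hd⟩ := exists_isDual ha hb hs hy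
    refine ⟨forall_not_loopStep_iff.1 hfinal, fun s hst => ?_⟩
    rcases Nat.lt_succ_iff_lt_or_eq.1 hst with hst | rfl
    · exact ih2 s hst
    · exact ⟨d, isDual_of_reflTransGen ha hb hs ih1 hd hyx⟩

theorem loop_length_le [Fintype N] [Fintype M] {n : ℕ} (hN : Fintype.card N = n)
    (hM : Fintype.card M = n) {a : ℝ} (ha : a < 1) {v : DynProfile N M} (hb : IsBinary a v)
    (hs : IsSymmetric v) (x : ℕ → PerfectMatching N M) (t : ℕ)
    (h : ∀ s < t, IsAlgStep a v x s) (k : ℕ) (y : ℕ → PerfectMatching N M)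
    (hy : IsMaxWeight (v t) (y 0)) (hstep : ∀ m < k, LoopStep a v x t (y m) (y (m + 1))) :
    k ≤ 2 * n ^ 2 := by
  obtain ⟨hx, hdual⟩ := invariant_of_isAlgStep ha hb hs t h
  choose! D hD using hdual
  obtain ⟨d, hd⟩ := exists_isDual ha hb hs hy
  have key : ∀ m ≤ k, IsDual (v t) d (y m) ∧ loopMeasure (v t) (potential D x t) (y m) + m ≤
      loopMeasure (v t) (potential D x t) (y 0) := by
    intro m
    induction m with
    | zero => exact fun _ => ⟨hd, le_rfl⟩
    | succ m ih =>
      intro hm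
      obtain ⟨ih1, ih2⟩ := ih (by omega)
      have hst := hstep m (by omega)
      have := hst.measure_lt ha hb hs hx hD ih1
      exact ⟨(hst.spec ha hb hs hx ih1).1, by omega⟩
  have := (key k le_rfl).2
  have := loopMeasure_le hN hM (v t) (potential D x t) (y 0)
  omega

theorem exists_isAlgStep [Fintype N] [Fintype M] (hcard : Fintype.card N = Fintype.card M)
    {a : ℝ} (ha : a < 1) {v : DynProfile N M} (hb : IsBinary a v)
    (hs : IsSymmetric v) (x : ℕ → PerfectMatching N M) (t : ℕ)
    (h : ∀ s < t, IsAlgStep a v x s) : ∃ z, IsAlgStep a v (Function.update x t z) t := by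
  obtain ⟨hx, hdual⟩ := invariant_of_isAlgStep ha hb hs t h
  choose! D hD using hdual
  have : Nonempty (PerfectMatching N M) := ⟨Fintype.equivOfCardEq hcard⟩
  obtain ⟨y, hy⟩ : ∃ y, IsMaxWeight (v t) y := Finite.exists_max (weight (v t))
  obtain ⟨d, hd⟩ := exists_isDual ha hb hs hy
  have key : ∀ (m : ℕ) (y : PerfectMatching N M), IsDual (v t) d y →
      loopMeasure (v t) (potential D x t) y ≤ m →
      ∃ z, Relation.ReflTransGen (LoopStep a v x t) y z ∧ ∀ y', ¬ LoopStep a v x t z y' := by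
    intro m
    induction m with
    | zero =>
      intro y hd hm
      exact ⟨y, .refl, fun y' hst => by have := hst.measure_lt ha hb hs hx hD hd; omega⟩
    | succ m ih =>
      intro y hd hm
      by_cases hst : ∃ y', LoopStep a v x t y y'
      · obtain ⟨y', hst⟩ := hst
        have := hst.measure_lt ha hb hs hx hD hd
        obtain ⟨z, hz, hfinal⟩ := ih y' (hst.spec ha hb hs hx hd).1 (by omega)
        exact ⟨z, .head hst hz, hfinal⟩
      · push Not at hst
        exact ⟨y, .refl, hst⟩
  obtain ⟨z, hz, hfinal⟩ := key _ y hd le_rfl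
  have hc : LoopStep a v (Function.update x t z) t = LoopStep a v x t := by
    funext y y'
    refine propext (LoopStep.congr (fun s hs => ?_) y y')
    simp [hs.ne]
  exact ⟨z, y, hy, by simpa [hc] using hz, by simpa [hc] using hfinal⟩

theorem exists_isRun [Fintype N] [Fintype M] (hcard : Fintype.card N = Fintype.card M)
    {a : ℝ} (ha : a < 1) {v : DynProfile N M} (hb : IsBinary a v)
    (hs : IsSymmetric v) : ∃ x, IsRun a v x := by
  have := fun x t h => exists_isAlgStep hcard ha hb hs x t h
  choose z hz using this
  classical
  -- `X t` is a sequence that follows the algorithm before time `t`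
  let X : (t : ℕ) → {x : ℕ → PerfectMatching N M // ∀ s < t, IsAlgStep a v x s} := fun t =>
    Nat.rec ⟨fun _ => Fintype.equivOfCardEq hcard, by simp⟩ (fun t X =>
      ⟨Function.update X.1 t (z X.1 t X.2), fun s hs => by
        rcases Nat.lt_succ_iff_lt_or_eq.1 hs with hst | rfl
        · exact (IsAlgStep.congr fun r hr => by
            rw [Function.update_of_ne (by omega)]).2 (X.2 s hst)
        · exact hz _ _ _⟩) t
  have hX : ∀ t, (X (t + 1)).1 = Function.update (X t).1 t (z _ t (X t).2) := fun t => rfl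
  have hstab : ∀ s t, s < t → (X t).1 s = (X (s + 1)).1 s := by
    intro s t hst
    induction t with
    | zero => omega
    | succ t ih =>
      rcases Nat.lt_succ_iff_lt_or_eq.1 hst with hst | rfl
      · rw [hX, Function.update_of_ne hst.ne, ih hst]
      · rfl
  refine ⟨fun t => (X (t + 1)).1 t, fun t => ?_⟩
  exact (IsAlgStep.congr fun s hs => hstab s (t + 1) (by omega)).1 ((X (t + 1)).2 t (by omega))

theorem IsRun.ef1OverRounds_and_isMaxWeight [Fintype N] [Fintype M] {a : ℝ} (ha0 : 0 ≤ a)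
    (ha : a < 1) {v : DynProfile N M} (hb : IsBinary a v) (hs : IsSymmetric v)
    {x : ℕ → PerfectMatching N M} (h : IsRun a v x) :
    EF1OverRounds v x ∧ ∀ t, IsMaxWeight (v t) (x t) := by
  refine ⟨fun t => ?_, fun t => ?_⟩
  · exact (invariant_of_isAlgStep ha hb hs t fun s _ => h s).1.isEF1 ha0 ha hb
  · obtain ⟨d, hd⟩ := (invariant_of_isAlgStep ha hb hs (t + 1) fun s _ => h s).2 t (by omega)
    exact hd.isMaxWeight ha hb hs

/-- A sequence of maximum weight matchings is a run of the algorithm (without exchanges) if at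
all times the matches that an agent without a good match would like belong to agents of no higher
potential. -/
theorem isRun_of_potential [Fintype N] [Fintype M] {a : ℝ} (ha : a < 1) {v : DynProfile N M}
    (hb : IsBinary a v) (hs : IsSymmetric v) {x : ℕ → PerfectMatching N M}
    {d : ℕ → N ⊕ M → ℕ} (hd : ∀ t, IsDual (v t) (d t) (x t))
    (hpot : ∀ t i j, SameSide i j → likes (v t) i (partner (x t) i) = 0 →
      likes (v t) i (partner (x t) j) = 1 → potential d x t j ≤ potential d x t i) :
    IsRun a v x := by
  have hbd : ∀ t, EnvyBounded a v x t := by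
    intro t
    induction t with
    | zero => exact envyBounded_zero ha v x
    | succ t ih =>
      intro i j hij
      have h1 := envyGap_le_potential ha hb (t := t) (fun s _ => hd s) hij
      have h2 := ih i j hij
      have h3 := hpot t i j hij
      have h4 := likes_le_one (v t) i (partner (x t) i)
      have h5 := likes_le_one (v t) i (partner (x t) j)
      have hpos : (0 : ℝ) ≤ 1 - a := by linarith
      rw [envyGap_succ, hb.eq_likes ha t (not_sameSide_partner _ i),
        hb.eq_likes ha t (hij.not_partner _)]
      by_cases hc : likes (v t) i (partner (x t) i) = 0 ∧ likes (v t) i (partner (x t) j) = 1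
      · have h6 : (potential d x t j : ℝ) ≤ potential d x t i := by exact_mod_cast h3 hc.1 hc.2
        have := mul_nonpos_of_nonneg_of_nonpos hpos (sub_nonpos.2 h6)
        rw [hc.1, hc.2]
        push_cast
        linarith
      · have h6 : (likes (v t) i (partner (x t) j) : ℝ) ≤ likes (v t) i (partner (x t) i) := by
          exact_mod_cast (by omega :
            likes (v t) i (partner (x t) j) ≤ likes (v t) i (partner (x t) i))
        have := mul_le_mul_of_nonneg_left h6 hpos
        linarith
  exact fun t => ⟨x t, (hd t).isMaxWeight ha hb hs, .refl,
    forall_not_loopStep_iff.2 (hbd (t + 1))⟩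

end Loop

/-! ### Time bounds for machine programs -/

section Machine

/-- `P`, started in `σ`, halts after at most `K` steps in a state with the property `Q`. -/
def Runs (W : ℕ) (P : Cmd) (σ : State) (K : ℕ) (Q : State → Prop) : Prop :=
  ∃ k τ, Exec W P σ k τ ∧ k ≤ K ∧ Q τ

theorem Runs.mono {W : ℕ} {P : Cmd} {σ : State} {K K' : ℕ} {Q Q' : State → Prop}
    (h : Runs W P σ K Q) (hK : K ≤ K') (hQ : ∀ τ, Q τ → Q' τ) : Runs W P σ K' Q' := by
  obtain ⟨k, τ, he, hk, hq⟩ := h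
  exact ⟨k, τ, he, hk.trans hK, hQ τ hq⟩

theorem Runs.seq {W : ℕ} {P P' : Cmd} {σ : State} {K K' : ℕ} {Q Q' : State → Prop}
    (h : Runs W P σ K Q) (h' : ∀ τ, Q τ → Runs W P' τ K' Q') :
    Runs W (.seq P P') σ (K + K') Q' := by
  obtain ⟨k, τ, he, hk, hq⟩ := h
  obtain ⟨k', τ', he', hk', hq'⟩ := h' τ hq
  exact ⟨k + k', τ', .seq he he', by omega, hq'⟩

/-- The rule for loops: `I m` is an invariant, where `m` decreases in each iteration. -/
theorem Runs.while' {W : ℕ} {e : Expr} {P : Cmd} {K : ℕ} (I : ℕ → State → Prop)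
    (h : ∀ m σ, I m σ → e.eval σ ≠ 0 → Runs W P σ K fun τ => ∃ m' < m, I m' τ)
    (m : ℕ) : ∀ σ : State, I m σ → Runs W (.while e P) σ ((K + e.cost + 1) * (m + 1)) fun τ =>
      (∃ m', I m' τ) ∧ e.eval τ = 0 := by
  induction m using Nat.strong_induction_on with
  | _ m ih =>
    intro σ hI
    by_cases he : e.eval σ = 0
    · exact ⟨_, σ, .while_false he, by nlinarith, ⟨m, hI⟩, he⟩
    · obtain ⟨k, τ, hx, hk, m', hm', hI'⟩ := h m σ hI he
      obtain ⟨k', ρ, hx', hk', hI', he'⟩ := ih m' hm' τ hI'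
      have : (K + e.cost + 1) * (m' + 1) ≤ (K + e.cost + 1) * m := by gcongr; omega
      exact ⟨_, ρ, .while_true he hx hx', by rw [mul_add]; omega, hI', he'⟩

/-- The rule for loops: `I` is an invariant, `μ` decreases in each iteration. -/
theorem Runs.while {W : ℕ} {e : Expr} {P : Cmd} {K : ℕ} (I : State → Prop) (μ : State → ℕ)
    (h : ∀ σ, I σ → e.eval σ ≠ 0 → Runs W P σ K fun τ => I τ ∧ μ τ < μ σ)
    (m : ℕ) (σ : State) (hI : I σ) (hμ : μ σ ≤ m) :
    Runs W (.while e P) σ ((K + e.cost + 1) * (m + 1)) fun τ => I τ ∧ e.eval τ = 0 := by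
  refine (Runs.while' (fun m σ => I σ ∧ μ σ ≤ m) (fun m σ hσ he => ?_) m σ ⟨hI, hμ⟩).mono le_rfl
    fun τ hτ => ⟨hτ.1.elim fun _ h => h.1, hτ.2⟩
  exact (h σ hσ.1 he).mono le_rfl fun τ hτ => ⟨μ τ, hτ.2.trans_le hσ.2, hτ.1, le_rfl⟩

/-- A command without loops. -/
def Cmd.loopFree : Cmd → Bool
  | .skip => true
  | .set _ _ => true
  | .write _ _ _ => true
  | .seq P Q => P.loopFree && Q.loopFree
  | .ite _ P Q => P.loopFree && Q.loopFree
  | .while _ _ => false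

/-- The result of a command without loops. -/
def Cmd.step : Cmd → State → State
  | .skip, σ => σ
  | .set r e, σ => σ.setReg r (e.eval σ)
  | .write A p e, σ => σ.setArr A (p.eval σ) (e.eval σ)
  | .seq P Q, σ => Q.step (P.step σ)
  | .ite e P Q, σ => if e.eval σ ≠ 0 then P.step σ else Q.step σ
  | .while _ _, σ => σ

/-- The command without loops never stores a number or writes to an address above `W`. -/
def Cmd.Safe (W : ℕ) : Cmd → State → Prop
  | .skip, _ => True
  | .set _ e, σ => e.eval σ ≤ W
  | .write _ p e, σ => p.eval σ ≤ W ∧ e.eval σ ≤ W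
  | .seq P Q, σ => P.Safe W σ ∧ Q.Safe W (P.step σ)
  | .ite e P Q, σ => if e.eval σ ≠ 0 then P.Safe W σ else Q.Safe W σ
  | .while _ _, _ => True

/-- An upper bound for the number of steps of a command without loops. -/
def Cmd.maxCost : Cmd → ℕ
  | .skip => 1
  | .set _ e => e.cost + 1
  | .write _ p e => p.cost + e.cost + 1
  | .seq P Q => P.maxCost + Q.maxCost
  | .ite e P Q => e.cost + 1 + (P.maxCost + Q.maxCost)
  | .while _ _ => 0

theorem Runs.loopFree {W : ℕ} {P : Cmd} {σ : State} {Q : State → Prop} (hP : P.loopFree = true)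
    (hs : P.Safe W σ) (hQ : Q (P.step σ)) : Runs W P σ P.maxCost Q := by
  suffices ∃ k ≤ P.maxCost, Exec W P σ k (P.step σ) by
    obtain ⟨k, hk, hx⟩ := this
    exact ⟨k, _, hx, hk, hQ⟩
  clear hQ
  induction P generalizing σ with
  | skip => exact ⟨_, le_rfl, .skip σ⟩
  | set r e => exact ⟨_, le_rfl, .set r e σ hs⟩
  | write A p e => exact ⟨_, le_rfl, .write A p e σ hs.1 hs.2⟩
  | seq P P' ih ih' =>
    simp only [Cmd.loopFree, Bool.and_eq_true] at hP
    obtain ⟨k, hk, hx⟩ := ih hP.1 hs.1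
    obtain ⟨k', hk', hx'⟩ := ih' hP.2 hs.2
    exact ⟨_, add_le_add hk hk', .seq hx hx'⟩
  | ite e P P' ih ih' =>
    simp only [Cmd.loopFree, Bool.and_eq_true] at hP
    simp only [Cmd.Safe] at hs
    simp only [Cmd.step, Cmd.maxCost]
    by_cases he : e.eval σ = 0
    · rw [if_neg (by simpa using he)] at hs ⊢
      obtain ⟨k, hk, hx⟩ := ih' hP.2 hs
      exact ⟨_, by omega, .ite_false he hx⟩
    · rw [if_pos he] at hs ⊢
      obtain ⟨k, hk, hx⟩ := ih hP.1 hs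
      exact ⟨_, by omega, .ite_true he hx⟩
  | _ => simp [Cmd.loopFree] at hP

theorem Runs.whileStep {W : ℕ} {e : Expr} {P : Cmd} (hP : P.loopFree = true)
    (I : State → Prop) (μ : State → ℕ)
    (h : ∀ σ, I σ → e.eval σ ≠ 0 → P.Safe W σ ∧ I (P.step σ) ∧ μ (P.step σ) < μ σ)
    (m : ℕ) (σ : State) (hI : I σ) (hμ : μ σ ≤ m) :
    Runs W (.while e P) σ ((P.maxCost + e.cost + 1) * (m + 1)) fun τ => I τ ∧ e.eval τ = 0 :=
  Runs.while I μ (fun σ hI he => Runs.loopFree hP (h σ hI he).1 (h σ hI he).2) m σ hI hμ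

/-- The registers that a command may change. -/
def Cmd.regs : Cmd → List ℕ
  | .skip => []
  | .set r _ => [r]
  | .write _ _ _ => []
  | .seq P Q => P.regs ++ Q.regs
  | .ite _ P Q => P.regs ++ Q.regs
  | .while _ P => P.regs

/-- The arrays that a command may change. -/
def Cmd.arrs : Cmd → List ℕ
  | .skip => []
  | .set _ _ => []
  | .write A _ _ => [A]
  | .seq P Q => P.arrs ++ Q.arrs
  | .ite _ P Q => P.arrs ++ Q.arrs
  | .while _ P => P.arrs

theorem Exec.frame {W : ℕ} {P : Cmd} {σ τ : State} {k : ℕ} (h : Exec W P σ k τ) :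
    (∀ r ∉ P.regs, τ.reg r = σ.reg r) ∧ ∀ A ∉ P.arrs, τ.arr A = σ.arr A := by
  induction h with
  | skip => simp
  | set r e σ h =>
    refine ⟨fun r' hr => ?_, fun A _ => rfl⟩
    simp only [Cmd.regs, List.mem_singleton] at hr
    exact Function.update_of_ne hr _ _
  | write A p e σ h h' =>
    refine ⟨fun r' _ => rfl, fun A' hA => ?_⟩
    simp only [Cmd.arrs, List.mem_singleton] at hA
    exact Function.update_of_ne hA _ _
  | seq _ _ ih ih' =>
    refine ⟨fun r hr => ?_, fun A hA => ?_⟩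
    · simp only [Cmd.regs, List.mem_append, not_or] at hr
      rw [ih'.1 r hr.2, ih.1 r hr.1]
    · simp only [Cmd.arrs, List.mem_append, not_or] at hA
      rw [ih'.2 A hA.2, ih.2 A hA.1]
  | ite_true _ _ ih =>
    refine ⟨fun r hr => ?_, fun A hA => ?_⟩
    · simp only [Cmd.regs, List.mem_append, not_or] at hr
      exact ih.1 r hr.1
    · simp only [Cmd.arrs, List.mem_append, not_or] at hA
      exact ih.2 A hA.1
  | ite_false _ _ ih =>
    refine ⟨fun r hr => ?_, fun A hA => ?_⟩
    · simp only [Cmd.regs, List.mem_append, not_or] at hr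
      exact ih.1 r hr.2
    · simp only [Cmd.arrs, List.mem_append, not_or] at hA
      exact ih.2 A hA.2
  | while_true _ _ _ ih ih' =>
    exact ⟨fun r hr => (ih'.1 r hr).trans (ih.1 r hr), fun A hA => (ih'.2 A hA).trans (ih.2 A hA)⟩
  | while_false => simp

theorem Runs.frame {W : ℕ} {P : Cmd} {σ : State} {K : ℕ} {Q : State → Prop}
    (h : Runs W P σ K Q) : Runs W P σ K fun τ =>
      Q τ ∧ (∀ r ∉ P.regs, τ.reg r = σ.reg r) ∧ ∀ A ∉ P.arrs, τ.arr A = σ.arr A := by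
  obtain ⟨k, τ, hx, hk, hQ⟩ := h
  exact ⟨k, τ, hx, hk, hQ, hx.frame⟩

end Machine

theorem Expr.lt_ne_zero {e e' : Expr} {σ : State} :
    (Expr.lt e e').eval σ ≠ 0 ↔ e.eval σ < e'.eval σ := by
  change (if e.eval σ < e'.eval σ then 1 else 0) ≠ 0 ↔ _
  split_ifs with h <;> simp [h]

theorem Expr.lt_eq_zero {e e' : Expr} {σ : State} :
    (Expr.lt e e').eval σ = 0 ↔ e'.eval σ ≤ e.eval σ := by
  rw [← not_iff_not, not_le]
  exact Expr.lt_ne_zero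

section Fill

/-- Store the value of `e` in the cells `0, …, n - 1` of the array `A`. -/
def fill (A : ℕ) (e : Expr) : Cmd :=
  .seq (.set 2 (.const 0)) (.while (.lt (.reg 2) (.reg 0))
    (.seq (.write A (.reg 2) e) (.set 2 (.add (.reg 2) (.const 1)))))

theorem fill_runs {W n A : ℕ} {e : Expr} {σ : State} {b : ℕ} (hn : σ.reg 0 = n) (hW : n ≤ W)
    (hb : b ≤ W) (he : ∀ τ : State, τ.reg 0 = n → e.eval τ = b) :
    Runs W (fill A e) σ ((e.cost + 20) * (n + 1)) fun τ => ∀ i < n, τ.arr A i = b := by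
  have hloop := Runs.whileStep (W := W) (e := .lt (.reg 2) (.reg 0))
    (P := .seq (.write A (.reg 2) e) (.set 2 (.add (.reg 2) (.const 1)))) rfl
    (fun τ => τ.reg 0 = n ∧ τ.reg 2 ≤ n ∧ ∀ i < τ.reg 2, τ.arr A i = b) (fun τ => n - τ.reg 2)
    (fun σ ⟨h0, h2, h3⟩ ht => by
      have hlt : σ.reg 2 < n := by simpa [Expr.eval, h0] using ht
      refine ⟨?_, ?_⟩
      · simp only [Cmd.Safe, Cmd.step, Expr.eval, State.setArr, he σ h0]
        omega
      · simp only [Cmd.step, Expr.eval, State.setArr, State.setReg, he σ h0, Function.update_self]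
        refine ⟨⟨by simp [h0], by omega, fun i hi => ?_⟩, by omega⟩
        by_cases h : i = σ.reg 2
        · simp [h]
        · rw [Function.update_of_ne h]
          exact h3 i (by omega)) n
  refine Runs.mono (Runs.seq (Q := fun τ => τ.reg 0 = n ∧ τ.reg 2 = 0)
    (Runs.loopFree rfl (by simp [Cmd.Safe, Expr.eval])
      (by simp [Cmd.step, State.setReg, Expr.eval, hn]))
    fun τ hτ => hloop τ (by simp [hτ.1, hτ.2]) (by simp)) ?_ ?_
  · simp only [Cmd.maxCost, Expr.cost]
    nlinarith
  · rintro τ ⟨⟨h0, h2, h3⟩, ht⟩ i hi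
    simp only [Expr.eval, h0, ite_eq_right_iff, one_ne_zero, imp_false] at ht
    exact h3 i (by omega)

end Fill

/-! ### Partial matchings in arrays -/

section Matchings

/-- The arrays `mA` and `mB` represent a matching of pairs of the relation `e` between two copies
of `{0, …, n - 1}`: they map each matched number to its partner, and the others to `n`. -/
structure IsMatch (n : ℕ) (e : ℕ → ℕ → Prop) (mA mB : ℕ → ℕ) : Prop where
  leA : ∀ i < n, mA i ≤ n
  leB : ∀ k < n, mB k ≤ n
  AB : ∀ i < n, mA i < n → mB (mA i) = i
  BA : ∀ k < n, mB k < n → mA (mB k) = k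
  edge : ∀ i < n, mA i < n → e i (mA i)

theorem IsMatch.symm {n : ℕ} {e : ℕ → ℕ → Prop} {mA mB : ℕ → ℕ} (h : IsMatch n e mA mB) :
    IsMatch n (fun k i => e i k) mB mA where
  leA := h.leB
  leB := h.leA
  AB := h.BA
  BA := h.AB
  edge k hk hlt := by
    have h1 := h.BA k hk hlt
    have h2 := h.edge _ hlt (by omega)
    rwa [h1] at h2

/-- The partners after the unmatched `i` has taken `k` away from its partner (if any). -/
def takeA (n : ℕ) (mA mB : ℕ → ℕ) (i k : ℕ) : ℕ → ℕ :=
  Function.update (Function.update mA i k) (mB k) n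

theorem takeA_self {n : ℕ} {e : ℕ → ℕ → Prop} {mA mB : ℕ → ℕ} (h : IsMatch n e mA mB)
    {i k : ℕ} (hi : i < n) (hk : k < n) (hfree : mA i = n) : takeA n mA mB i k i = k := by
  have : i ≠ mB k := by
    rintro rfl
    have := h.BA k hk hi
    omega
  simp [takeA, Function.update_of_ne this]

theorem takeA_of_ne {n : ℕ} {mA mB : ℕ → ℕ} {i k b : ℕ} (h : b ≠ i) (h' : b ≠ mB k) :
    takeA n mA mB i k b = mA b := by
  simp [takeA, Function.update_of_ne h, Function.update_of_ne h']

theorem IsMatch.take {n : ℕ} {e : ℕ → ℕ → Prop} {mA mB : ℕ → ℕ} (h : IsMatch n e mA mB)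
    {i k : ℕ} (hi : i < n) (hk : k < n) (hfree : mA i = n) (he : e i k) :
    IsMatch n e (takeA n mA mB i k) (Function.update mB k i) := by
  have hself := takeA_self h hi hk hfree
  have hcase : ∀ b, b ≠ i → takeA n mA mB i k b = n ∨
      (takeA n mA mB i k b = mA b ∧ b ≠ mB k) := by
    intro b hb
    by_cases hb' : b = mB k
    · exact .inl (by simp [takeA, hb'])
    · exact .inr ⟨takeA_of_ne hb hb', hb'⟩
  refine ⟨fun b hb => ?_, fun b hb => ?_, fun b hb hlt => ?_, fun b hb hlt => ?_,
    fun b hb hlt => ?_⟩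
  · by_cases hbi : b = i
    · rw [hbi, hself]; omega
    · rcases hcase b hbi with h1 | h1
      · omega
      · have := h.leA b hb; omega
  · have := h.leB b hb
    rw [Function.update_apply]
    split_ifs <;> omega
  · by_cases hbi : b = i
    · rw [hbi, hself, Function.update_self]
    · rcases hcase b hbi with h1 | ⟨h1, h2⟩
      · omega
      · rw [h1] at hlt ⊢
        have := h.AB b hb hlt
        rw [Function.update_of_ne, this]
        intro h3
        rw [h3] at this
        omega
  · by_cases hbk : b = k
    · rw [hbk, Function.update_self, hself]
    · rw [Function.update_of_ne hbk] at hlt ⊢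
      have h1 := h.BA b hb hlt
      rw [takeA_of_ne, h1]
      · intro h2
        rw [h2, hfree] at h1
        omega
      · intro h2
        rw [h2] at h1 hlt
        have := h.BA k hk hlt
        omega
  · by_cases hbi : b = i
    · rw [hbi, hself]; exact he
    · rcases hcase b hbi with h1 | ⟨h1, h2⟩
      · omega
      · rw [h1] at hlt ⊢
        exact h.edge b hb hlt

end Matchings

/-! ### Proposals in rounds -/

section Propose

/-- The invariant of the proposal loop. All unmatched `i < s`, except for the active `c` (if
`c < n`), have given up. An `i` at level `lev i` has been refused by the neighbours `k < col i`,
because they had a partner of at least this level, and the same holds for all neighbours with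
respect to the previous level. `J` is a further property of the matching. -/
structure ProposeInv (n L : ℕ) (e : ℕ → ℕ → Prop) (lev₀ : ℕ → ℕ)
    (J : (ℕ → ℕ) → (ℕ → ℕ) → Prop) (mA mB lev col : ℕ → ℕ) (s c : ℕ) : Prop where
  isMatch : IsMatch n e mA mB
  prop : J mA mB
  s_le : s ≤ n
  c_le : c ≤ n
  active : c < n → mA c = n
  col_le : ∀ i < n, col i ≤ n
  retired : ∀ i < n, i < s → i ≠ c → mA i = n → L ≤ lev i ∧ col i = n
  scanned : ∀ i < n, ∀ k < n, e i k → k < col i → mB k < n ∧ lev i ≤ lev (mB k)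
  raised : ∀ i < n, ∀ k < n, e i k → lev i ≤ lev₀ i ∨ (mB k < n ∧ lev i ≤ lev (mB k) + 1)
  lev_ge : ∀ i < n, lev₀ i ≤ lev i
  lev_le : ∀ i < n, lev i ≤ lev₀ i ∨ lev i ≤ L

/-- The termination measure of the proposal loop. -/
def proposeMeasure (n L : ℕ) (lev col : ℕ → ℕ) (s c : ℕ) : ℕ :=
  ∑ i ∈ Finset.range n, ((L - lev i) * (n + 1) + (n - col i)) + 2 * (n - s) +
    if c < n then 1 else 0

theorem proposeMeasure_le {n L : ℕ} (lev col : ℕ → ℕ) (s c : ℕ) :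
    proposeMeasure n L lev col s c ≤ n * (L * (n + 1) + n) + 2 * n + 1 := by
  unfold proposeMeasure
  have : ∑ i ∈ Finset.range n, ((L - lev i) * (n + 1) + (n - col i)) ≤
      ∑ _i ∈ Finset.range n, (L * (n + 1) + n) :=
    Finset.sum_le_sum fun i _ => by gcongr <;> omega
  simp only [Finset.sum_const, Finset.card_range, smul_eq_mul] at this
  split_ifs <;> omega

variable {n L : ℕ} {e : ℕ → ℕ → Prop} {lev₀ : ℕ → ℕ} {J : (ℕ → ℕ) → (ℕ → ℕ) → Prop}
  {mA mB lev col : ℕ → ℕ} {s c : ℕ}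

theorem ProposeInv.start (h : ProposeInv n L e lev₀ J mA mB lev col s c) (hc : c = n)
    (hs : s < n) : ProposeInv n L e lev₀ J mA mB lev col (s + 1) (if mA s < n then n else s) := by
  refine { h with s_le := hs, c_le := ?_, active := ?_, retired := ?_ }
  · split_ifs <;> omega
  · have := h.isMatch.leA s hs
    split_ifs <;> omega
  · intro i hi his hic hfree
    refine h.retired i hi ?_ (by omega) hfree
    rcases Nat.lt_succ_iff_lt_or_eq.1 his with h' | rfl
    · exact h'
    · rw [if_neg (by omega)] at hic
      omega

theorem proposeMeasure_start (hc : c = n) (hs : s < n) (c' : ℕ) :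
    proposeMeasure n L lev col (s + 1) c' < proposeMeasure n L lev col s c := by
  unfold proposeMeasure
  split_ifs <;> omega

theorem ProposeInv.giveUp (h : ProposeInv n L e lev₀ J mA mB lev col s c)
    (hcol : n ≤ col c) (hlev : L ≤ lev c) : ProposeInv n L e lev₀ J mA mB lev col s n := by
  refine { h with c_le := le_rfl, active := by simp, retired := ?_ }
  intro i hi his _ hfree
  by_cases hic : i = c
  · subst hic
    exact ⟨hlev, le_antisymm (h.col_le i hi) hcol⟩
  · exact h.retired i hi his hic hfree

theorem proposeMeasure_giveUp (hc : c < n) :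
    proposeMeasure n L lev col s n < proposeMeasure n L lev col s c := by
  simp [proposeMeasure, hc]

theorem ProposeInv.raise (h : ProposeInv n L e lev₀ J mA mB lev col s c) (hc : c < n)
    (hcol : n ≤ col c) (hlev : lev c < L) : ProposeInv n L e lev₀ J mA mB
      (Function.update lev c (lev c + 1)) (Function.update col c 0) s c := by
  have hle : ∀ i, lev i ≤ Function.update lev c (lev c + 1) i := fun i => by
    rw [Function.update_apply]; split_ifs with h' <;> simp [h']
  refine { h with
    col_le := ?_, retired := ?_, scanned := ?_, raised := ?_, lev_ge := ?_, lev_le := ?_ }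
  · intro i hi
    have := h.col_le i hi
    rw [Function.update_apply]; split_ifs <;> omega
  · intro i hi his hic hfree
    rw [Function.update_of_ne hic, Function.update_of_ne hic]
    exact h.retired i hi his hic hfree
  · intro i hi k hk he hkc
    by_cases hic : i = c
    · simp [hic] at hkc
    · rw [Function.update_of_ne hic] at hkc ⊢
      have := h.scanned i hi k hk he hkc
      exact ⟨this.1, this.2.trans (hle _)⟩
  · intro i hi k hk he
    by_cases hic : i = c
    · subst hic
      have := h.scanned i hi k hk he (by omega)
      refine .inr ⟨this.1, ?_⟩
      rw [Function.update_self]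
      exact Nat.succ_le_succ (this.2.trans (hle _))
    · rw [Function.update_of_ne hic]
      exact (h.raised i hi k hk he).imp_right fun h' =>
        ⟨h'.1, h'.2.trans (Nat.succ_le_succ (hle _))⟩
  · exact fun i hi => (h.lev_ge i hi).trans (hle i)
  · intro i hi
    by_cases hic : i = c
    · subst hic
      rw [Function.update_self]
      exact .inr hlev
    · rw [Function.update_of_ne hic]
      exact h.lev_le i hi

theorem proposeMeasure_raise (hc : c < n) (hlev : lev c < L) :
    proposeMeasure n L (Function.update lev c (lev c + 1)) (Function.update col c 0) s c <
      proposeMeasure n L lev col s c := by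
  unfold proposeMeasure
  have : ∑ i ∈ Finset.range n, ((L - Function.update lev c (lev c + 1) i) * (n + 1) +
      (n - Function.update col c 0 i)) <
      ∑ i ∈ Finset.range n, ((L - lev i) * (n + 1) + (n - col i)) := by
    refine Finset.sum_lt_sum (fun i _ => ?_) ⟨c, Finset.mem_range.2 hc, ?_⟩
    · by_cases hic : i = c
      · subst hic
        simp only [Function.update_self]
        obtain ⟨m, hm⟩ : ∃ m, L - lev i = m + 1 := ⟨L - lev i - 1, by omega⟩
        rw [hm, show L - (lev i + 1) = m by omega, add_mul]
        omega
      · simp [Function.update_of_ne hic]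
    · simp only [Function.update_self]
      obtain ⟨m, hm⟩ : ∃ m, L - lev c = m + 1 := ⟨L - lev c - 1, by omega⟩
      rw [hm, show L - (lev c + 1) = m by omega, add_mul]
      omega
  omega

theorem ProposeInv.refuse (h : ProposeInv n L e lev₀ J mA mB lev col s c)
    (hcol : col c < n) (hno : e c (col c) → mB (col c) < n ∧ lev c ≤ lev (mB (col c))) :
    ProposeInv n L e lev₀ J mA mB lev (Function.update col c (col c + 1)) s c := by
  refine { h with col_le := ?_, retired := ?_, scanned := ?_ }
  · intro i hi
    have := h.col_le i hi
    rw [Function.update_apply]; split_ifs <;> omega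
  · intro i hi his hic hfree
    rw [Function.update_of_ne hic]
    exact h.retired i hi his hic hfree
  · intro i hi k hk he hkc
    by_cases hic : i = c
    · subst hic
      rw [Function.update_self] at hkc
      rcases Nat.lt_succ_iff_lt_or_eq.1 hkc with h' | rfl
      · exact h.scanned i hi k hk he h'
      · exact hno he
    · rw [Function.update_of_ne hic] at hkc
      exact h.scanned i hi k hk he hkc

theorem ProposeInv.accept (h : ProposeInv n L e lev₀ J mA mB lev col s c) (hc : c < n)
    (hJ : ∀ mA mB i k, IsMatch n e mA mB → J mA mB → i < n → k < n → mA i = n → e i k →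
      J (takeA n mA mB i k) (Function.update mB k i))
    (hcol : col c < n) (he : e c (col c)) (hyes : mB (col c) < n → lev (mB (col c)) < lev c) :
    ProposeInv n L e lev₀ J (takeA n mA mB c (col c)) (Function.update mB (col c) c) lev
      (Function.update col c (col c + 1)) s (mB (col c)) := by
  have hfree := h.active hc
  have hne : mB (col c) ≠ c := by
    intro h1
    have := h.isMatch.BA _ hcol (by omega)
    rw [h1] at this
    omega
  have hup : ∀ k < n, ∀ b, mB k < n ∧ b ≤ lev (mB k) → Function.update mB (col c) c k < n ∧
      b ≤ lev (Function.update mB (col c) c k) := by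
    intro k hk b hb
    by_cases hkc : k = col c
    · subst hkc
      rw [Function.update_self]
      exact ⟨hc, hb.2.trans (hyes hb.1).le⟩
    · rwa [Function.update_of_ne hkc]
  refine { h with
    isMatch := h.isMatch.take hc hcol hfree he
    prop := hJ _ _ _ _ h.isMatch h.prop hc hcol hfree he
    c_le := h.isMatch.leB _ hcol
    active := ?_, col_le := ?_, retired := ?_, scanned := ?_, raised := ?_ }
  · intro _
    simp [takeA]
  · intro i hi
    have := h.col_le i hi
    rw [Function.update_apply]; split_ifs <;> omega
  · intro i hi his hic hfree'
    by_cases hic' : i = c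
    · rw [hic', takeA_self h.isMatch hc hcol hfree] at hfree'
      omega
    · rw [takeA_of_ne hic' hic] at hfree'
      rw [Function.update_of_ne hic']
      exact h.retired i hi his hic' hfree'
  · intro i hi k hk he' hkc
    by_cases hic : i = c
    · subst hic
      rw [Function.update_self] at hkc
      rcases Nat.lt_succ_iff_lt_or_eq.1 hkc with h' | rfl
      · exact hup k hk _ (h.scanned i hi k hk he' h')
      · simp [hc]
    · rw [Function.update_of_ne hic] at hkc
      exact hup k hk _ (h.scanned i hi k hk he' hkc)
  · intro i hi k hk he'
    refine (h.raised i hi k hk he').imp_right fun ⟨h1, h2⟩ => ?_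
    have := hup k hk (lev i - 1) ⟨h1, by omega⟩
    exact ⟨this.1, by omega⟩

theorem proposeMeasure_next (hc : c < n) (hcol : col c < n) (c' : ℕ) :
    proposeMeasure n L lev (Function.update col c (col c + 1)) s c' <
      proposeMeasure n L lev col s c := by
  unfold proposeMeasure
  have : ∑ i ∈ Finset.range n, ((L - lev i) * (n + 1) +
      (n - Function.update col c (col c + 1) i)) <
      ∑ i ∈ Finset.range n, ((L - lev i) * (n + 1) + (n - col i)) := by
    refine Finset.sum_lt_sum (fun i _ => ?_) ⟨c, Finset.mem_range.2 hc, ?_⟩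
    · by_cases hic : i = c
      · subst hic
        simp only [Function.update_self]
        omega
      · simp [Function.update_of_ne hic]
    · simp only [Function.update_self]
      omega
  rw [if_pos hc]
  split_ifs <;> omega

end Propose

/-! ### The program for the proposals -/

section ProposeProgram

/-- The entry of the input table for the `i`-th and the `k`-th agent of different sides; the side
of the first one is given by `b`. -/
def entry (b : Bool) (i k : Expr) : Expr :=
  .read 0 (if b then .add (.mul i (.reg 0)) k else .add (.mul k (.reg 0)) i)

/-- An iteration of the proposal loop. Register `2` holds the first agent that has not started yet,
register `3` the agent that is proposing (`n` if there is none), and array `4` the next candidates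
of all agents. An agent who loses her partner becomes the proposing one. If the candidate was
unmatched, then `n` takes the place of that partner, and the cell `n` of the array `A`, whose
contents do not matter, is overwritten. The sum of two truth values is their disjunction. -/
def proposeBody (b : Bool) (A B V : ℕ) : Cmd :=
  .ite (.lt (.reg 3) (.reg 0))
    (.seq (.set 4 (.read 4 (.reg 3)))
      (.ite (.lt (.reg 4) (.reg 0))
        (.seq (.write 4 (.reg 3) (.add (.reg 4) (.const 1)))
          (.ite (entry b (.reg 3) (.reg 4))
            (.seq (.set 5 (.read B (.reg 4)))
              (.ite (.add (.sub (.const 1) (.lt (.reg 5) (.reg 0)))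
                  (.lt (.read V (.reg 5)) (.read V (.reg 3))))
                (.seq (.write B (.reg 4) (.reg 3)) (.seq (.write A (.reg 3) (.reg 4))
                  (.seq (.write A (.reg 5) (.reg 0)) (.set 3 (.reg 5)))))
                .skip))
            .skip))
        (.ite (.lt (.read V (.reg 3)) (.reg 1))
          (.seq (.write V (.reg 3) (.add (.read V (.reg 3)) (.const 1)))
            (.write 4 (.reg 3) (.const 0)))
          (.set 3 (.reg 0)))))
    (.seq (.ite (.lt (.read A (.reg 2)) (.reg 0)) .skip (.set 3 (.reg 2)))
      (.set 2 (.add (.reg 2) (.const 1))))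

/-- Unmatched agents of one side propose to the agents of the other side. `A` and `B` are the
arrays of partners of the two sides, and `V` holds the levels of the proposing side. An agent
proposes to the others in turn, is accepted if these are unmatched or have a partner of lower level,
and in the end raises her level, or gives up if her level is at least that in register `1`. The loop
ends when the registers `2` and `3`, which are at most `n`, are both `n`. -/
def propose (b : Bool) (A B V : ℕ) : Cmd :=
  .seq (fill 4 (.const 0)) (.seq (.set 2 (.const 0)) (.seq (.set 3 (.reg 0))
    (.while (.lt (.add (.reg 2) (.reg 3)) (.add (.reg 0) (.reg 0))) (proposeBody b A B V))))

/-- The input table (array `0`) describes the relation `e`, whose first argument is the row of the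
table if `b` is true, and the column otherwise. -/
def HasTable (b : Bool) (n : ℕ) (e : ℕ → ℕ → Prop) (σ : State) : Prop :=
  σ.reg 0 = n ∧ ∀ i < n, ∀ k < n,
    σ.arr 0 (if b then i * n + k else k * n + i) ≠ 0 ↔ e i k

theorem entry_eval (b : Bool) (i k : Expr) (σ : State) : (entry b i k).eval σ =
    σ.arr 0 (if b then i.eval σ * σ.reg 0 + k.eval σ else k.eval σ * σ.reg 0 + i.eval σ) := by
  cases b <;> simp [entry, Expr.eval]

theorem HasTable.congr {b : Bool} {n : ℕ} {e : ℕ → ℕ → Prop} {σ τ : State}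
    (h : HasTable b n e σ) (h0 : τ.reg 0 = σ.reg 0) (hA : τ.arr 0 = σ.arr 0) :
    HasTable b n e τ := by
  unfold HasTable
  rw [h0, hA]
  exact h

variable {W n L : ℕ} {e : ℕ → ℕ → Prop} {lev₀ : ℕ → ℕ} {J : (ℕ → ℕ) → (ℕ → ℕ) → Prop}
  {b : Bool} {A B V : ℕ}

/-- The invariant of the proposal loop, for memory states. -/
def ProposeState (b : Bool) (n L : ℕ) (e : ℕ → ℕ → Prop) (lev₀ : ℕ → ℕ)
    (J : (ℕ → ℕ) → (ℕ → ℕ) → Prop) (A B V : ℕ) (σ : State) : Prop :=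
  HasTable b n e σ ∧ σ.reg 1 = L ∧
    ProposeInv n L e lev₀ J (σ.arr A) (σ.arr B) (σ.arr V) (σ.arr 4) (σ.reg 2) (σ.reg 3)

set_option linter.unusedSimpArgs false in
theorem proposeBody_spec (hA : A ∉ [0, 4]) (hB : B ∉ [0, 4]) (hV : V ∉ [0, 4]) (hAB : A ≠ B)
    (hAV : A ≠ V) (hBV : B ≠ V) (hnW : n ≤ W) (hLW : L ≤ W)
    (hJ : ∀ mA mB i k, IsMatch n e mA mB → J mA mB → i < n → k < n → mA i = n → e i k →
      J (takeA n mA mB i k) (Function.update mB k i)) (σ : State)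
    (hσ : ProposeState b n L e lev₀ J A B V σ)
    (ht : (Expr.lt (.add (.reg 2) (.reg 3)) (.add (.reg 0) (.reg 0))).eval σ ≠ 0) :
    (proposeBody b A B V).Safe W σ ∧
      ProposeState b n L e lev₀ J A B V ((proposeBody b A B V).step σ) ∧
      proposeMeasure n L (((proposeBody b A B V).step σ).arr V)
        (((proposeBody b A B V).step σ).arr 4) (((proposeBody b A B V).step σ).reg 2)
        (((proposeBody b A B V).step σ).reg 3) <
      proposeMeasure n L (σ.arr V) (σ.arr 4) (σ.reg 2) (σ.reg 3) := by
  obtain ⟨⟨hn, htab⟩, hL, hinv⟩ := hσ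
  have hne : (A ≠ 0 ∧ A ≠ 4 ∧ B ≠ 0 ∧ B ≠ 4 ∧ V ≠ 0 ∧ V ≠ 4 ∧ A ≠ B ∧ A ≠ V ∧ B ≠ V) ∧
      (0 ≠ A ∧ 4 ≠ A ∧ 0 ≠ B ∧ 4 ≠ B ∧ 0 ≠ V ∧ 4 ≠ V ∧ B ≠ A ∧ V ≠ A ∧ V ≠ B) := by
    simp only [List.mem_cons, List.not_mem_nil, or_false, not_or] at hA hB hV
    omega
  have hs := hinv.s_le
  have hc := hinv.c_le
  by_cases hact : σ.reg 3 < n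
  · by_cases hcol : σ.arr 4 (σ.reg 3) < n
    · by_cases he : e (σ.reg 3) (σ.arr 4 (σ.reg 3))
      · have he' := (htab _ hact _ hcol).2 he
        have hm := hinv.isMatch.leB _ hcol
        by_cases hacc : σ.arr B (σ.arr 4 (σ.reg 3)) < n →
            σ.arr V (σ.arr B (σ.arr 4 (σ.reg 3))) < σ.arr V (σ.reg 3)
        · have hacc' : ¬ ((1 - if σ.arr B (σ.arr 4 (σ.reg 3)) < n then 1 else 0) = 0 ∧
              σ.arr V (σ.reg 3) ≤ σ.arr V (σ.arr B (σ.arr 4 (σ.reg 3)))) := by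
            split_ifs <;> simp_all
          have h1 := hinv.accept hact hJ hcol he hacc
          have h2 := proposeMeasure_next (L := L) (s := σ.reg 2) (lev := σ.arr V) hact hcol
            (σ.arr B (σ.arr 4 (σ.reg 3)))
          simp [proposeBody, Cmd.Safe, Cmd.step, Expr.eval, entry_eval, State.setReg, State.setArr,
            Function.update_of_ne, ProposeState, HasTable, hn, hL, hact, hcol, he', hacc', hne]
          exact ⟨⟨by omega, by omega, by omega, by omega, by omega⟩, ⟨htab, h1⟩, h2⟩
        · push Not at hacc
          have hacc' : (1 - if σ.arr B (σ.arr 4 (σ.reg 3)) < n then 1 else 0) = 0 ∧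
              σ.arr V (σ.reg 3) ≤ σ.arr V (σ.arr B (σ.arr 4 (σ.reg 3))) := by
            simp [hacc]
          have h1 := hinv.refuse hcol fun _ => hacc
          have h2 := proposeMeasure_next (L := L) (s := σ.reg 2) (lev := σ.arr V) hact hcol
            (σ.reg 3)
          simp [proposeBody, Cmd.Safe, Cmd.step, Expr.eval, entry_eval, State.setReg, State.setArr,
            Function.update_of_ne, ProposeState, HasTable, hn, hL, hact, hcol, he', hacc', hne]
          exact ⟨by omega, ⟨htab, h1⟩, h2⟩
      · have he' := not_not.1 (mt (htab _ hact _ hcol).1 he)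
        have h1 := hinv.refuse hcol fun h => absurd h he
        have h2 := proposeMeasure_next (L := L) (s := σ.reg 2) (lev := σ.arr V) hact hcol
          (σ.reg 3)
        simp [proposeBody, Cmd.Safe, Cmd.step, Expr.eval, entry_eval, State.setReg, State.setArr,
          Function.update_of_ne, ProposeState, HasTable, hn, hL, hact, hcol, he', hne]
        exact ⟨by omega, ⟨htab, h1⟩, h2⟩
    · have hcl := hinv.col_le _ hact
      by_cases hlev : σ.arr V (σ.reg 3) < L
      · have h1 := hinv.raise hact (by omega) hlev
        have h2 := proposeMeasure_raise (s := σ.reg 2) (col := σ.arr 4) hact hlev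
        simp [proposeBody, Cmd.Safe, Cmd.step, Expr.eval, entry_eval, State.setReg, State.setArr,
          Function.update_of_ne, ProposeState, HasTable, hn, hL, hact, hcol, hlev, hne]
        exact ⟨by omega, ⟨htab, h1⟩, h2⟩
      · have h1 := hinv.giveUp (by omega) (by omega)
        have h2 := proposeMeasure_giveUp (L := L) (lev := σ.arr V) (col := σ.arr 4)
          (s := σ.reg 2) hact
        simp [proposeBody, Cmd.Safe, Cmd.step, Expr.eval, entry_eval, State.setReg, State.setArr,
          Function.update_of_ne, ProposeState, HasTable, hn, hL, hact, hcol, hlev, hne]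
        exact ⟨by omega, ⟨htab, h1⟩, h2⟩
  · have hs' : σ.reg 2 < n := by
      simp only [Expr.eval, hn, ne_eq, ite_eq_right_iff, one_ne_zero, imp_false, not_not] at ht
      omega
    have h1 := hinv.start (by omega) hs'
    have h2 := proposeMeasure_start (L := L) (lev := σ.arr V) (col := σ.arr 4) (c := n)
      rfl hs' (if σ.arr A (σ.reg 2) < n then n else σ.reg 2)
    by_cases hm : σ.arr A (σ.reg 2) < n
    · rw [if_pos hm] at h1 h2
      simp [proposeBody, Cmd.Safe, Cmd.step, Expr.eval, entry_eval, State.setReg, State.setArr,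
        Function.update_of_ne, ProposeState, HasTable, hn, hL, hact, hm, hne]
      rw [show σ.reg 3 = n by omega]
      exact ⟨by omega, ⟨htab, h1⟩, h2⟩
    · rw [if_neg hm] at h1 h2
      simp [proposeBody, Cmd.Safe, Cmd.step, Expr.eval, entry_eval, State.setReg, State.setArr,
        Function.update_of_ne, ProposeState, HasTable, hn, hL, hact, hm, hne]
      rw [show σ.reg 3 = n by omega]
      exact ⟨⟨by omega, by omega⟩, ⟨htab, h1⟩, h2⟩

end ProposeProgram

section ProposeRuns

variable {W n L : ℕ} {e : ℕ → ℕ → Prop} {J : (ℕ → ℕ) → (ℕ → ℕ) → Prop}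
  {b : Bool} {A B V : ℕ}

theorem propose_frame (b : Bool) (A B V : ℕ) :
    (∀ r ∉ [2, 3, 4, 5], r ∉ (propose b A B V).regs) ∧
      ∀ a ∉ [A, B, V, 4], a ∉ (propose b A B V).arrs := by
  refine ⟨fun r hr => ?_, fun a ha => ?_⟩
  · simp [propose, fill, proposeBody, Cmd.regs] at hr ⊢
    omega
  · simp [propose, fill, proposeBody, Cmd.arrs] at ha ⊢
    omega

theorem propose_runs (hA : A ∉ [0, 4]) (hB : B ∉ [0, 4]) (hV : V ∉ [0, 4]) (hAB : A ≠ B)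
    (hAV : A ≠ V) (hBV : B ≠ V) (hnW : n ≤ W) (hLW : L ≤ W)
    (hJ : ∀ mA mB i k, IsMatch n e mA mB → J mA mB → i < n → k < n → mA i = n → e i k →
      J (takeA n mA mB i k) (Function.update mB k i)) (σ : State)
    (htab : HasTable b n e σ) (hL : σ.reg 1 = L) (hm : IsMatch n e (σ.arr A) (σ.arr B))
    (hJσ : J (σ.arr A) (σ.arr B)) :
    Runs W (propose b A B V) σ (400 * ((n + 1) ^ 2 * (L + 1))) fun τ =>
      ProposeInv n L e (σ.arr V) J (τ.arr A) (τ.arr B) (τ.arr V) (τ.arr 4) n n ∧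
      (∀ r ∉ [2, 3, 4, 5], τ.reg r = σ.reg r) ∧ ∀ a ∉ [A, B, V, 4], τ.arr a = σ.arr a := by
  have hloop := Runs.whileStep (W := W) (P := proposeBody b A B V)
    (e := .lt (.add (.reg 2) (.reg 3)) (.add (.reg 0) (.reg 0))) (by cases b <;> rfl)
    (ProposeState b n L e (σ.arr V) J A B V)
    (fun σ => proposeMeasure n L (σ.arr V) (σ.arr 4) (σ.reg 2) (σ.reg 3))
    (fun ρ => proposeBody_spec (lev₀ := σ.arr V) hA hB hV hAB hAV hBV hnW hLW hJ ρ)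
    (n * (L * (n + 1) + n) + 2 * n + 1)
  have hmain : Runs W (propose b A B V) σ (400 * ((n + 1) ^ 2 * (L + 1))) fun τ =>
      ProposeInv n L e (σ.arr V) J (τ.arr A) (τ.arr B) (τ.arr V) (τ.arr 4) n n := by
    refine Runs.mono (Runs.seq (fill_runs htab.1 hnW (Nat.zero_le W) (fun _ _ => rfl)).frame
      fun τ hτ => Runs.seq (Runs.loopFree rfl (Q := fun ρ => ρ = τ.setReg 2 0)
        (by simp [Cmd.Safe, Expr.eval]) rfl)
      fun τ' hτ' => Runs.seq (Runs.loopFree rfl (Q := fun ρ => ρ = (τ.setReg 2 0).setReg 3 n) ?_ ?_)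
      fun ρ hρ => hloop ρ ?_ (proposeMeasure_le _ _ _ _)) ?_ ?_
    · have h0 : τ.reg 0 = n := (hτ.2.1 0 (by simp [fill, Cmd.regs])).trans htab.1
      subst hτ'
      simpa [Cmd.Safe, Expr.eval, State.setReg, h0] using hnW
    · have h0 : τ.reg 0 = n := (hτ.2.1 0 (by simp [fill, Cmd.regs])).trans htab.1
      subst hτ'
      simp [Cmd.step, Expr.eval, State.setReg, h0]
    · obtain ⟨hfill, hreg, harr⟩ := hτ
      have hr : ∀ r, r ≠ 2 → τ.reg r = σ.reg r := fun r hr => hreg r (by simp [fill, Cmd.regs, hr])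
      have ha : ∀ a, a ≠ 4 → τ.arr a = σ.arr a := fun a ha => harr a (by simp [fill, Cmd.arrs, ha])
      subst hρ
      simp only [List.mem_cons, List.not_mem_nil, or_false, not_or] at hA hB hV
      refine ⟨htab.congr ?_ ?_, ?_, ?_⟩
      · simp [State.setReg, hr]
      · simp [State.setReg, ha]
      · simp [State.setReg, hr, hL]
      · simp only [State.setReg, ha A hA.2, ha B hB.2, ha V hV.2]
        rw [Function.update_self, Function.update_of_ne (by omega), Function.update_self]
        exact {
          isMatch := hm
          prop := hJσ
          s_le := by simp
          c_le := le_rfl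
          active := by simp
          col_le := fun i hi => by rw [hfill i hi]; omega
          retired := by simp
          scanned := fun i hi k hk _ hlt => by rw [hfill i hi] at hlt; omega
          raised := by simp
          lev_ge := by simp
          lev_le := by simp }
    · simp only [Cmd.maxCost, Expr.cost, proposeBody, entry]
      have h1 : ∀ x y : Expr, (if b = true then x else y).cost ≤ x.cost + y.cost := by
        intro x y; split_ifs <;> omega
      have h2 := h1 (.add (.mul (.reg 3) (.reg 0)) (.reg 4))
        (.add (.mul (.reg 4) (.reg 0)) (.reg 3))
      simp only [Expr.cost] at h2
      generalize (if b = true then Expr.add (.mul (.reg 3) (.reg 0)) (.reg 4)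
        else .add (.mul (.reg 4) (.reg 0)) (.reg 3)).cost = q at h2 ⊢
      have hX1 : n + 1 ≤ (n + 1) ^ 2 * (L + 1) := by nlinarith [Nat.zero_le (n * L)]
      have hX2 : n * (L * (n + 1) + n) + 2 * n + 1 + 1 ≤ 2 * ((n + 1) ^ 2 * (L + 1)) := by
        nlinarith [Nat.zero_le (n * L), Nat.zero_le (n * n * L)]
      generalize n * (L * (n + 1) + n) + 2 * n + 1 + 1 = M at hX2
      refine le_trans (b := 21 * (n + 1) + (2 + (2 + 150 * M))) ?_ ?_
      · gcongr
        omega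
      · omega
    · rintro τ ⟨⟨htab', -, hinv⟩, ht⟩
      have h0 := htab'.1
      have h1 := hinv.s_le
      have h2 := hinv.c_le
      simp only [Expr.eval, h0, ite_eq_right_iff, one_ne_zero, imp_false] at ht
      rwa [show τ.reg 2 = n by omega, show τ.reg 3 = n by omega] at hinv
  exact hmain.frame.mono le_rfl fun τ ⟨h1, h2, h3⟩ =>
    ⟨h1, fun r hr => h2 r ((propose_frame b A B V).1 r hr),
      fun a ha => h3 a ((propose_frame b A B V).2 a ha)⟩

end ProposeRuns

/-! ### The matching after the auction is almost maximum -/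

section Deficit

/-- The number of matched agents on the side of `mA`. -/
def msize (n : ℕ) (mA : ℕ → ℕ) : ℕ := ((Finset.range n).filter fun i => mA i < n).card

variable {n L : ℕ} {e : ℕ → ℕ → Prop} {mA mB lev col : ℕ → ℕ}

theorem IsMatch.injOn (h : IsMatch n e mA mB) :
    Set.InjOn mA {i | i < n ∧ mA i < n} := by
  intro i hi j hj hij
  rw [← h.AB i hi.1 hi.2, ← h.AB j hj.1 hj.2, hij]

theorem IsMatch.msize_le (h : IsMatch n e mA mB) : msize n mA ≤ msize n mB := by
  refine Finset.card_le_card_of_injOn mA (fun i hi => ?_) (h.injOn.mono fun i hi => ?_)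
  · simp only [Finset.coe_filter, Finset.mem_range, Set.mem_ofPred_eq] at hi ⊢
    rw [h.AB i hi.1 hi.2]
    exact ⟨hi.2, hi.1⟩
  · simpa using hi

theorem IsMatch.msize_eq (h : IsMatch n e mA mB) : msize n mA = msize n mB :=
  le_antisymm h.msize_le h.symm.msize_le

theorem IsMatch.msize_le_cover (h : IsMatch n e mA mB) {u w : ℕ → ℕ}
    (hcov : ∀ i < n, ∀ k < n, e i k → 1 ≤ u i + w k) :
    msize n mA ≤ ∑ i ∈ Finset.range n, u i + ∑ k ∈ Finset.range n, w k := by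
  set S := (Finset.range n).filter fun i => mA i < n with hS
  have hmem : ∀ i ∈ S, i < n ∧ mA i < n := fun i hi => by simpa [hS] using hi
  calc msize n mA = ∑ _i ∈ S, 1 := by simp [msize, hS]
    _ ≤ ∑ i ∈ S, (u i + w (mA i)) := Finset.sum_le_sum fun i hi =>
        hcov i (hmem i hi).1 _ (hmem i hi).2 (h.edge i (hmem i hi).1 (hmem i hi).2)
    _ = ∑ i ∈ S, u i + ∑ k ∈ S.image mA, w k := by
        rw [Finset.sum_add_distrib, Finset.sum_image]
        exact fun i hi j hj hij => h.injOn (hmem i hi) (hmem j hj) hij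
    _ ≤ _ := by
        gcongr
        · exact Finset.filter_subset _ _
        · intro k hk
          obtain ⟨i, hi, rfl⟩ := Finset.mem_image.1 hk
          exact Finset.mem_range.2 (hmem i hi).2

/-- After the auction the matching is almost maximum. For each threshold `c ≤ L`, the matched
agents `i` of level at most `c` and the agents with a partner of level at least `c` form a cover.
It exceeds the matching by the number of matched agents of level `c`, which is small for
some `c`. -/
theorem ProposeInv.exists_cover {lev₀ : ℕ → ℕ} {J : (ℕ → ℕ) → (ℕ → ℕ) → Prop}
    (h : ProposeInv n L e lev₀ J mA mB lev col n n) (h0 : ∀ i < n, lev₀ i = 0) :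
    ∃ u w : ℕ → ℕ, (∀ i < n, ∀ k < n, e i k → 1 ≤ u i + w k) ∧
      (L + 1) * (∑ i ∈ Finset.range n, u i + ∑ k ∈ Finset.range n, w k) ≤
        (L + 1) * msize n mA + n := by
  set S := (Finset.range n).filter fun i => mA i < n with hS
  have hmem : ∀ i, i ∈ S ↔ i < n ∧ mA i < n := fun i => by simp [hS]
  obtain ⟨c, hc, hcard⟩ : ∃ c ∈ Finset.range (L + 1),
      (L + 1) * (S.filter fun i => lev i = c).card ≤ n := by
    by_contra! hcon
    have h1 : ∑ c ∈ Finset.range (L + 1), (S.filter fun i => lev i = c).card ≤ n := by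
      rw [← Finset.card_biUnion]
      · calc _ ≤ (Finset.range n).card := Finset.card_le_card fun i hi => by
              simp only [Finset.mem_biUnion, Finset.mem_filter, hmem] at hi
              obtain ⟨c, -, hi, -⟩ := hi
              exact Finset.mem_range.2 hi.1
          _ = n := Finset.card_range n
      · intro c _ c' _ hcc
        rw [Function.onFun, Finset.disjoint_left]
        intro i hi hi'
        exact hcc ((Finset.mem_filter.1 hi).2.symm.trans (Finset.mem_filter.1 hi').2)
    have h2 : ∑ _c ∈ Finset.range (L + 1), n <
        ∑ c ∈ Finset.range (L + 1), (L + 1) * (S.filter fun i => lev i = c).card :=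
      Finset.sum_lt_sum_of_nonempty ⟨0, by simp⟩ hcon
    rw [← Finset.mul_sum] at h2
    simp only [Finset.sum_const, Finset.card_range, smul_eq_mul] at h2
    have := Nat.mul_le_mul_left (L + 1) h1
    omega
  have hcL : c ≤ L := by simpa [Nat.lt_succ_iff] using hc
  refine ⟨fun i => if mA i < n ∧ lev i ≤ c then 1 else 0,
    fun k => if mB k < n ∧ c ≤ lev (mB k) then 1 else 0, fun i hi k hk he => ?_, ?_⟩
  · by_cases hi' : mA i < n
    · by_cases hl : lev i ≤ c
      · simp [hi', hl]
      · rcases h.raised i hi k hk he with h1 | ⟨h1, h2⟩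
        · rw [h0 i hi] at h1
          omega
        · dsimp only
          rw [if_pos (c := mB k < n ∧ _) ⟨h1, by omega⟩]
          omega
    · have hfree : mA i = n := le_antisymm (h.isMatch.leA i hi) (by omega)
      obtain ⟨h1, h2⟩ := h.retired i hi hi (by omega) hfree
      obtain ⟨h3, h4⟩ := h.scanned i hi k hk he (by omega)
      dsimp only
      rw [if_pos (c := mB k < n ∧ _) ⟨h3, by omega⟩]
      omega
  · have hu : ∑ i ∈ Finset.range n, (if mA i < n ∧ lev i ≤ c then 1 else 0) =
        (S.filter fun i => lev i ≤ c).card := by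
      rw [Finset.sum_boole, hS, Finset.filter_filter, Nat.cast_id]
    have hw : ∑ k ∈ Finset.range n, (if mB k < n ∧ c ≤ lev (mB k) then 1 else 0) ≤
        (S.filter fun i => c ≤ lev i).card := by
      rw [Finset.sum_boole, Nat.cast_id]
      refine Finset.card_le_card_of_injOn mB (fun k hk => ?_)
        (h.isMatch.symm.injOn.mono fun k hk => ?_)
      · simp only [Finset.coe_filter, Finset.mem_range, Set.mem_ofPred_eq, hmem] at hk ⊢
        rw [h.isMatch.BA k hk.1 hk.2.1]
        exact ⟨⟨hk.2.1, hk.1⟩, hk.2.2⟩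
      · simp only [Finset.coe_filter, Finset.mem_range, Set.mem_ofPred_eq] at hk ⊢
        exact ⟨hk.1, hk.2.1⟩
    have hsum : (S.filter fun i => lev i ≤ c).card + (S.filter fun i => c ≤ lev i).card =
        msize n mA + (S.filter fun i => lev i = c).card := by
      rw [← Finset.card_union_add_card_inter, ← Finset.filter_or, ← Finset.filter_and]
      congr 1
      · rw [msize, ← hS, Finset.filter_true_of_mem fun i _ => le_total _ _]
      · congr 1
        ext i
        simp only [Finset.mem_filter, le_antisymm_iff]
    calc _ ≤ (L + 1) * ((S.filter fun i => lev i ≤ c).card +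
          (S.filter fun i => c ≤ lev i).card) := by gcongr; exact hu.le
      _ = (L + 1) * msize n mA + (L + 1) * (S.filter fun i => lev i = c).card := by
        rw [hsum, mul_add]
      _ ≤ _ := by gcongr

end Deficit

/-! ### Augmenting paths -/

section Search

/-- The invariant of the search for an augmenting path. The cells `0, …, tail - 1` of `Q` hold
the agents that have been reached, starting with the unmatched ones; `par k` is the agent from
which `k` has been reached, or `n`. All neighbours of `Q p` for `p < head`, and the neighbours
below `k` of `Q head`, have been reached. -/
structure SearchInv (n : ℕ) (e : ℕ → ℕ → Prop) (mA mB par Q : ℕ → ℕ) (tail head k : ℕ) :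
    Prop where
  head_le : head ≤ tail
  Q_lt : ∀ p < tail, Q p < n
  Q_inj : ∀ p < tail, ∀ q < tail, Q p = Q q → p = q
  Q_pred : ∀ p < tail, mA (Q p) = n ∨
    (mA (Q p) < n ∧ par (mA (Q p)) < n ∧ ∃ r < p, Q r = par (mA (Q p)))
  free_mem : ∀ i < n, mA i = n → ∃ p < tail, Q p = i
  visited : ∀ k < n, par k < n → mB k < n ∧ (∃ p < tail, Q p = mB k) ∧ e (par k) k
  scanned : ∀ p < tail, ∀ k' < n, e (Q p) k' → (p < head ∨ (p = head ∧ k' < k)) → par k' < n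

/-- An alternating path from the unmatched agent `f` (if `f < n`) to an agent on the other side
who is unmatched, too: from `k` it goes to `par k`, and from there to the partner of `par k`. The
agent `par f` is at position `m` of the list `Q`, and the later ones are at positions that
decrease. -/
structure PathInv (n : ℕ) (e : ℕ → ℕ → Prop) (par Q : ℕ → ℕ) (T m : ℕ) (mA mB : ℕ → ℕ) (f : ℕ) :
    Prop where
  isMatch : IsMatch n e mA mB
  Q_lt : ∀ p < T, Q p < n
  Q_inj : ∀ p < T, ∀ q < T, Q p = Q q → p = q
  edge : ∀ k < n, par k < n → e (par k) k
  path : f < n → mB f = n ∧ par f < n ∧ m < T ∧ Q m = par f ∧ ∀ r ≤ m, mA (Q r) = n ∨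
    (mA (Q r) < n ∧ par (mA (Q r)) < n ∧ ∃ q < r, Q q = par (mA (Q r)))

variable {W n : ℕ} {e : ℕ → ℕ → Prop} {mA mB par Q : ℕ → ℕ} {tail head k : ℕ}

theorem le_of_inj (hlt : ∀ p < tail, Q p < n)
    (hinj : ∀ p < tail, ∀ q < tail, Q p = Q q → p = q) : tail ≤ n := by
  have := Finset.card_le_card_of_injOn (s := Finset.range tail) (t := Finset.range n) Q
    (fun p hp => by simpa using hlt p (by simpa using hp))
    (fun p hp q hq h => hinj p (by simpa using hp) q (by simpa using hq) h)
  simpa using this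

theorem SearchInv.tail_le (h : SearchInv n e mA mB par Q tail head k) : tail ≤ n :=
  le_of_inj h.Q_lt h.Q_inj

theorem SearchInv.nextHead (h : SearchInv n e mA mB par Q tail head k) (hh : head < tail)
    (hk : n ≤ k) : SearchInv n e mA mB par Q tail (head + 1) 0 := by
  refine { h with head_le := hh, scanned := fun p hp k' hk' he hor => ?_ }
  refine h.scanned p hp k' hk' he ?_
  omega

theorem SearchInv.nextCol (h : SearchInv n e mA mB par Q tail head k) (hk : k < n)
    (hdone : e (Q head) k → par k < n) : SearchInv n e mA mB par Q tail head (k + 1) := by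
  refine { h with scanned := fun p hp k' hk' he hor => ?_ }
  by_cases hcase : p = head ∧ k' = k
  · obtain ⟨rfl, rfl⟩ := hcase
    exact hdone he
  · exact h.scanned p hp k' hk' he (by omega)

theorem SearchInv.push (hm : IsMatch n e mA mB) (h : SearchInv n e mA mB par Q tail head k)
    (hh : head < tail) (hk : k < n) (he : e (Q head) k) (hnew : n ≤ par k) (hmk : mB k < n) :
    SearchInv n e mA mB (Function.update par k (Q head)) (Function.update Q tail (mB k))
      (tail + 1) head (k + 1) := by
  have hnot : ∀ p < tail, Q p ≠ mB k := by
    intro p hp heq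
    have hk' := hm.BA k hk hmk
    rcases h.Q_pred p hp with h1 | ⟨h1, h2, -⟩
    · rw [heq, hk'] at h1
      omega
    · rw [heq, hk'] at h2
      omega
  have hQ : ∀ p < tail, Function.update Q tail (mB k) p = Q p := fun p hp =>
    Function.update_of_ne hp.ne _ _
  have hQt : Function.update Q tail (mB k) tail = mB k := Function.update_self _ _ _
  have hpar : ∀ b, b < n → par b < n → Function.update par k (Q head) b = par b := fun b hb hpb =>
    Function.update_of_ne (by rintro rfl; omega) _ _
  have hpar' : ∀ b, par b < n → Function.update par k (Q head) b < n := fun b hb => by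
    rw [Function.update_apply]
    split_ifs
    · exact h.Q_lt head hh
    · exact hb
  refine ⟨by have := h.head_le; omega, fun p hp => ?_, fun p hp q hq heq => ?_, fun p hp => ?_,
    fun i hi hfree => ?_, fun b hb hpb => ?_, fun p hp b hb hpb hor => ?_⟩
  · rcases Nat.lt_succ_iff_lt_or_eq.1 hp with hp | rfl
    · rw [hQ p hp]; exact h.Q_lt p hp
    · rwa [hQt]
  · rcases Nat.lt_succ_iff_lt_or_eq.1 hp with hp | rfl <;>
      rcases Nat.lt_succ_iff_lt_or_eq.1 hq with hq | rfl
    · rw [hQ p hp, hQ q hq] at heq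
      exact h.Q_inj p hp q hq heq
    · rw [hQ p hp, hQt] at heq
      exact absurd heq (hnot p hp)
    · rw [hQ q hq, hQt] at heq
      exact absurd heq.symm (hnot q hq)
    · rfl
  · rcases Nat.lt_succ_iff_lt_or_eq.1 hp with hp | rfl
    · rw [hQ p hp]
      refine (h.Q_pred p hp).imp_right fun ⟨h1, h2, r, h3, h4⟩ => ⟨h1, ?_, r, h3, ?_⟩
      · rwa [hpar _ h1 h2]
      · rw [hpar _ h1 h2, hQ r (by omega), h4]
    · rw [hQt, hm.BA k hk hmk, Function.update_self]
      exact .inr ⟨hk, h.Q_lt head hh, head, hh, hQ head hh⟩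
  · obtain ⟨p, hp, hpi⟩ := h.free_mem i hi hfree
    exact ⟨p, by omega, by rw [hQ p hp, hpi]⟩
  · by_cases hbk : b = k
    · subst hbk
      rw [Function.update_self]
      exact ⟨hmk, ⟨tail, by omega, hQt⟩, he⟩
    · rw [Function.update_of_ne hbk] at hpb ⊢
      obtain ⟨h1, ⟨p, hp, h2⟩, h3⟩ := h.visited b hb hpb
      exact ⟨h1, ⟨p, by omega, by rw [hQ p hp, h2]⟩, h3⟩
  · by_cases hbk : b = k
    · subst hbk
      rw [Function.update_self]
      exact h.Q_lt head hh
    · have hp' : p < tail := by omega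
      rw [hQ p hp'] at hpb
      exact hpar' b (h.scanned p hp' b hb hpb (by omega))

theorem SearchInv.path (hm : IsMatch n e mA mB) (h : SearchInv n e mA mB par Q tail head k)
    (hh : head < tail) (hk : k < n) (he : e (Q head) k) (hmk : mB k = n) :
    PathInv n e (Function.update par k (Q head)) Q tail head mA mB k := by
  have hpar : ∀ b, b ≠ k → Function.update par k (Q head) b = par b := fun b hb =>
    Function.update_of_ne hb _ _
  refine ⟨hm, h.Q_lt, h.Q_inj, fun b hb hpb => ?_, fun _ => ⟨hmk, ?_, hh, ?_, ?_⟩⟩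
  · by_cases hbk : b = k
    · subst hbk
      rwa [Function.update_self]
    · rw [hpar b hbk] at hpb ⊢
      exact (h.visited b hb hpb).2.2
  · rw [Function.update_self]
    exact h.Q_lt head hh
  · rw [Function.update_self]
  · intro r hr
    refine (h.Q_pred r (by omega)).imp_right fun h1 => ?_
    rw [hpar]
    · exact h1
    · intro h2
      have := hm.AB _ (h.Q_lt r (by omega)) h1.1
      rw [h2] at this
      have := h.Q_lt r (by omega)
      omega

theorem PathInv.flip {T m f : ℕ} (h : PathInv n e par Q T m mA mB f) (hf : f < n) :
    ∃ m', (mA (par f) < n → m' < m) ∧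
      PathInv n e par Q T m' (Function.update mA (par f) f) (takeA n mB mA f (par f))
        (mA (par f)) := by
  obtain ⟨hfree, hpf, hmT, hQm, hpred⟩ := h.path hf
  have hm' := (h.isMatch.symm.take hf hpf hfree (h.edge f hf hpf)).symm
  have hpm := hpred m le_rfl
  rw [hQm] at hpm
  rcases hpm with hn | ⟨h1, h2, q, hq, h3⟩
  · exact ⟨0, by omega, hm', h.Q_lt, h.Q_inj, h.edge, by omega⟩
  · refine ⟨q, fun _ => hq, hm', h.Q_lt, h.Q_inj, h.edge,
      fun _ => ⟨?_, h2, by omega, h3, ?_⟩⟩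
    · simp [takeA]
    · intro r hr
      have hne : Q r ≠ par f := by
        rw [← hQm]
        intro heq
        have := h.Q_inj r (by omega) m hmT heq
        omega
      rw [Function.update_of_ne hne]
      exact hpred r (by omega)

/-- Matched agents are in the cover with exactly one endpoint of their pair, and others are not:
so the cover `u`, `w` has the size of the matching. -/
structure IsTight (n : ℕ) (e : ℕ → ℕ → Prop) (u w mA mB : ℕ → ℕ) : Prop where
  cover : ∀ i < n, ∀ k < n, e i k → 1 ≤ u i + w k
  tight : ∀ i < n, mA i < n → u i + w (mA i) = 1
  freeA : ∀ i < n, mA i = n → u i = 0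
  freeB : ∀ k < n, mB k = n → w k = 0

/-- When the search fails, the agents that have been reached give a cover. -/
theorem SearchInv.exists_isTight (hm : IsMatch n e mA mB)
    (h : SearchInv n e mA mB par Q tail head k) (hend : tail ≤ head) :
    ∃ u, IsTight n e u (fun k => if par k < n then 1 else 0) mA mB := by
  classical
  refine ⟨fun i => if ∃ p < tail, Q p = i then 0 else 1, fun i hi b hb he => ?_, fun i hi hlt => ?_,
    fun i hi hfree => ?_, fun b hb hfree => ?_⟩
  · by_cases hmem : ∃ p < tail, Q p = i
    · obtain ⟨p, hp, rfl⟩ := hmem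
      simp [h.scanned p hp b hb he (.inl (by omega))]
    · simp [hmem]
  · by_cases hpar : par (mA i) < n
    · have := (h.visited _ hlt hpar).2.1
      rw [hm.AB i hi hlt] at this
      simp [this, hpar]
    · have : ¬ ∃ p < tail, Q p = i := by
        rintro ⟨p, hp, rfl⟩
        rcases h.Q_pred p hp with h1 | ⟨-, h1, -⟩ <;> omega
      simp [this, hpar]
  · simp [h.free_mem i hi hfree]
  · have : ¬ par b < n := fun hpb => by
      have := (h.visited b hb hpb).1
      omega
    simp [this]

end Search

/-! ### The program for augmentation -/

section SearchProgram

/-- Put the unmatched agents into the queue (array `6`). -/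
def searchInit : Cmd :=
  .seq (fill 5 (.reg 0)) (.seq (.set 6 (.const 0)) (.seq (.set 2 (.const 0))
    (.while (.lt (.reg 2) (.reg 0))
      (.seq (.ite (.lt (.read 1 (.reg 2)) (.reg 0)) .skip
        (.seq (.write 6 (.reg 6) (.reg 2)) (.set 6 (.add (.reg 6) (.const 1)))))
        (.set 2 (.add (.reg 2) (.const 1)))))))

/-- An iteration of the search. Register `7` holds the position of the agent in the queue whose
neighbours are being visited, register `4` the next candidate, register `6` the length of the
queue, and array `5` the predecessors on the other side. When an unmatched agent has been found,
the length is set to `0`, which ends the search. -/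
def searchBody : Cmd :=
  .ite (.lt (.reg 4) (.reg 0))
    (.seq
      (.ite (entry true (.read 6 (.reg 7)) (.reg 4))
        (.ite (.lt (.read 5 (.reg 4)) (.reg 0)) .skip
          (.seq (.write 5 (.reg 4) (.read 6 (.reg 7)))
            (.ite (.lt (.read 2 (.reg 4)) (.reg 0))
              (.seq (.write 6 (.reg 6) (.read 2 (.reg 4))) (.set 6 (.add (.reg 6) (.const 1))))
              (.seq (.set 8 (.reg 4)) (.set 6 (.const 0))))))
        .skip)
      (.set 4 (.add (.reg 4) (.const 1))))
    (.seq (.set 7 (.add (.reg 7) (.const 1))) (.set 4 (.const 0)))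

/-- Search for an augmenting path: its end is put into register `8`, or `n` if there is none. -/
def search : Cmd :=
  .seq (.set 7 (.const 0)) (.seq (.set 4 (.const 0)) (.seq (.set 8 (.reg 0))
    (.while (.lt (.reg 7) (.reg 6)) searchBody)))

/-- An iteration along the augmenting path: the unmatched agent in register `4` is matched to her
predecessor, whose former partner (or `n`) is the next one. -/
def flipBody : Cmd :=
  .seq (.set 3 (.read 5 (.reg 4))) (.seq (.set 5 (.read 1 (.reg 3)))
    (.seq (.write 2 (.reg 4) (.reg 3)) (.seq (.write 2 (.reg 5) (.reg 0))
      (.seq (.write 1 (.reg 3) (.reg 4)) (.set 4 (.reg 5))))))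

/-- Augment the matching along the path that has been found. -/
def flip : Cmd :=
  .seq (.set 4 (.reg 8)) (.while (.lt (.reg 4) (.reg 0)) flipBody)

/-- Augment the matching until it is maximum. Register `8` is `n` after a search that has failed. -/
def augment : Cmd :=
  .seq (.set 8 (.const 0)) (.while (.lt (.reg 8) (.reg 0))
    (.seq searchInit (.seq search flip)))

variable {W n : ℕ} {e : ℕ → ℕ → Prop}

theorem searchInit_runs {mA mB : ℕ → ℕ} (hnW : n ≤ W) (hm : IsMatch n e mA mB) (σ : State)
    (h0 : σ.reg 0 = n) (hA : σ.arr 1 = mA) :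
    Runs W searchInit σ (100 * (n + 1)) fun τ =>
      SearchInv n e mA mB (τ.arr 5) (τ.arr 6) (τ.reg 6) 0 0 := by
  have hloop := Runs.whileStep (W := W) (e := .lt (.reg 2) (.reg 0))
    (P := .seq (.ite (.lt (.read 1 (.reg 2)) (.reg 0)) .skip
        (.seq (.write 6 (.reg 6) (.reg 2)) (.set 6 (.add (.reg 6) (.const 1)))))
        (.set 2 (.add (.reg 2) (.const 1)))) rfl
    (fun τ => τ.reg 0 = n ∧ τ.arr 1 = mA ∧ (∀ k < n, τ.arr 5 k = n) ∧
      τ.reg 2 ≤ n ∧ τ.reg 6 ≤ τ.reg 2 ∧ (∀ p < τ.reg 6, τ.arr 6 p < τ.reg 2 ∧ n ≤ mA (τ.arr 6 p)) ∧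
      (∀ p < τ.reg 6, ∀ q < τ.reg 6, τ.arr 6 p = τ.arr 6 q → p = q) ∧
      ∀ i < τ.reg 2, n ≤ mA i → ∃ p < τ.reg 6, τ.arr 6 p = i) (fun τ => n - τ.reg 2)
    (fun σ ⟨h0, hA, hpar, h2, h6, hQ, hinj, hmem⟩ ht => by
      have hlt : σ.reg 2 < n := by simpa [Expr.eval, h0] using ht
      by_cases hm : mA (σ.reg 2) < n
      · simp [Cmd.Safe, Cmd.step, Expr.eval, State.setReg, h0, hA, hm]
        refine ⟨by omega, ⟨hpar, by omega, by omega, fun p hp => ?_, hinj, fun i hi hi' => ?_⟩,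
          by omega⟩
        · exact ⟨(hQ p hp).1.le, (hQ p hp).2⟩
        · refine hmem i ?_ hi'
          by_contra hcon
          rw [show i = σ.reg 2 by omega] at hi'
          omega
      · have hu : ∀ p < σ.reg 6, Function.update (σ.arr 6) (σ.reg 6) (σ.reg 2) p = σ.arr 6 p :=
          fun p hp => Function.update_of_ne hp.ne _ _
        simp [Cmd.Safe, Cmd.step, Expr.eval, State.setReg, State.setArr, h0, hA, hm]
        refine ⟨by omega, ⟨hpar, by omega, by omega, fun p hp => ?_, fun p hp q hq => ?_,
          fun i hi hi' => ?_⟩, by omega⟩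
        · rcases Nat.lt_or_eq_of_le hp with hp | rfl
          · rw [hu p hp]
            exact ⟨(hQ p hp).1.le, (hQ p hp).2⟩
          · rw [Function.update_self]
            omega
        · rcases Nat.lt_or_eq_of_le hp with hp | rfl <;>
            rcases Nat.lt_or_eq_of_le hq with hq | rfl
          · rw [hu p hp, hu q hq]
            exact hinj p hp q hq
          · rw [hu p hp, Function.update_self]
            have := (hQ p hp).1
            omega
          · rw [hu q hq, Function.update_self]
            have := (hQ q hq).1
            omega
          · exact fun _ => rfl
        · rcases Nat.lt_or_eq_of_le hi with hi | rfl
          · obtain ⟨p, hp, hpi⟩ := hmem i hi hi'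
            exact ⟨p, by omega, by rw [hu p hp, hpi]⟩
          · exact ⟨σ.reg 6, by omega, Function.update_self _ _ _⟩) n
  refine Runs.mono (Runs.seq (fill_runs (e := .reg 0) h0 hnW hnW (fun _ h => h)).frame
    fun τ hτ => Runs.seq (Runs.loopFree rfl (Q := fun ρ => ρ = τ.setReg 6 0)
      (by simp [Cmd.Safe, Expr.eval]) rfl)
    fun τ' hτ' => Runs.seq (Runs.loopFree rfl (Q := fun ρ => ρ = (τ.setReg 6 0).setReg 2 0)
      (by simp [Cmd.Safe, Expr.eval]) (by subst hτ'; rfl))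
    fun ρ hρ => hloop ρ ?_ (by omega)) ?_ ?_
  · obtain ⟨hfill, hreg, harr⟩ := hτ
    subst hρ
    have : τ.reg 0 = n := (hreg 0 (by simp [fill, Cmd.regs])).trans h0
    have hA' : τ.arr 1 = mA := (harr 1 (by simp [fill, Cmd.arrs])).trans hA
    simp [State.setReg, this, hA']
    exact hfill
  · simp only [Cmd.maxCost, Expr.cost]
    omega
  · rintro τ ⟨⟨h0, hA, hpar, h2, h6, hQ, hinj, hmem⟩, ht⟩
    simp only [Expr.eval, h0, ite_eq_right_iff, one_ne_zero, imp_false] at ht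
    refine ⟨Nat.zero_le _, fun p hp => (hQ p hp).1.trans_le h2, hinj,
      fun p hp => .inl ?_, fun i hi hfree => hmem i (by omega) hfree.ge, fun k hk hlt => ?_,
      fun p hp k hk he hor => by omega⟩
    · exact le_antisymm (hm.leA _ ((hQ p hp).1.trans_le h2)) (hQ p hp).2
    · rw [hpar k hk] at hlt
      omega

/-- The invariant of the search, for memory states. -/
def SearchState (n : ℕ) (e : ℕ → ℕ → Prop) (mA mB : ℕ → ℕ) (σ : State) : Prop :=
  HasTable true n e σ ∧ σ.arr 1 = mA ∧ σ.arr 2 = mB ∧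
    ((σ.reg 8 = n ∧ SearchInv n e mA mB (σ.arr 5) (σ.arr 6) (σ.reg 6) (σ.reg 7) (σ.reg 4)) ∨
      (σ.reg 8 < n ∧ σ.reg 6 = 0 ∧ ∃ T m, PathInv n e (σ.arr 5) (σ.arr 6) T m mA mB (σ.reg 8)))

set_option linter.unusedSimpArgs false in
theorem searchBody_spec {mA mB : ℕ → ℕ} (hnW : n ≤ W) (hm : IsMatch n e mA mB) (σ : State)
    (hσ : SearchState n e mA mB σ) (ht : (Expr.lt (.reg 7) (.reg 6)).eval σ ≠ 0) :
    searchBody.Safe W σ ∧ SearchState n e mA mB (searchBody.step σ) ∧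
      (n - (searchBody.step σ).reg 7) * (n + 1) + (n - (searchBody.step σ).reg 4) <
        (n - σ.reg 7) * (n + 1) + (n - σ.reg 4) := by
  obtain ⟨⟨h0, htab⟩, hA, hB, hor⟩ := hσ
  have hh : σ.reg 7 < σ.reg 6 := Expr.lt_ne_zero.1 ht
  rcases hor with ⟨h8, hinv⟩ | ⟨-, h6, -⟩
  swap
  · omega
  have htail := hinv.tail_le
  have hQ := hinv.Q_lt _ hh
  by_cases hk : σ.reg 4 < n
  · have hμ : (n - σ.reg 7) * (n + 1) + (n - (σ.reg 4 + 1)) <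
        (n - σ.reg 7) * (n + 1) + (n - σ.reg 4) := by omega
    by_cases he : e (σ.arr 6 (σ.reg 7)) (σ.reg 4)
    · have he' := (htab _ hQ _ hk).2 he
      simp only [if_true] at he'
      by_cases hpar : σ.arr 5 (σ.reg 4) < n
      · have h1 := hinv.nextCol hk fun _ => hpar
        simp [searchBody, Cmd.Safe, Cmd.step, Expr.eval, entry_eval, State.setReg, State.setArr,
          SearchState, HasTable, h0, hA, hB, h8, hk, he', hpar]
        exact ⟨by omega, ⟨by simpa using htab, h1⟩, by omega⟩
      · by_cases hmk : mB (σ.reg 4) < n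
        · have h1 := hinv.push hm hh hk he (by omega) hmk
          have h2 := h1.tail_le
          simp [searchBody, Cmd.Safe, Cmd.step, Expr.eval, entry_eval, State.setReg, State.setArr,
            SearchState, HasTable, h0, hA, hB, h8, hk, he', hpar, hmk]
          exact ⟨by omega, ⟨by simpa using htab, h1⟩, by omega⟩
        · have h1 := hinv.path hm hh hk he (le_antisymm (hm.leB _ hk) (by omega))
          simp [searchBody, Cmd.Safe, Cmd.step, Expr.eval, entry_eval, State.setReg, State.setArr,
            SearchState, HasTable, h0, hA, hB, h8, hk, he', hpar, hmk]
          exact ⟨by omega, ⟨by simpa using htab, .inr ⟨_, _, h1⟩⟩, by omega⟩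
    · have he' := not_not.1 (mt (htab _ hQ _ hk).1 he)
      simp only [if_true] at he'
      have h1 := hinv.nextCol hk fun h => absurd h he
      simp [searchBody, Cmd.Safe, Cmd.step, Expr.eval, entry_eval, State.setReg, State.setArr,
        SearchState, HasTable, h0, hA, hB, h8, hk, he']
      exact ⟨by omega, ⟨by simpa using htab, h1⟩, by omega⟩
  · have h1 := hinv.nextHead hh (by omega)
    simp [searchBody, Cmd.Safe, Cmd.step, Expr.eval, entry_eval, State.setReg, State.setArr,
      SearchState, HasTable, h0, hA, hB, h8, hk]
    refine ⟨by omega, ⟨by simpa using htab, h1⟩, ?_⟩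
    obtain ⟨r, hr⟩ : ∃ r, n - σ.reg 7 = r + 1 := ⟨n - σ.reg 7 - 1, by omega⟩
    rw [hr, show n - (σ.reg 7 + 1) = r by omega, add_mul]
    omega

theorem search_runs {mA mB : ℕ → ℕ} (hnW : n ≤ W) (hm : IsMatch n e mA mB) (σ : State)
    (htab : HasTable true n e σ) (hA : σ.arr 1 = mA) (hB : σ.arr 2 = mB)
    (hinv : SearchInv n e mA mB (σ.arr 5) (σ.arr 6) (σ.reg 6) 0 0) :
    Runs W search σ (200 * (n + 1) ^ 2) fun τ =>
      SearchState n e mA mB τ ∧ (τ.reg 8 = n → τ.reg 6 ≤ τ.reg 7) := by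
  have hloop := Runs.whileStep (W := W) (P := searchBody) rfl _
    (fun σ => (n - σ.reg 7) * (n + 1) + (n - σ.reg 4)) (searchBody_spec hnW hm)
    (n * (n + 1) + n)
  refine Runs.mono (Runs.seq (Runs.loopFree rfl (Q := fun ρ => ρ = σ.setReg 7 0)
      (by simp [Cmd.Safe, Expr.eval]) rfl)
    fun τ hτ => Runs.seq (Runs.loopFree rfl (Q := fun ρ => ρ = (σ.setReg 7 0).setReg 4 0)
      (by simp [Cmd.Safe, Expr.eval]) (by subst hτ; rfl))
    fun τ' hτ' => Runs.seq (Runs.loopFree rfl (Q := fun ρ => ρ =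
      ((σ.setReg 7 0).setReg 4 0).setReg 8 n) ?_ ?_)
    fun ρ hρ => hloop ρ ?_ ?_) ?_ ?_
  · subst hτ'
    simpa [Cmd.Safe, Expr.eval, State.setReg, htab.1] using hnW
  · subst hτ'
    simp [Cmd.step, Expr.eval, State.setReg, htab.1]
  · subst hρ
    refine ⟨htab.congr ?_ ?_, ?_, ?_, .inl ⟨?_, ?_⟩⟩ <;> simp [State.setReg, hA, hB]
    exact hinv
  · subst hρ
    simp [State.setReg]
  · simp only [Cmd.maxCost, Expr.cost, searchBody, entry, if_true]
    have : n * (n + 1) + n + 1 ≤ (n + 1) ^ 2 := by nlinarith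
    have : 0 < (n + 1) ^ 2 := by positivity
    omega
  · rintro τ ⟨hst, ht⟩
    refine ⟨hst, fun _ => ?_⟩
    exact Expr.lt_eq_zero.1 ht

theorem msize_flip {mA mB : ℕ → ℕ} (hm : IsMatch n e mA mB) {i k : ℕ} (hi : i < n) (hk : k < n)
    (hfree : mA i = n) :
    msize n (takeA n mA mB i k) + (if mB k < n then 1 else 0) = msize n mA + 1 := by
  have hself := takeA_self hm hi hk hfree
  set S := (Finset.range n).filter fun i => mA i < n with hS
  have hmem : ∀ b, b ∈ S ↔ b < n ∧ mA b < n := fun b => by simp [hS]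
  have hset : (Finset.range n).filter (fun b => takeA n mA mB i k b < n) =
      insert i (S.erase (mB k)) := by
    ext b
    simp only [Finset.mem_filter, Finset.mem_range, Finset.mem_insert, Finset.mem_erase, hmem]
    by_cases hbi : b = i
    · subst hbi
      simp [hself, hi, hk]
    · by_cases hbh : b = mB k
      · simp [takeA, hbh]
        omega
      · rw [takeA_of_ne hbi hbh]
        simp [hbi, hbh]
  have hiS : i ∉ S.erase (mB k) := by simp [hmem, hfree]
  unfold msize
  rw [hset, Finset.card_insert_of_notMem hiS, ← hS]
  split_ifs with h
  · have hmS : mB k ∈ S := by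
      rw [hmem, hm.BA k hk h]
      exact ⟨h, hk⟩
    have := Finset.card_erase_add_one hmS
    omega
  · have hmS : mB k ∉ S := fun hmS => h ((hmem _).1 hmS).1
    rw [Finset.erase_eq_of_notMem hmS]

theorem flip_runs (hnW : n ≤ W) {T m : ℕ} (σ : State) (h0 : σ.reg 0 = n)
    (h8 : σ.reg 8 < n) (hpath : PathInv n e (σ.arr 5) (σ.arr 6) T m (σ.arr 1) (σ.arr 2) (σ.reg 8)) :
    Runs W flip σ (50 * (n + 1)) fun τ => IsMatch n e (τ.arr 1) (τ.arr 2) ∧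
      msize n (τ.arr 2) = msize n (σ.arr 2) + 1 := by
  have hT : T ≤ n := le_of_inj hpath.Q_lt hpath.Q_inj
  have hloop := Runs.while' (W := W) (e := .lt (.reg 4) (.reg 0)) (P := flipBody)
    (K := flipBody.maxCost)
    (fun j τ => τ.reg 0 = n ∧ (∃ m, (τ.reg 4 < n → m < j) ∧
      PathInv n e (τ.arr 5) (τ.arr 6) T m (τ.arr 1) (τ.arr 2) (τ.reg 4)) ∧
      msize n (τ.arr 2) + (if τ.reg 4 < n then 1 else 0) = msize n (σ.arr 2) + 1)
    (fun j τ ⟨h0, ⟨m, hmj, hp⟩, hsz⟩ ht => by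
      have hlt : τ.reg 4 < n := by simpa [Expr.eval, h0] using ht
      obtain ⟨hfree, hpar, -, -, -⟩ := hp.path hlt
      have hh := hp.isMatch.leA _ hpar
      obtain ⟨m', hm', hp'⟩ := hp.flip hlt
      have hsz' := msize_flip hp.isMatch.symm hlt hpar hfree
      refine Runs.loopFree rfl ?_ ⟨m, hmj hlt, ?_⟩
      · simp [flipBody, Cmd.Safe, Cmd.step, Expr.eval, State.setReg, State.setArr, h0]
        omega
      · simp [flipBody, Cmd.step, Expr.eval, State.setReg, State.setArr, h0]
        rw [if_pos hlt] at hsz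
        exact ⟨⟨m', hm', hp'⟩, hsz'.trans hsz⟩) n
  refine Runs.mono (Runs.seq (Runs.loopFree rfl (Q := fun ρ => ρ = σ.setReg 4 (σ.reg 8))
      (by simp [Cmd.Safe, Expr.eval]; omega) rfl) fun ρ hρ => hloop ρ ?_) ?_ ?_
  · subst hρ
    simp [State.setReg, h0, h8]
    exact ⟨m, ((hpath.path h8).2.2.1).trans_le hT, hpath⟩
  · simp only [Cmd.maxCost, Expr.cost, flipBody]
    omega
  · rintro τ ⟨⟨j, h0, ⟨m, -, hp⟩, hsz⟩, ht⟩
    simp only [Expr.eval, h0, ite_eq_right_iff, one_ne_zero, imp_false] at ht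
    rw [if_neg ht] at hsz
    exact ⟨hp.isMatch, hsz⟩

end SearchProgram

section Augment

variable {W n : ℕ} {e : ℕ → ℕ → Prop}

theorem flip_runs_of_eq (hnW : n ≤ W) (σ : State) (h0 : σ.reg 0 = n) (h8 : σ.reg 8 = n) :
    Runs W flip σ (50 * (n + 1)) fun τ => τ.arr = σ.arr := by
  refine ⟨_, _, .seq (.set 4 (.reg 8) σ (by simpa [Expr.eval, h8])) (.while_false ?_), ?_, rfl⟩
  · rw [Expr.lt_eq_zero]
    simp [Expr.eval, State.setReg, h0, h8]
  · simp only [Expr.cost]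
    omega

theorem augment_runs (hn : 1 ≤ n) (hnW : n ≤ W) {b δ : ℕ}
    (hb : ∀ mA mB, IsMatch n e mA mB → msize n mB ≤ b) (σ : State) (htab : HasTable true n e σ)
    (hm : IsMatch n e (σ.arr 1) (σ.arr 2)) (hδ : b ≤ msize n (σ.arr 2) + δ) :
    Runs W augment σ (400 * ((n + 1) ^ 2 * (δ + 3))) fun τ =>
      (IsMatch n e (τ.arr 1) (τ.arr 2) ∧
        ∃ u, IsTight n e u (fun k => if τ.arr 5 k < n then 1 else 0) (τ.arr 1) (τ.arr 2)) ∧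
      (∀ r ∉ [2, 3, 4, 5, 6, 7, 8], τ.reg r = σ.reg r) ∧
      ∀ a ∉ [1, 2, 5, 6], τ.arr a = σ.arr a := by
  have hloop := Runs.while (W := W) (e := .lt (.reg 8) (.reg 0))
    (P := .seq searchInit (.seq search flip))
    (K := 100 * (n + 1) + (200 * (n + 1) ^ 2 + 50 * (n + 1)))
    (fun σ => HasTable true n e σ ∧ IsMatch n e (σ.arr 1) (σ.arr 2) ∧ (n ≤ σ.reg 8 →
      ∃ u, IsTight n e u (fun k => if σ.arr 5 k < n then 1 else 0) (σ.arr 1) (σ.arr 2)))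
    (fun σ => b - msize n (σ.arr 2) + if σ.reg 8 < n then 1 else 0)
    (fun σ ⟨htab, hm, _⟩ ht => by
      have h8 : σ.reg 8 < σ.reg 0 := Expr.lt_ne_zero.1 ht
      rw [htab.1] at h8
      refine Runs.seq (searchInit_runs hnW hm σ htab.1 rfl).frame fun τ ⟨h1, h2, h3⟩ => ?_
      have hA1 : τ.arr 1 = σ.arr 1 := h3 1 (by simp [searchInit, fill, Cmd.arrs])
      have hA2 : τ.arr 2 = σ.arr 2 := h3 2 (by simp [searchInit, fill, Cmd.arrs])
      have htabτ : HasTable true n e τ := htab.congr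
        (h2 0 (by simp [searchInit, fill, Cmd.regs])) (h3 0 (by simp [searchInit, fill, Cmd.arrs]))
      refine Runs.seq (search_runs hnW hm τ htabτ hA1 hA2 h1)
        fun ρ ⟨⟨htabρ, hB1, hB2, hor⟩, hend⟩ => ?_
      rcases hor with ⟨hρ8, hinv⟩ | ⟨hρ8, -, T, m, hpath⟩
      · refine (flip_runs_of_eq hnW ρ htabρ.1 hρ8).frame.mono le_rfl fun κ ⟨h4, h5, _⟩ => ?_
        have hκ0 : κ.reg 0 = ρ.reg 0 := h5 0 (by simp [flip, flipBody, Cmd.regs])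
        have hκ8 : κ.reg 8 = ρ.reg 8 := h5 8 (by simp [flip, flipBody, Cmd.regs])
        rw [h4, hB1, hB2, hκ8, hρ8]
        exact ⟨⟨htabρ.congr hκ0 (by rw [h4]), hm, fun _ => hinv.exists_isTight hm (hend hρ8)⟩,
          by simp [h8]⟩
      · rw [← hB1, ← hB2] at hpath
        refine (flip_runs hnW ρ htabρ.1 hρ8 hpath).frame.mono le_rfl fun κ ⟨⟨h4, h6⟩, h5, h7⟩ => ?_
        have hκ0 : κ.reg 0 = ρ.reg 0 := h5 0 (by simp [flip, flipBody, Cmd.regs])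
        have hκ8 : κ.reg 8 = ρ.reg 8 := h5 8 (by simp [flip, flipBody, Cmd.regs])
        have hle := hb _ _ h4
        rw [hB2] at h6
        refine ⟨⟨htabρ.congr hκ0 (h7 0 (by simp [flip, flipBody, Cmd.arrs])), h4, fun h => ?_⟩, ?_⟩
        · omega
        · rw [hκ8, if_pos hρ8, if_pos h8]
          omega) (δ + 1)
  have hmain : Runs W augment σ (400 * ((n + 1) ^ 2 * (δ + 3))) fun τ =>
      IsMatch n e (τ.arr 1) (τ.arr 2) ∧
        ∃ u, IsTight n e u (fun k => if τ.arr 5 k < n then 1 else 0) (τ.arr 1) (τ.arr 2) := by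
    refine Runs.mono (Runs.seq (Runs.loopFree rfl (Q := fun ρ => ρ = σ.setReg 8 0)
      (by simp [Cmd.Safe, Expr.eval]) rfl) fun ρ hρ => hloop ρ ?_ ?_) ?_ ?_
    · subst hρ
      refine ⟨htab.congr (by simp [State.setReg]) rfl, hm, fun h => ?_⟩
      simp [State.setReg] at h
      omega
    · subst hρ
      simp only [State.setReg, Function.update_self, if_pos (show 0 < n by omega)]
      omega
    · simp only [Cmd.maxCost, Expr.cost]
      have h1 : n + 1 ≤ (n + 1) ^ 2 := by nlinarith
      have h2 : 0 < (n + 1) ^ 2 := by positivity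
      have h3 : (n + 1) ^ 2 * (δ + 3) = (n + 1) ^ 2 * (δ + 1 + 1) + (n + 1) ^ 2 := by ring
      rw [h3]
      have h4 : (100 * (n + 1) + (200 * (n + 1) ^ 2 + 50 * (n + 1)) + (1 + 1 + 1) + 1) *
          (δ + 1 + 1) ≤ (400 * (n + 1) ^ 2) * (δ + 1 + 1) := by
        gcongr
        omega
      rw [mul_assoc] at h4
      omega
    · rintro τ ⟨⟨htab, hm, h⟩, ht⟩
      have := Expr.lt_eq_zero.1 ht
      exact ⟨hm, h (htab.1.ge.trans this)⟩
  refine hmain.frame.mono le_rfl fun τ ⟨h1, h2, h3⟩ =>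
    ⟨h1, fun r hr => h2 r ?_, fun a ha => h3 a ?_⟩
  · simp [augment, searchInit, search, searchBody, flip, flipBody, fill, Cmd.regs] at hr ⊢
    omega
  · simp [augment, searchInit, search, searchBody, flip, flipBody, fill, Cmd.arrs] at ha ⊢
    omega

end Augment

/-! ### An integer square root -/

section Root

/-- Compute the square root of `n`, rounded up, in register `1`. -/
def sqrtCeil : Cmd :=
  .seq (.set 1 (.const 0)) (.while (.lt (.mul (.reg 1) (.reg 1)) (.reg 0))
    (.set 1 (.add (.reg 1) (.const 1))))

theorem sqrtCeil_runs {W n : ℕ} (hnW : n ≤ W) (σ : State) (h0 : σ.reg 0 = n) :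
    Runs W sqrtCeil σ (20 * (n + 1)) fun τ => n ≤ τ.reg 1 * τ.reg 1 ∧ τ.reg 1 ≤ n ∧
      (τ.reg 1 - 1) * (τ.reg 1 - 1) ≤ n := by
  have hloop := Runs.whileStep (W := W) (e := .lt (.mul (.reg 1) (.reg 1)) (.reg 0))
    (P := .set 1 (.add (.reg 1) (.const 1))) rfl
    (fun τ => τ.reg 0 = n ∧ τ.reg 1 ≤ n ∧ (τ.reg 1 - 1) * (τ.reg 1 - 1) ≤ n)
    (fun τ => n - τ.reg 1)
    (fun τ ⟨h0, h1, h2⟩ ht => by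
      have hlt : τ.reg 1 * τ.reg 1 < τ.reg 0 := Expr.lt_ne_zero.1 ht
      rw [h0] at hlt
      have : τ.reg 1 < n := by
        rcases Nat.eq_zero_or_pos (τ.reg 1) with h | h
        · omega
        · nlinarith
      simp [Cmd.Safe, Cmd.step, Expr.eval, State.setReg, h0]
      exact ⟨by omega, ⟨by omega, hlt.le⟩, by omega⟩) n
  refine Runs.mono (Runs.seq (Runs.loopFree rfl (Q := fun ρ => ρ = σ.setReg 1 0)
      (by simp [Cmd.Safe, Expr.eval]) rfl) fun ρ hρ => hloop ρ ?_ (by omega)) ?_ ?_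
  · subst hρ
    simp [State.setReg, h0]
  · simp only [Cmd.maxCost, Expr.cost]
    omega
  · rintro τ ⟨⟨h0, h1, h2⟩, ht⟩
    have : τ.reg 0 ≤ τ.reg 1 * τ.reg 1 := Expr.lt_eq_zero.1 ht
    exact ⟨by omega, h1, h2⟩

end Root

/-! ### Dual certificates under proposals -/

section Tight

variable {n : ℕ} {e : ℕ → ℕ → Prop} {u w mA mB : ℕ → ℕ}

theorem IsTight.symm (h : IsTight n e u w mA mB) (hm : IsMatch n e mA mB) :
    IsTight n (fun k i => e i k) w u mB mA where
  cover k hk i hi he := by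
    have := h.cover i hi k hk he
    omega
  tight k hk hlt := by
    have := h.tight _ hlt (by rw [hm.BA k hk hlt]; exact hk)
    rw [hm.BA k hk hlt] at this
    omega
  freeA := h.freeB
  freeB := h.freeA

/-- Taking away a partner keeps a tight matching tight; the partner that is taken away has dual
value `1`. -/
theorem IsTight.take (h : IsTight n e u w mA mB) (hm : IsMatch n e mA mB) {i k : ℕ} (hi : i < n)
    (hk : k < n) (hfree : mA i = n) (he : e i k) :
    IsTight n e u w (takeA n mA mB i k) (Function.update mB k i) ∧ w k = 1 := by
  have hu := h.freeA i hi hfree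
  have hc := h.cover i hi k hk he
  have hmk : mB k < n := by
    by_contra hcon
    have := h.freeB k hk (le_antisymm (hm.leB k hk) (by omega))
    omega
  have ht := h.tight _ hmk (by rw [hm.BA k hk hmk]; exact hk)
  rw [hm.BA k hk hmk] at ht
  refine ⟨⟨h.cover, fun b hb hlt => ?_, fun b hb hbf => ?_, fun b hb hbf => ?_⟩, by omega⟩
  · by_cases hbi : b = i
    · rw [hbi, takeA_self hm hi hk hfree]
      omega
    · by_cases hbh : b = mB k
      · simp [takeA, hbh] at hlt
      · rw [takeA_of_ne hbi hbh] at hlt ⊢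
        exact h.tight b hb hlt
  · by_cases hbi : b = i
    · rw [hbi, takeA_self hm hi hk hfree] at hbf
      omega
    · by_cases hbh : b = mB k
      · rw [hbh]
        omega
      · rw [takeA_of_ne hbi hbh] at hbf
        exact h.freeA b hb hbf
  · rw [Function.update_apply] at hbf
    split_ifs at hbf
    · omega
    · exact h.freeB b hb hbf

end Tight

/-! ### Completing a matching -/

section Complete

/-- Match the remaining agents with each other, in the order of their numbers. -/
def complete : Cmd :=
  .seq (.set 2 (.const 0)) (.seq (.set 4 (.const 0)) (.while (.lt (.reg 2) (.reg 0))
    (.ite (.lt (.read 1 (.reg 2)) (.reg 0)) (.set 2 (.add (.reg 2) (.const 1)))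
      (.ite (.lt (.read 2 (.reg 4)) (.reg 0)) (.set 4 (.add (.reg 4) (.const 1)))
        (.seq (.write 1 (.reg 2) (.reg 4)) (.write 2 (.reg 4) (.reg 2)))))))

variable {W n : ℕ} {e : ℕ → ℕ → Prop}

/-- If one side is matched completely, then so is the other one. -/
theorem IsMatch.all_matched {mA mB : ℕ → ℕ} (h : IsMatch n e mA mB) (hall : ∀ k < n, mB k < n) :
    ∀ i < n, mA i < n := by
  have h1 : (Finset.range n).image mB = Finset.range n := by
    refine Finset.eq_of_subset_of_card_le (fun i hi => ?_) ?_
    · obtain ⟨k, hk, rfl⟩ := Finset.mem_image.1 hi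
      exact Finset.mem_range.2 (hall k (Finset.mem_range.1 hk))
    · rw [Finset.card_image_of_injOn]
      intro k hk l hl hkl
      have hk' : k < n := by simpa using hk
      have hl' : l < n := by simpa using hl
      exact h.symm.injOn ⟨hk', hall k hk'⟩ ⟨hl', hall l hl'⟩ hkl
  intro i hi
  obtain ⟨k, hk, rfl⟩ := Finset.mem_image.1 (h1 ▸ Finset.mem_range.2 hi)
  rw [Finset.mem_range] at hk
  rwa [h.BA k hk (hall k hk)]

theorem IsMatch.weaken {mA mB : ℕ → ℕ} (h : IsMatch n e mA mB) :
    IsMatch n (fun _ _ => True) mA mB :=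
  { h with edge := fun _ _ _ => trivial }

theorem complete_runs (hnW : n ≤ W) (σ : State) (h0 : σ.reg 0 = n)
    (hm : IsMatch n e (σ.arr 1) (σ.arr 2)) :
    Runs W complete σ (100 * (n + 1)) fun τ => (IsMatch n (fun _ _ => True) (τ.arr 1) (τ.arr 2) ∧
      (∀ i < n, τ.arr 1 i < n) ∧ ∀ i < n, σ.arr 1 i < n → τ.arr 1 i = σ.arr 1 i) ∧
      (∀ r ∉ [2, 4], τ.reg r = σ.reg r) ∧ ∀ a ∉ [1, 2], τ.arr a = σ.arr a := by
  have hloop := Runs.whileStep (W := W) (e := .lt (.reg 2) (.reg 0))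
    (P := .ite (.lt (.read 1 (.reg 2)) (.reg 0)) (.set 2 (.add (.reg 2) (.const 1)))
      (.ite (.lt (.read 2 (.reg 4)) (.reg 0)) (.set 4 (.add (.reg 4) (.const 1)))
        (.seq (.write 1 (.reg 2) (.reg 4)) (.write 2 (.reg 4) (.reg 2))))) rfl
    (fun τ => τ.reg 0 = n ∧ τ.reg 2 ≤ n ∧ τ.reg 4 ≤ n ∧
      IsMatch n (fun _ _ => True) (τ.arr 1) (τ.arr 2) ∧ (∀ i < τ.reg 2, τ.arr 1 i < n) ∧
      (∀ k < τ.reg 4, τ.arr 2 k < n) ∧ ∀ i < n, σ.arr 1 i < n → τ.arr 1 i = σ.arr 1 i)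
    (fun τ => 2 * (n - τ.reg 2) + (n - τ.reg 4) + if τ.arr 1 (τ.reg 2) < n then 0 else 1)
    (fun τ ⟨h0, h2, h4, hm, hi, hk, hext⟩ ht => by
      have hlt : τ.reg 2 < n := h0 ▸ Expr.lt_ne_zero.1 ht
      by_cases h1 : τ.arr 1 (τ.reg 2) < n
      · simp [Cmd.Safe, Cmd.step, Expr.eval, State.setReg, h0, h1]
        refine ⟨by omega, ⟨by omega, h4, hm, fun i hi' => ?_, hk, hext⟩, ?_⟩
        · rcases Nat.lt_or_eq_of_le hi' with hi' | rfl
          · exact hi i hi'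
          · exact h1
        · split_ifs <;> omega
      · by_cases h2 : τ.arr 2 (τ.reg 4) < n
        · have hk4 : τ.reg 4 < n := by
            by_contra hcon
            exact h1 (hm.all_matched (fun k hk' => hk k (by omega)) _ hlt)
          simp [Cmd.Safe, Cmd.step, Expr.eval, State.setReg, h0, h1, h2]
          refine ⟨by omega, ⟨by omega, by omega, hm, hi, fun k hk' => ?_, hext⟩, by omega⟩
          rcases Nat.lt_or_eq_of_le hk' with hk' | rfl
          · exact hk k hk'
          · exact h2
        · have hk4 : τ.reg 4 < n := by
            by_contra hcon
            exact h1 (hm.all_matched (fun k hk' => hk k (by omega)) _ hlt)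
          have hfree := hm.leA _ hlt
          have hfree' := hm.leB _ hk4
          have hm' := hm.take hlt hk4 (by omega) trivial
          have htake : ∀ b < n, takeA n (τ.arr 1) (τ.arr 2) (τ.reg 2) (τ.reg 4) b =
              Function.update (τ.arr 1) (τ.reg 2) (τ.reg 4) b := fun b hb =>
            Function.update_of_ne (by omega) _ _
          have hm'' : IsMatch n (fun _ _ => True)
              (Function.update (τ.arr 1) (τ.reg 2) (τ.reg 4))
              (Function.update (τ.arr 2) (τ.reg 4) (τ.reg 2)) :=
            ⟨fun i hi => htake i hi ▸ hm'.leA i hi, hm'.leB,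
              fun i hi => htake i hi ▸ hm'.AB i hi,
              fun k hk hlt => htake _ hlt ▸ hm'.BA k hk hlt, fun _ _ _ => trivial⟩
          simp [Cmd.Safe, Cmd.step, Expr.eval, State.setArr, h0, h1, h2]
          refine ⟨by omega, ⟨by omega, h4, hm'', fun i hi' => ?_, fun k hk' => ?_,
            fun i hi' hlt' => ?_⟩, ?_⟩
          · rw [Function.update_of_ne (by omega)]
            exact hi i hi'
          · rw [Function.update_of_ne (by omega)]
            exact hk k hk'
          · rw [Function.update_of_ne]
            · exact hext i hi' hlt'
            · rintro rfl
              rw [hext _ hi' hlt'] at h1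
              omega
          · simp [hk4]) (3 * n + 1)
  have hmain : Runs W complete σ (100 * (n + 1)) fun τ =>
      IsMatch n (fun _ _ => True) (τ.arr 1) (τ.arr 2) ∧
      (∀ i < n, τ.arr 1 i < n) ∧ ∀ i < n, σ.arr 1 i < n → τ.arr 1 i = σ.arr 1 i := by
    refine Runs.mono (Runs.seq (Runs.loopFree rfl (Q := fun ρ => ρ = σ.setReg 2 0)
        (by simp [Cmd.Safe, Expr.eval]) rfl)
      fun τ hτ => Runs.seq (Runs.loopFree rfl (Q := fun ρ => ρ = (σ.setReg 2 0).setReg 4 0)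
        (by simp [Cmd.Safe, Expr.eval]) (by subst hτ; rfl))
      fun ρ hρ => hloop ρ ?_ ?_) ?_ ?_
    · subst hρ
      simp [State.setReg, h0]
      exact hm.weaken
    · subst hρ
      have hite : ∀ (p : Prop) [Decidable p], (if p then 0 else 1) ≤ 1 := fun p _ => by
        split_ifs <;> simp
      exact (Nat.add_le_add_left (hite _) _).trans (by omega)
    · simp only [Cmd.maxCost, Expr.cost]
      omega
    · rintro τ ⟨⟨h0, h2, h4, hm, hi, hk, hext⟩, ht⟩
      have : τ.reg 0 ≤ τ.reg 2 := Expr.lt_eq_zero.1 ht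
      exact ⟨hm, fun i hi' => hi i (by omega), hext⟩
  refine hmain.frame.mono le_rfl fun τ ⟨h1, h2, h3⟩ =>
    ⟨h1, fun r hr => h2 r ?_, fun a ha => h3 a ?_⟩
  · simp [complete, Cmd.regs] at hr ⊢
    omega
  · simp [complete, Cmd.arrs] at ha ⊢
    omega

end Complete

/-! ### Updating the counters -/

section UpdatePotentials

/-- Count the times at which the partner had dual value `0`, in arrays `7` and `8`. The dual value
of an agent `k` of the second side is `1` if the last search has reached her (array `5`). That of
her partner is `1` if the pair has value `1` and `k` has not been reached. -/
def updatePotentials : Cmd :=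
  .seq (.set 2 (.const 0)) (.while (.lt (.reg 2) (.reg 0))
    (.seq (.set 4 (.read 1 (.reg 2)))
      (.seq (.ite (.lt (.read 5 (.reg 4)) (.reg 0)) .skip
          (.write 7 (.reg 2) (.add (.read 7 (.reg 2)) (.const 1))))
        (.seq (.ite (entry true (.reg 2) (.reg 4))
            (.ite (.lt (.read 5 (.reg 4)) (.reg 0))
              (.write 8 (.reg 4) (.add (.read 8 (.reg 4)) (.const 1))) .skip)
            (.write 8 (.reg 4) (.add (.read 8 (.reg 4)) (.const 1))))
          (.set 2 (.add (.reg 2) (.const 1)))))))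

variable {W n : ℕ} {e : ℕ → ℕ → Prop}

theorem updatePotentials_runs {t : ℕ} (hnW : n + t + 2 ≤ W) (σ : State)
    (htab : HasTable true n e σ) (hm : IsMatch n (fun _ _ => True) (σ.arr 1) (σ.arr 2))
    (hall : ∀ i < n, σ.arr 1 i < n) (h7 : ∀ i < n, σ.arr 7 i ≤ t) (h8 : ∀ k < n, σ.arr 8 k ≤ t) :
    Runs W updatePotentials σ (100 * (n + 1)) fun τ =>
      (∀ i < n, τ.arr 7 i = σ.arr 7 i + if σ.arr 5 (σ.arr 1 i) < n then 0 else 1) ∧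
      (∀ i < n, (e i (σ.arr 1 i) ∧ n ≤ σ.arr 5 (σ.arr 1 i) →
          τ.arr 8 (σ.arr 1 i) = σ.arr 8 (σ.arr 1 i)) ∧
        (¬ (e i (σ.arr 1 i) ∧ n ≤ σ.arr 5 (σ.arr 1 i)) →
          τ.arr 8 (σ.arr 1 i) = σ.arr 8 (σ.arr 1 i) + 1)) := by
  set x := σ.arr 1 with hx
  set f := σ.arr 7
  set g := σ.arr 8
  set par := σ.arr 5
  have hinj : ∀ i < n, ∀ j < n, x i = x j → i = j := fun i hi j hj hij => by
    rw [← hm.AB i hi (hall i hi), ← hm.AB j hj (hall j hj), hij]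
  have hloop := Runs.whileStep (W := W) (e := .lt (.reg 2) (.reg 0))
    (P := .seq (.set 4 (.read 1 (.reg 2)))
      (.seq (.ite (.lt (.read 5 (.reg 4)) (.reg 0)) .skip
          (.write 7 (.reg 2) (.add (.read 7 (.reg 2)) (.const 1))))
        (.seq (.ite (entry true (.reg 2) (.reg 4))
            (.ite (.lt (.read 5 (.reg 4)) (.reg 0))
              (.write 8 (.reg 4) (.add (.read 8 (.reg 4)) (.const 1))) .skip)
            (.write 8 (.reg 4) (.add (.read 8 (.reg 4)) (.const 1))))
          (.set 2 (.add (.reg 2) (.const 1)))))) rfl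
    (fun τ => HasTable true n e τ ∧ τ.reg 2 ≤ n ∧ τ.arr 1 = x ∧ τ.arr 5 = par ∧
      (∀ i < n, τ.arr 7 i = f i + if i < τ.reg 2 ∧ n ≤ par (x i) then 1 else 0) ∧
      (∀ i < n, (e i (x i) ∧ n ≤ par (x i) ∨ τ.reg 2 ≤ i → τ.arr 8 (x i) = g (x i)) ∧
        (¬ (e i (x i) ∧ n ≤ par (x i)) → i < τ.reg 2 → τ.arr 8 (x i) = g (x i) + 1)))
    (fun τ => n - τ.reg 2)
    (fun τ ⟨⟨h0, htab⟩, h2, hA, hpar, hf, hg⟩ ht => by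
      have hlt : τ.reg 2 < n := h0 ▸ Expr.lt_ne_zero.1 ht
      have hxlt := hall _ hlt
      have hf2 := hf _ hlt
      rw [if_neg (by omega)] at hf2
      have hg2 := (hg _ hlt).1 (.inr le_rfl)
      have hf7 := h7 _ hlt
      have hg8 := h8 _ hxlt
      have htab2 := htab _ hlt _ hxlt
      simp only [if_true] at htab2
      have hfgen : ∀ i < n, i ≠ τ.reg 2 →
          τ.arr 7 i = f i + if i < τ.reg 2 + 1 ∧ n ≤ par (x i) then 1 else 0 := fun i hi hne => by
        rw [hf i hi]
        congr 2
        simp only [eq_iff_iff, and_congr_left_iff]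
        omega
      have hgen : ∀ i < n, i ≠ τ.reg 2 →
          (e i (x i) ∧ n ≤ par (x i) ∨ τ.reg 2 + 1 ≤ i → τ.arr 8 (x i) = g (x i)) ∧
          (¬ (e i (x i) ∧ n ≤ par (x i)) → i < τ.reg 2 + 1 → τ.arr 8 (x i) = g (x i) + 1) :=
        fun i hi hne => ⟨fun h => (hg i hi).1 (h.imp_right (by omega)),
          fun h h' => (hg i hi).2 h (by omega)⟩
      have hstepg : ¬ (e (τ.reg 2) (x (τ.reg 2)) ∧ n ≤ par (x (τ.reg 2))) → ∀ i < n,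
          (e i (x i) ∧ n ≤ par (x i) ∨ τ.reg 2 + 1 ≤ i →
            Function.update (τ.arr 8) (x (τ.reg 2)) (τ.arr 8 (x (τ.reg 2)) + 1) (x i) = g (x i)) ∧
          (¬ (e i (x i) ∧ n ≤ par (x i)) → i < τ.reg 2 + 1 →
            Function.update (τ.arr 8) (x (τ.reg 2)) (τ.arr 8 (x (τ.reg 2)) + 1) (x i) =
              g (x i) + 1) := fun hno i hi => by
        by_cases hne : i = τ.reg 2
        · subst hne
          rw [Function.update_self, hg2]
          exact ⟨fun h => absurd h (by simp [hno]), fun _ _ => rfl⟩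
        · rw [Function.update_of_ne fun h => hne (hinj i hi _ hlt h)]
          exact hgen i hi hne
      have hstepg' : e (τ.reg 2) (x (τ.reg 2)) ∧ n ≤ par (x (τ.reg 2)) → ∀ i < n,
          (e i (x i) ∧ n ≤ par (x i) ∨ τ.reg 2 + 1 ≤ i → τ.arr 8 (x i) = g (x i)) ∧
          (¬ (e i (x i) ∧ n ≤ par (x i)) → i < τ.reg 2 + 1 → τ.arr 8 (x i) = g (x i) + 1) :=
        fun hyes i hi => by
        by_cases hne : i = τ.reg 2
        · subst hne
          exact ⟨fun _ => hg2, fun h => absurd hyes h⟩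
        · exact hgen i hi hne
      have hstepf : par (x (τ.reg 2)) < n → ∀ i < n,
          τ.arr 7 i = f i + if i < τ.reg 2 + 1 ∧ n ≤ par (x i) then 1 else 0 := fun hp i hi => by
        by_cases hne : i = τ.reg 2
        · subst hne
          rw [hf2, if_neg (by omega)]
        · exact hfgen i hi hne
      have hstepf' : ¬ par (x (τ.reg 2)) < n → ∀ i < n,
          Function.update (τ.arr 7) (τ.reg 2) (τ.arr 7 (τ.reg 2) + 1) i =
            f i + if i < τ.reg 2 + 1 ∧ n ≤ par (x i) then 1 else 0 := fun hp i hi => by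
        by_cases hne : i = τ.reg 2
        · subst hne
          rw [Function.update_self, hf2, if_pos (by omega)]
        · rw [Function.update_of_ne hne]
          exact hfgen i hi hne
      by_cases hp : par (x (τ.reg 2)) < n <;> by_cases he : e (τ.reg 2) (x (τ.reg 2))
      · have he' := htab2.2 he
        have h3 := hstepg (by omega)
        have h4 := hstepf hp
        simp [Cmd.Safe, Cmd.step, Expr.eval, entry_eval, State.setReg, State.setArr, HasTable, h0,
          hA, hpar, hp, he']
        exact ⟨by omega, ⟨by simpa using htab, by omega, by simpa using h4, by simpa using h3⟩,
          by omega⟩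
      · have he' := not_not.1 (mt htab2.1 he)
        have h3 := hstepg (by tauto)
        have h4 := hstepf hp
        simp [Cmd.Safe, Cmd.step, Expr.eval, entry_eval, State.setReg, State.setArr, HasTable, h0,
          hA, hpar, hp, he']
        exact ⟨by omega, ⟨by simpa using htab, by omega, by simpa using h4, by simpa using h3⟩,
          by omega⟩
      · have he' := htab2.2 he
        have h3 := hstepg' ⟨he, by omega⟩
        have h4 := hstepf' hp
        simp [Cmd.Safe, Cmd.step, Expr.eval, entry_eval, State.setReg, State.setArr, HasTable, h0,
          hA, hpar, hp, he']
        exact ⟨by omega, ⟨by simpa using htab, by omega, by simpa using h4, by simpa using h3⟩,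
          by omega⟩
      · have he' := not_not.1 (mt htab2.1 he)
        have h3 := hstepg (by tauto)
        have h4 := hstepf' hp
        simp [Cmd.Safe, Cmd.step, Expr.eval, entry_eval, State.setReg, State.setArr, HasTable, h0,
          hA, hpar, hp, he']
        exact ⟨by omega, ⟨by simpa using htab, by omega, by simpa using h4, by simpa using h3⟩,
          by omega⟩) n
  refine Runs.mono (Runs.seq (Runs.loopFree rfl (Q := fun ρ => ρ = σ.setReg 2 0)
      (by simp [Cmd.Safe, Expr.eval]) rfl) fun ρ hρ => hloop ρ ?_ (by omega)) ?_ ?_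
  · subst hρ
    refine ⟨htab.congr (by simp [State.setReg]) rfl, ?_, hx.symm, rfl, ?_, ?_⟩
    · simp [State.setReg]
    · simp [State.setReg, f]
    · simp [State.setReg, g]
  · simp only [Cmd.maxCost, Expr.cost, entry, if_true]
    omega
  · rintro τ ⟨⟨htab, h2, hA, hpar, hf, hg⟩, ht⟩
    have h3 : n ≤ τ.reg 2 := htab.1 ▸ Expr.lt_eq_zero.1 ht
    refine ⟨fun i hi => ?_, fun i hi => ⟨fun h => (hg i hi).1 (.inl h),
      fun h => (hg i hi).2 h (by omega)⟩⟩
    rw [hf i hi]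
    split_ifs <;> omega

end UpdatePotentials

/-! ### The program for one time step -/

section StepProgram

/-- The program for one time step. Register `0` holds `n`, and the arrays `7` and `8` persist; the
arrays `1` and `2` hold the partners of the agents of the two sides. A maximum matching is found by
an auction with about `√n` levels followed by augmentation. Then the proposals are used again, on
each of the sides, to make the matching stable with respect to the potentials. -/
def stepProgram : Cmd :=
  .seq sqrtCeil (.seq (fill 1 (.reg 0)) (.seq (fill 2 (.reg 0)) (.seq (fill 3 (.const 0))
    (.seq (propose true 1 2 3) (.seq augment (.seq (.set 1 (.const 0))
      (.seq (propose true 1 2 7) (.seq (propose false 2 1 8)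
        (.seq complete updatePotentials)))))))))

/-- The specification of the program for one time step: from the counters `f` and `g` of the two
sides it computes a matching `x`, which has a dual certificate `u`, `w` and is stable with respect
to `f` and `g`, and increases the counters where the partner has dual value `0`. -/
structure StepSpec (n : ℕ) (e : ℕ → ℕ → Prop) (f g : ℕ → ℕ) (x f' g' u w : ℕ → ℕ) : Prop where
  lt : ∀ i < n, x i < n
  inj : ∀ i < n, ∀ j < n, x i = x j → i = j
  cover : ∀ i < n, ∀ k < n, e i k → 1 ≤ u i + w k
  tight : ∀ i < n, e i (x i) → u i + w (x i) = 1
  tight' : ∀ i < n, ¬ e i (x i) → u i + w (x i) = 0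
  counter : ∀ i < n, f' i + w (x i) = f i + 1
  counter' : ∀ i < n, g' (x i) + u i = g (x i) + 1
  stable : ∀ i < n, ∀ j < n, ¬ e i (x i) → e i (x j) → f i ≤ f j
  stable' : ∀ i < n, ∀ j < n, ¬ e i (x i) → e j (x i) → g (x i) ≤ g (x j)

/-- A tight matching stays tight when agents take partners away from each other, and the proposals
make it stable: an agent without a good match has been refused by all her candidates, in favour of
agents with at least her counter. The proposals of the second side (`h2`) do not spoil the result of
those of the first side (`h1`), since they only change the partners of agents of dual value `1`
(`hkeep`), while the candidates of an unmatched agent have partners of dual value `0`. -/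
theorem stepSpec_of_phases {n : ℕ} {e : ℕ → ℕ → Prop} {f g par u : ℕ → ℕ}
    {A₁ B₁ A₂ B₂ x y lev₁ col₁ lev₂ col₂ f' g' : ℕ → ℕ}
    {J₁ J₂ : (ℕ → ℕ) → (ℕ → ℕ) → Prop}
    (h1 : ProposeInv n 0 e f J₁ A₁ B₁ lev₁ col₁ n n)
    (h2 : ProposeInv n 0 (fun k i => e i k) g J₂ B₂ A₂ lev₂ col₂ n n)
    (ht : IsTight n e u (fun k => if par k < n then 1 else 0) A₂ B₂)
    (hkeep : ∀ i < n, u i = 0 → A₂ i = A₁ i)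
    (hm : IsMatch n (fun _ _ => True) x y) (hx : ∀ i < n, x i < n)
    (hext : ∀ i < n, A₂ i < n → x i = A₂ i)
    (hf : ∀ i < n, f' i = f i + if par (x i) < n then 0 else 1)
    (hg : ∀ i < n, (e i (x i) ∧ n ≤ par (x i) → g' (x i) = g (x i)) ∧
      (¬ (e i (x i) ∧ n ≤ par (x i)) → g' (x i) = g (x i) + 1)) :
    StepSpec n e f g x f' g' u (fun k => if par k < n then 1 else 0) := by
  have hlev : ∀ (f lev : ℕ → ℕ), (∀ i < n, f i ≤ lev i) → (∀ i < n, lev i ≤ f i ∨ lev i ≤ 0) →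
      ∀ i < n, lev i = f i := fun f lev h h' i hi => by
    have := h i hi
    have := h' i hi
    omega
  have hlev₁ := hlev _ _ h1.lev_ge h1.lev_le
  have hlev₂ := hlev _ _ h2.lev_ge h2.lev_le
  have hm₂ := h2.isMatch.symm
  have hm₁ := h1.isMatch
  have hinj : ∀ i < n, ∀ j < n, x i = x j → i = j := fun i hi j hj hij => by
    rw [← hm.AB i hi (hx i hi), ← hm.AB j hj (hx j hj), hij]
  have hfreeA : ∀ i < n, ¬ e i (x i) → A₂ i = n := fun i hi he => by
    by_contra hcon
    have hlt : A₂ i < n := by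
      have := hm₂.leA i hi
      omega
    rw [hext i hi hlt] at he
    exact he (hm₂.edge i hi hlt)
  have hfreeB : ∀ i < n, A₂ i = n → B₂ (x i) = n := fun i hi hfree => by
    by_contra hcon
    have hlt : B₂ (x i) < n := by
      have := hm₂.leB _ (hx i hi)
      omega
    have h3 := hm₂.BA _ (hx i hi) hlt
    have h4 := hext _ hlt (by rw [h3]; exact hx i hi)
    have h5 := hinj _ hlt i hi (by rw [h4, h3])
    rw [h5, hfree] at h3
    have := hx i hi
    omega
  have htight : ∀ i < n, e i (x i) → u i + (if par (x i) < n then 1 else 0) = 1 :=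
    fun i hi he => by
      by_cases hlt : A₂ i < n
      · have := ht.tight i hi hlt
        rwa [hext i hi hlt]
      · have hfree : A₂ i = n := le_antisymm (hm₂.leA i hi) (by omega)
        have h3 := ht.cover i hi _ (hx i hi) he
        have h4 := ht.freeA i hi hfree
        have h5 := ht.freeB _ (hx i hi) (hfreeB i hi hfree)
        omega
  have htight' : ∀ i < n, ¬ e i (x i) → u i + (if par (x i) < n then 1 else 0) = 0 :=
    fun i hi he => by
      have hfree := hfreeA i hi he
      have h4 := ht.freeA i hi hfree
      have h5 := ht.freeB _ (hx i hi) (hfreeB i hi hfree)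
      omega
  refine ⟨hx, hinj, ht.cover, htight, htight', fun i hi => ?_, fun i hi => ?_,
    fun i hi j hj he he' => ?_, fun i hi j hj he he' => ?_⟩
  · rw [hf i hi]
    split_ifs <;> omega
  · by_cases he : e i (x i)
    · have h3 := htight i hi he
      by_cases hp : par (x i) < n
      · have := (hg i hi).2 (by omega)
        rw [if_pos hp] at h3
        omega
      · have := (hg i hi).1 ⟨he, by omega⟩
        rw [if_neg hp] at h3
        omega
    · have h3 := htight' i hi he
      have := (hg i hi).2 (by tauto)
      omega
  · -- The partner of `x j` has not changed since the first round of proposals.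
    have hfree := hfreeA i hi he
    have hu := ht.freeA i hi hfree
    have hfree₁ : A₁ i = n := (hkeep i hi hu).symm.trans hfree
    have hcol := (h1.retired i hi hi (by omega) hfree₁).2
    obtain ⟨h3, h4⟩ := h1.scanned i hi _ (hx j hj) he' (by rw [hcol]; exact hx j hj)
    rw [hlev₁ i hi, hlev₁ _ h3] at h4
    have h5 := ht.cover i hi _ (hx j hj) he'
    have h6 : B₂ (x j) < n := by
      by_contra hcon
      have := ht.freeB _ (hx j hj) (le_antisymm (hm₂.leB _ (hx j hj)) (by omega))
      omega
    have h7 := hm₂.BA _ (hx j hj) h6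
    have h8 := hinj _ h6 j hj (by rw [hext _ h6 (by rw [h7]; exact hx j hj), h7])
    rw [h8] at h7
    have h9 := ht.tight j hj (by rw [h7]; exact hx j hj)
    rw [h7] at h9
    have h10 := hkeep j hj (by omega)
    have h11 := hm₁.AB j hj (by rw [← h10, h7]; exact hx j hj)
    rw [← h10, h7] at h11
    rwa [h11] at h4
  · have hfree := hfreeB i hi (hfreeA i hi he)
    have hcol := (h2.retired _ (hx i hi) (hx i hi) (by have := hx i hi; omega) hfree).2
    obtain ⟨h3, h4⟩ := h2.scanned _ (hx i hi) j hj he' (by omega)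
    rw [hlev₂ _ (hx i hi), hlev₂ _ h3] at h4
    rwa [hext j hj h3]

variable {W n : ℕ} {e : ℕ → ℕ → Prop}

/-- The table for the proposals of the second side. -/
theorem HasTable.transpose {σ : State} (h : HasTable true n e σ) :
    HasTable false n (fun k i => e i k) σ :=
  ⟨h.1, fun k hk i hi => by simpa using h.2 i hi k hk⟩

theorem stepProgram_runs {t : ℕ} (hn : 1 ≤ n) (hW : n + t + 2 ≤ W) (σ : State)
    (htab : HasTable true n e σ) (h7 : ∀ i < n, σ.arr 7 i ≤ t) (h8 : ∀ k < n, σ.arr 8 k ≤ t) :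
    Runs W stepProgram σ (3000 * ((n + 1) ^ 2 * (n.sqrt + 2))) fun τ => τ.reg 0 = n ∧
      ∃ u w, StepSpec n e (σ.arr 7) (σ.arr 8) (τ.arr 1) (τ.arr 7) (τ.arr 8) u w := by
  have hnW : n ≤ W := by omega
  have hmain : Runs W stepProgram σ
      (20 * (n + 1) + (21 * (n + 1) + (21 * (n + 1) + (21 * (n + 1) +
      (400 * ((n + 1) ^ 2 * (n.sqrt + 2)) + (400 * ((n + 1) ^ 2 * (n.sqrt + 4)) + (2 +
      (400 * ((n + 1) ^ 2 * (0 + 1)) + (400 * ((n + 1) ^ 2 * (0 + 1)) +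
      (100 * (n + 1) + 100 * (n + 1))))))))))) fun τ =>
      ∃ u w, StepSpec n e (σ.arr 7) (σ.arr 8) (τ.arr 1) (τ.arr 7) (τ.arr 8) u w := by
    refine Runs.seq (sqrtCeil_runs hnW σ htab.1).frame fun σ₁ ⟨⟨hL1, hL2, hL3⟩, hr₁, ha₁⟩ => ?_
    have htab₁ := htab.congr (hr₁ 0 (by simp [sqrtCeil, Cmd.regs]))
      (ha₁ 0 (by simp [sqrtCeil, Cmd.arrs]))
    have ha₁ : ∀ a, σ₁.arr a = σ.arr a := fun a => ha₁ a (by simp [sqrtCeil, Cmd.arrs])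
    have hL4 : σ₁.reg 1 ≤ n.sqrt + 1 := by
      have := Nat.le_sqrt.2 hL3
      omega
    refine Runs.seq (fill_runs (e := .reg 0) htab₁.1 hnW hnW (fun _ h => h)).frame
      fun σ₂ ⟨hf₂, hr₂, ha₂⟩ => ?_
    have htab₂ := htab₁.congr (hr₂ 0 (by simp [fill, Cmd.regs])) (ha₂ 0 (by simp [fill, Cmd.arrs]))
    refine Runs.seq (fill_runs (e := .reg 0) htab₂.1 hnW hnW (fun _ h => h)).frame
      fun σ₃ ⟨hf₃, hr₃, ha₃⟩ => ?_
    have htab₃ := htab₂.congr (hr₃ 0 (by simp [fill, Cmd.regs])) (ha₃ 0 (by simp [fill, Cmd.arrs]))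
    refine Runs.seq (fill_runs (e := .const 0) (b := 0) htab₃.1 hnW (Nat.zero_le _)
      (fun _ _ => rfl)).frame fun σ₄ ⟨hf₄, hr₄, ha₄⟩ => ?_
    have htab₄ := htab₃.congr (hr₄ 0 (by simp [fill, Cmd.regs])) (ha₄ 0 (by simp [fill, Cmd.arrs]))
    have hA₄ : ∀ a, a ≠ 1 → a ≠ 2 → a ≠ 3 → σ₄.arr a = σ.arr a := fun a h1 h2 h3 => by
      rw [ha₄ a (by simp [fill, Cmd.arrs, h3]), ha₃ a (by simp [fill, Cmd.arrs, h2]),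
        ha₂ a (by simp [fill, Cmd.arrs, h1]), ha₁ a]
    have hR₄ : σ₄.reg 1 = σ₁.reg 1 := by
      rw [hr₄ 1 (by simp [fill, Cmd.regs]), hr₃ 1 (by simp [fill, Cmd.regs]),
        hr₂ 1 (by simp [fill, Cmd.regs])]
    have h41 : ∀ i < n, σ₄.arr 1 i = n := fun i hi => by
      rw [ha₄ 1 (by simp [fill, Cmd.arrs]), ha₃ 1 (by simp [fill, Cmd.arrs]), hf₂ i hi]
    have h42 : ∀ i < n, σ₄.arr 2 i = n := fun i hi => by
      rw [ha₄ 2 (by simp [fill, Cmd.arrs]), hf₃ i hi]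
    have hm₄ : IsMatch n e (σ₄.arr 1) (σ₄.arr 2) :=
      ⟨fun i hi => (h41 i hi).le, fun i hi => (h42 i hi).le,
        fun i hi h => by have := h41 i hi; omega, fun i hi h => by have := h42 i hi; omega,
        fun i hi h => by have := h41 i hi; omega⟩
    refine Runs.seq ((propose_runs (J := fun _ _ => True) (b := true) (A := 1) (B := 2) (V := 3)
      (by simp) (by simp) (by simp) (by simp) (by simp) (by simp) hnW (hL2.trans hnW)
      (fun _ _ _ _ _ _ _ _ _ _ => trivial) σ₄ htab₄ hR₄ hm₄ trivial).mono
      (Nat.mul_le_mul_left _ (Nat.mul_le_mul_left _ (by omega))) fun _ h => h)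
      fun σ₅ ⟨hp₅, hr₅, ha₅⟩ => ?_
    have htab₅ := htab₄.congr (hr₅ 0 (by simp)) (ha₅ 0 (by simp))
    obtain ⟨u₀, w₀, hcov, hsize⟩ := hp₅.exists_cover hf₄
    -- The deficit is at most `n / (L + 1)`, where `L` is the square root of `n`, rounded up.
    have hδ : ∑ i ∈ Finset.range n, u₀ i + ∑ k ∈ Finset.range n, w₀ k ≤
        msize n (σ₅.arr 2) + (n.sqrt + 1) := by
      rw [← hp₅.isMatch.msize_eq]
      by_contra! hcon
      have h1 : msize n (σ₅.arr 1) + (σ₁.reg 1 + 1) ≤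
        ∑ i ∈ Finset.range n, u₀ i + ∑ k ∈ Finset.range n, w₀ k := by omega
      have h2 := Nat.mul_le_mul_left (σ₁.reg 1 + 1) h1
      nlinarith
    refine Runs.seq (augment_runs hn hnW (fun mA mB hm => by
      rw [← hm.msize_eq]
      exact hm.msize_le_cover hcov) σ₅ htab₅ hp₅.isMatch hδ)
      fun σ₆ ⟨⟨hm₆, u, ht₆⟩, hr₆, ha₆⟩ => ?_
    have htab₆ := htab₅.congr (hr₆ 0 (by simp)) (ha₆ 0 (by simp))
    refine Runs.seq (Runs.loopFree rfl (Q := fun ρ => ρ = σ₆.setReg 1 0)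
      (by simp [Cmd.Safe, Expr.eval]) rfl) fun σ₇ hσ₇ => ?_
    have htab₇ : HasTable true n e σ₇ := htab₆.congr (by simp [hσ₇, State.setReg])
      (by rw [hσ₇]; rfl)
    have ha₇ : σ₇.arr = σ₆.arr := by rw [hσ₇]; rfl
    have hr₇ : σ₇.reg 1 = 0 := by simp [hσ₇, State.setReg]
    generalize hw : (fun k => if σ₆.arr 5 k < n then 1 else 0) = w at ht₆
    refine Runs.seq (propose_runs (L := 0) (J := IsTight n e u w) (b := true) (A := 1) (B := 2)
      (V := 7) (by simp) (by simp) (by simp) (by simp) (by simp) (by simp) hnW (Nat.zero_le _)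
      (fun mA mB i k hm hJ hi hk hfree he => (hJ.take hm hi hk hfree he).1) σ₇ htab₇ hr₇
      (by rw [ha₇]; exact hm₆) (by rw [ha₇]; exact ht₆)) fun σ₈ ⟨hp₈, hr₈, ha₈⟩ => ?_
    have htab₈ := htab₇.congr (hr₈ 0 (by simp)) (ha₈ 0 (by simp))
    refine Runs.seq (propose_runs (L := 0) (J := fun mB mA =>
        IsTight n (fun k i => e i k) w u mB mA ∧ ∀ i < n, u i = 0 → mA i = σ₈.arr 1 i)
      (b := false) (A := 2) (B := 1) (V := 8)
      (by simp) (by simp) (by simp) (by simp) (by simp) (by simp) hnW (Nat.zero_le _)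
      (fun mA mB i k hm hJ hi hk hfree he => by
        obtain ⟨h1, h2⟩ := hJ.1.take hm hi hk hfree he
        refine ⟨h1, fun b hb hub => ?_⟩
        rw [Function.update_of_ne (by rintro rfl; omega)]
        exact hJ.2 b hb hub) σ₈ htab₈.transpose
      ((hr₈ 1 (by simp)).trans hr₇) hp₈.isMatch.symm
      ⟨hp₈.prop.symm hp₈.isMatch, fun _ _ _ => rfl⟩) fun σ₉ ⟨hp₉, hr₉, ha₉⟩ => ?_
    have htab₉ := htab₈.congr (hr₉ 0 (by simp)) (ha₉ 0 (by simp))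
    refine Runs.seq (complete_runs hnW σ₉ htab₉.1 hp₉.isMatch.symm)
      fun σ' ⟨⟨hm', hall', hext'⟩, hr', ha'⟩ => ?_
    have htab' := htab₉.congr (hr' 0 (by simp)) (ha' 0 (by simp))
    have h7' : σ₇.arr 7 = σ.arr 7 := by
      rw [ha₇, ha₆ 7 (by simp), ha₅ 7 (by simp), hA₄ 7 (by simp) (by simp) (by simp)]
    have h8' : σ₈.arr 8 = σ.arr 8 := by
      rw [ha₈ 8 (by simp), ha₇, ha₆ 8 (by simp), ha₅ 8 (by simp),
        hA₄ 8 (by simp) (by simp) (by simp)]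
    have hpar' : σ'.arr 5 = σ₆.arr 5 := by
      rw [ha' 5 (by simp), ha₉ 5 (by simp), ha₈ 5 (by simp), ha₇]
    have h7'' : ∀ i < n, σ'.arr 7 i = σ.arr 7 i := fun i hi => by
      rw [ha' 7 (by simp), ha₉ 7 (by simp), ← h7']
      exact le_antisymm ((hp₈.lev_le i hi).elim id (fun h => h.trans (Nat.zero_le _)))
        (hp₈.lev_ge i hi)
    have h8'' : ∀ k < n, σ'.arr 8 k = σ.arr 8 k := fun k hk => by
      rw [ha' 8 (by simp), ← h8']
      exact le_antisymm ((hp₉.lev_le k hk).elim id (fun h => h.trans (Nat.zero_le _)))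
        (hp₉.lev_ge k hk)
    rw [h7'] at hp₈
    rw [h8'] at hp₉
    refine (updatePotentials_runs hW σ' htab' hm' hall' (fun i hi => (h7'' i hi).trans_le (h7 i hi))
      (fun k hk => (h8'' k hk).trans_le (h8 k hk))).frame.mono le_rfl
      fun τ ⟨⟨hf, hg⟩, _, hτ⟩ => ⟨u, w, ?_⟩
    have hτ₁ : τ.arr 1 = σ'.arr 1 := hτ 1 (by simp [updatePotentials, Cmd.arrs])
    rw [hτ₁, ← hw]
    rw [hpar'] at hf hg
    refine stepSpec_of_phases hp₈ hp₉ ?_ hp₉.prop.2 hm' hall' hext' (fun i hi => ?_)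
      (fun i hi => ?_)
    · rw [hw]
      exact hp₉.prop.1.symm hp₉.isMatch
    · rw [hf i hi, h7'' i hi]
    · rw [← h8'' _ (hall' i hi)]
      exact hg i hi
  refine hmain.frame.mono ?_ fun τ ⟨h1, h2, _⟩ => ⟨?_, h1⟩
  · have hs : n.sqrt + 4 ≤ 2 * (n.sqrt + 2) := by omega
    have h1 : (n + 1) ^ 2 * (n.sqrt + 4) ≤ 2 * ((n + 1) ^ 2 * (n.sqrt + 2)) := by nlinarith
    have h2 : n + 1 ≤ (n + 1) ^ 2 := by nlinarith
    have h3 : 2 * (n + 1) ^ 2 ≤ (n + 1) ^ 2 * (n.sqrt + 2) := by nlinarith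
    omega
  · exact (h2 0 (by simp [stepProgram, sqrtCeil, fill, propose, proposeBody, augment, searchInit,
      search, searchBody, flip, flipBody, complete, updatePotentials, Cmd.regs])).trans htab.1

end StepProgram

/-! ### The online computation -/

section Online

variable {n : ℕ}

/-- The pairs of agents of value `1`, with the agents of both sides numbered from `0`. -/
def HighPair (v : Profile (Fin n) (Fin n)) (i k : ℕ) : Prop :=
  ∃ (hi : i < n) (hk : k < n), v (.inl ⟨i, hi⟩) (.inr ⟨k, hk⟩) = 1

theorem highPair_iff {v : Profile (Fin n) (Fin n)} (i k : Fin n) :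
    HighPair v i k ↔ v (.inl i) (.inr k) = 1 :=
  ⟨fun ⟨_, _, h⟩ => h, fun h => ⟨i.2, k.2, h⟩⟩

/-- The cells `i * n + k` of the table are distinct. -/
theorem hasTable_load (v : Profile (Fin n) (Fin n)) {σ : State} (hσ : σ.reg 0 = n) :
    HasTable true n (HighPair v) (σ.load (valueTable v)) := by
  refine ⟨hσ, fun i hi k hk => ?_⟩
  have harr : (σ.load (valueTable v)).arr 0 = valueTable v := by simp [State.load]
  rw [harr, if_pos rfl]
  unfold valueTable
  rw [ite_ne_right_iff, and_iff_left one_ne_zero]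
  constructor
  · rintro ⟨i', k', h, hv⟩
    have hn : 0 < n := by omega
    have hi' : i = i' := by
      have := congrArg (· / n) h
      simpa [add_comm _ k, add_comm _ (k' : ℕ), Nat.add_mul_div_right _ _ hn,
        Nat.div_eq_of_lt hk, Nat.div_eq_of_lt k'.2] using this
    have hk' : k = k' := by
      rw [hi'] at h
      omega
    rw [hi', hk']
    exact (highPair_iff _ _).2 hv
  · rintro ⟨hi, hk, h⟩
    exact ⟨⟨i, hi⟩, ⟨k, hk⟩, rfl, h⟩

/-- Register `0` holds `n`, and the counters are at most `t`. -/
def Ready (n t : ℕ) (σ : State) : Prop :=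
  σ.reg 0 = n ∧ (∀ i < n, σ.arr 7 i ≤ t) ∧ ∀ k < n, σ.arr 8 k ≤ t

theorem StepSpec.surjective {e : ℕ → ℕ → Prop} {f g x f' g' u w : ℕ → ℕ}
    (h : StepSpec n e f g x f' g' u w) {k : ℕ} (hk : k < n) : ∃ i < n, x i = k := by
  have hinj : Function.Injective fun i : Fin n => (⟨x i, h.lt i i.2⟩ : Fin n) := fun i j hij =>
    Fin.ext (h.inj i i.2 j j.2 (by simpa using hij))
  obtain ⟨i, hi⟩ := Finite.surjective_of_injective hinj ⟨k, hk⟩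
  exact ⟨i, i.2, by simpa using hi⟩

theorem exists_step (hn : 1 ≤ n) (v : Profile (Fin n) (Fin n)) (t : ℕ) (σ : State)
    (hσ : Ready n t σ) : ∃ (T : ℕ) (τ : State),
      Exec (n + t + 2) stepProgram (σ.load (valueTable v)) T τ ∧
      T ≤ 3000 * ((n + 1) ^ 2 * (n.sqrt + 2)) ∧ Ready n (t + 1) τ ∧
      ∃ u w, StepSpec n (HighPair v) (σ.arr 7) (σ.arr 8) (τ.arr 1) (τ.arr 7) (τ.arr 8) u w := by
  obtain ⟨T, τ, hx, hT, h0, u, w, h⟩ := stepProgram_runs hn le_rfl (σ.load (valueTable v))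
    (hasTable_load v hσ.1) hσ.2.1 hσ.2.2
  refine ⟨T, τ, hx, hT, ⟨h0, fun i hi => ?_, fun k hk => ?_⟩, u, w, h⟩
  · have h1 := h.counter i hi
    have h2 : (σ.load (valueTable v)).arr 7 i ≤ t := hσ.2.1 i hi
    omega
  · obtain ⟨i, hi, rfl⟩ := h.surjective hk
    have h1 := h.counter' i hi
    have h2 : (σ.load (valueTable v)).arr 8 (τ.arr 1 i) ≤ t := hσ.2.2 _ hk
    omega

/-- The counters of a time step and the potentials add up to the number of steps, so that
stability with respect to the counters is what `isRun_of_potential` asks for. -/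
theorem exists_online_run (hn : 1 ≤ n) {a : ℝ} (ha : a < 1) {v : DynProfile (Fin n) (Fin n)}
    (hb : IsBinary a v) (hs : IsSymmetric v) :
    ∃ (x : ℕ → PerfectMatching (Fin n) (Fin n)) (T : ℕ → ℕ), IsRun a v x ∧
      Computes stepProgram 1 v x T ∧ ∀ t, T t ≤ 3000 * ((n + 1) ^ 2 * (n.sqrt + 2)) := by
  choose! T next hexec hT hready u w hspec using fun t σ => exists_step hn (v t) t σ
  let σ : ℕ → State := fun t => Nat.rec (initState n) (fun t σ => next t σ) t
  have hσ : ∀ t, Ready n t (σ t) := fun t => by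
    induction t with
    | zero => exact ⟨rfl, fun _ _ => le_rfl, fun _ _ => le_rfl⟩
    | succ t ih => exact hready t _ ih
  have hstep : ∀ t, StepSpec n (HighPair (v t)) ((σ t).arr 7) ((σ t).arr 8) ((σ (t + 1)).arr 1)
      ((σ (t + 1)).arr 7) ((σ (t + 1)).arr 8) (u t (σ t)) (w t (σ t)) :=
    fun t => hspec t _ (hσ t)
  let x : ℕ → PerfectMatching (Fin n) (Fin n) := fun t =>
    Equiv.ofBijective (fun i => ⟨(σ (t + 1)).arr 1 i, (hstep t).lt i i.2⟩)
      (Finite.injective_iff_bijective.1 fun i j hij =>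
        Fin.ext ((hstep t).inj i i.2 j j.2 (by simpa using hij)))
  have hx : ∀ t i, (x t i : ℕ) = (σ (t + 1)).arr 1 i := fun _ _ => rfl
  let d : ℕ → Fin n ⊕ Fin n → ℕ := fun t =>
    Sum.elim (fun i => u t (σ t) i) fun k => w t (σ t) k
  have hlikes : ∀ t (i k : Fin n), likes (v t) (.inl i) (.inr k) = 1 ↔ HighPair (v t) i k :=
    fun t i k => by rw [highPair_iff]; simp [likes]
  have hlikes' : ∀ t (i k : Fin n), likes (v t) (.inl i) (.inr k) = 0 ↔ ¬ HighPair (v t) i k :=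
    fun t i k => by rw [highPair_iff]; simp [likes]
  have hcomm : ∀ t (i k : Fin n),
      likes (v t) (.inr k) (.inl i) = likes (v t) (.inl i) (.inr k) :=
    fun t i k => hs.likes_comm t id
  have hcover : ∀ t (i k : Fin n),
      likes (v t) (.inl i) (.inr k) ≤ d t (.inl i) + d t (.inr k) := fun t i k => by
    by_cases h : HighPair (v t) i k
    · rw [(hlikes t i k).2 h]
      exact (hstep t).cover i i.2 k k.2 h
    · rw [(hlikes' t i k).2 h]
      exact Nat.zero_le _
  have htight : ∀ t (i : Fin n),
      likes (v t) (.inl i) (.inr (x t i)) = d t (.inl i) + d t (.inr (x t i)) := fun t i => by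
    by_cases h : HighPair (v t) i (x t i)
    · rw [(hlikes t i _).2 h]
      exact ((hstep t).tight i i.2 h).symm
    · rw [(hlikes' t i _).2 h]
      exact ((hstep t).tight' i i.2 h).symm
  have hd : ∀ t, IsDual (v t) (d t) (x t) := fun t => by
    refine ⟨?_, ?_⟩
    · rintro (i | k) (i' | k') h
      · exact absurd trivial h
      · exact hcover t i k'
      · rw [hcomm, add_comm]
        exact hcover t i' k
      · exact absurd trivial h
    · rintro (i | k)
      · exact htight t i
      · obtain ⟨i, rfl⟩ := (x t).surjective k
        simp only [partner, Equiv.symm_apply_apply]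
        rw [hcomm, add_comm]
        exact htight t i
  have hpot₁ : ∀ t (i : Fin n), (σ t).arr 7 i + potential d x t (.inl i) = t := fun t i => by
    induction t with
    | zero => simp [σ, initState, potential]
    | succ t ih =>
      have h : (σ (t + 1)).arr 7 i + d t (.inr (x t i)) = (σ t).arr 7 i + 1 :=
        (hstep t).counter i i.2
      have : potential d x (t + 1) (.inl i) = potential d x t (.inl i) + d t (.inr (x t i)) :=
        Finset.sum_range_succ _ _
      omega
  have hpot₂ : ∀ t (k : Fin n), (σ t).arr 8 k + potential d x t (.inr k) = t := fun t k => by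
    induction t with
    | zero => simp [σ, initState, potential]
    | succ t ih =>
      have hk : x t ((x t).symm k) = k := (x t).apply_symm_apply k
      have h := (hstep t).counter' _ ((x t).symm k).2
      rw [← hx, hk] at h
      have h : (σ (t + 1)).arr 8 k + d t (.inl ((x t).symm k)) = (σ t).arr 8 k + 1 := h
      have : potential d x (t + 1) (.inr k) =
          potential d x t (.inr k) + d t (.inl ((x t).symm k)) :=
        Finset.sum_range_succ _ _
      omega
  refine ⟨x, fun t => T t (σ t), isRun_of_potential ha hb hs hd ?_,
    ⟨σ, rfl, fun t => ⟨?_, fun i => rfl⟩⟩, fun t => hT t _ (hσ t)⟩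
  · rintro t (i | k) (j | l) hij h0 h1
    · have h := (hstep t).stable i i.2 j j.2 ((hlikes' t i (x t i)).1 h0)
        ((hlikes t i (x t j)).1 h1)
      have := hpot₁ t i
      have := hpot₁ t j
      omega
    · exact hij.elim
    · exact hij.elim
    · simp only [partner] at h0 h1
      rw [hcomm] at h0 h1
      have hk : (σ (t + 1)).arr 1 ((x t).symm k) = k := by
        rw [← hx, Equiv.apply_symm_apply]
      have hl : (σ (t + 1)).arr 1 ((x t).symm l) = l := by
        rw [← hx, Equiv.apply_symm_apply]
      have h := (hstep t).stable' _ ((x t).symm k).2 _ ((x t).symm l).2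
        (by rw [hk]; exact (hlikes' t _ k).1 h0) (by rw [hk]; exact (hlikes t _ k).1 h1)
      rw [hk, hl] at h
      have := hpot₂ t k
      have := hpot₂ t l
      omega
  · rw [pow_one]
    exact hexec t _ (hσ t)

theorem time_bound_le {n : ℕ} (hn : 1 ≤ n) :
    ((3000 * ((n + 1) ^ 2 * (n.sqrt + 2)) : ℕ) : ℝ) ≤ 36000 * (n : ℝ) ^ (2.5 : ℝ) := by
  have hn' : (1 : ℝ) ≤ n := by exact_mod_cast hn
  have h1 : (1 : ℝ) ≤ √n := Real.one_le_sqrt.2 hn'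
  have h2 : (n.sqrt : ℝ) ≤ √n := Real.nat_sqrt_le_real_sqrt
  have h3 : (n : ℝ) ^ (2.5 : ℝ) = n ^ 2 * √n := by
    rw [Real.sqrt_eq_rpow, ← Real.rpow_natCast, ← Real.rpow_add (by linarith)]
    norm_num
  -- The constant is `3000 * 4 * 3`, by `(n + 1) ^ 2 ≤ 4 * n ^ 2` and `√n + 2 ≤ 3 * √n`.
  have h4 : ((n : ℝ) + 1) ^ 2 ≤ 4 * n ^ 2 := by nlinarith
  have h5 : ((n : ℝ) + 1) ^ 2 * (n.sqrt + 2) ≤ 4 * n ^ 2 * (3 * √n) := by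
    gcongr
    linarith
  rw [h3]
  push_cast
  linarith

end Online

end RepeatedMatching

open RepeatedMatching

/-- For dynamic, additive, binary and symmetric valuations: the algorithm never gets stuck and
each of its while loops stops after at most `2 n ^ 2` swaps, whatever maximum weight matchings and
swaps are chosen; each sequence that it produces is EF1-over-rounds and consists of maximum weight
matchings; and it can be implemented in time `O(n ^ 2.5)` per time step. -/
theorem theorem1 :
    (∀ (N M : Type*) [Fintype N] [Fintype M] [DecidableEq N] [DecidableEq M]
      (n : ℕ), Fintype.card N = n → Fintype.card M = n →
      ∀ a : ℝ, 0 ≤ a → a < 1 →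
      ∀ v : DynProfile N M, IsBinary a v → IsSymmetric v →
        (∃ x, IsRun a v x) ∧
        (∀ (x : ℕ → PerfectMatching N M) (t : ℕ), (∀ s < t, IsAlgStep a v x s) →
          ∀ (k : ℕ) (y : ℕ → PerfectMatching N M), IsMaxWeight (v t) (y 0) →
            (∀ m < k, LoopStep a v x t (y m) (y (m + 1))) → k ≤ 2 * n ^ 2) ∧
        (∀ x, IsRun a v x → EF1OverRounds v x ∧ ∀ t, IsMaxWeight (v t) (x t))) ∧
    (∃ (P : Cmd) (c : ℕ) (C : ℝ), ∀ n : ℕ, 1 ≤ n →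
      ∀ a : ℝ, 0 ≤ a → a < 1 →
      ∀ v : DynProfile (Fin n) (Fin n), IsBinary a v → IsSymmetric v →
        ∃ (x : ℕ → PerfectMatching (Fin n) (Fin n)) (T : ℕ → ℕ),
          IsRun a v x ∧ Computes P c v x T ∧ ∀ t, (T t : ℝ) ≤ C * (n : ℝ) ^ (2.5 : ℝ)) := by
  refine ⟨fun N M _ _ _ _ n hN hM a ha0 ha v hb hs =>
    ⟨exists_isRun (hN.trans hM.symm) ha hb hs, loop_length_le hN hM ha hb hs,
      fun x h => h.ef1OverRounds_and_isMaxWeight ha0 ha hb hs⟩,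
    stepProgram, 1, 36000, fun n hn a _ ha v hb hs => ?_⟩
  obtain ⟨x, T, hrun, hcomp, hT⟩ := exists_online_run hn ha hb hs
  exact ⟨x, T, hrun, hcomp, fun t => (Nat.cast_le.2 (hT t)).trans (time_bound_le hn)⟩
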